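/- **Objects.** A *rooted bipartite planar map* with $n$ edges is a connected planar map whose vertices are properly coloured black and white, with a distinguished root corner of the outer face at a black vertex, up to orientation-preserving homeomorphism; the only map with $n=0$ is a single black vertex (its outer face has degree $0$). Let $\mathcal M_n$ be the set of these maps. For $M\in\mathcal M_n$ let $\mathbf{black}(M)$, $\mathbf{white}(M)$, $\mathbf{face}(M)$ be the numbers of black vertices, white vertices and faces, and let $\mathbf{outdeg}(M)$ be half the degree of the outer face. For a Dyck path $P$ of size $m$ (with $m$ up steps) let $P_i$ be the part of $P$ strictly between its $i$-th up step and the matching down step, and let $V_P(i)$ be the size of $P_i$. A *new interval* of size $m\ge 1$ is a pair $I=[P,Q]$ of Dyck paths of size $m$ with $V_P(i)\le V_Q(i)$ for $1\le i\le m$ (a Tamari interval), $V_Q(1)=m-1$, and $V_P(i)\le V_Q(i+1)$ whenever $V_Q(i)>0$. Let $\mathcal I_m$ be the set of these. Let $\mathrm{Type}(P)_i$ be $1$ if the $i$-th up step of $P$ is followed by an up step, and $0$ otherwise; let $\mathbf c_{ab}(I)$ be the number of $i$ with $(\mathrm{Type}(P)_i,\mathrm{Type}(Q)_i)=(a,b)$,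 and let $\mathbf{rcont}(I)$ be the number of rising contacts of $P$, i.e. of up steps that start on the axis. **Transformations, through plane trees with edge labels in $\mathbb N$.** *$T_{\mathcal M}$, from maps to trees.* Start at the root vertex, with the edge next to the root corner in clockwise order as pending edge. Let $u$ be the current (black) vertex, $e$ the pending edge and $v$ its white end. If $v$ has degree $1$, then $e$ becomes a tree edge with label $0$ from $u$ to a leaf, and $u$ stays current. If $e$ is another bridge, let $w$ be the black end of the edge after $e$ in clockwise order around $v$; add a tree edge with label $0$ from $u$ to $w$, in the triangle $u,v,w$, and make $w$ current. If $e$ is not a bridge, split $u$ into $u_T$, with the tree edges, and $u_M$, with the remaining map edges; add a tree edge from $u_T$ to its child $u_M$, labelled by half the degree of the face on the other side of $e$ from the outer face; and make $u_M$ current. In all cases delete $e$ from the map. The next pending edge is the next remaining map edge at the current vertex in clockwise order from the new tree edge; if there is none, go back in the tree to the first ancestor that has one. Stop when there is none. *$M_{\mathcal T}$, from trees to maps.* Treat the nodes $c$ other than the root in postorder; let $u$ be the parent of $c$, $a$ the label of the tree edge from $u$ to $c$, and $M_c$ the map already built at $c$. Replace the tree edge by a map edge $x$ as follows. If $c$ is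 a leaf, then $x$ is this edge. If $c$ is not a leaf and $a=0$, then $x$ joins $u$ to the white end of the last edge of $M_c$ in clockwise order around $c$ from the tree edge, and closes an empty triangle with these two edges. If $a>0$, then $x$ joins the corner of $M_c$ immediately clockwise after the tree edge to the corner reached by $2a-1$ steps of a clockwise walk along the outer face of $M_c$, and the tree edge is contracted. *$I_{\mathcal T}$, from trees to intervals.* $Q=uQ'd$, where $Q'$ is the contour path of the tree. For $P$, treat the nodes in reverse preorder, all initially black. The certificate of a node whose leftmost descending edge has label $0$, or of a leaf, is the node itself. If this label is $a>0$, visit the nodes after it in preorder and colour the visited black ones red, until just before the $(a+1)$-st black one; the last visited node is the certificate. Then $P$ is the concatenation of $u\,d^{c(v)}$ over all nodes $v$ in preorder, where $c(v)$ is the number of nodes with certificate $v$. *$T_{\mathcal I}$, from intervals to trees.* For $Q=uQ'd$, take the plane tree with contour $Q'$; label the leftmost descending edge of its $i$-th node in preorder by the number of rising contacts of $P_i$, and all other edges by $0$. **Theorem.** For every $n\ge 0$, $I_{\mathcal M}=I_{\mathcal T}\circ T_{\mathcal M}$ is a well-defined bijection from $\mathcal M_n$ to $\mathcal I_{n+1}$,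 and $M_{\mathcal I}=M_{\mathcal T}\circ T_{\mathcal I}$ is its inverse. For $M\in\mathcal M_n$ and $I=I_{\mathcal M}(M)$, $$\mathbf{face}(M)=1+\mathbf c_{11}(I),\qquad \mathbf{outdeg}(M)=\mathbf{rcont}(I)-1,$$ and, if $n\ge 1$, $$\mathbf{white}(M)=\mathbf c_{00}(I),\qquad \mathbf{black}(M)=\mathbf c_{01}(I).$$ -/

import Mathlib

open Equiv DyckStep

/-! ### Bipartite planar maps

A bipartite map with edge set `E` is encoded by its rotation system: the permutation `black` sends
an edge to the next edge in clockwise order around its black end, and `white` to the next edge in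
clockwise order around its white end. -/

/-- A bipartite map with edge set `E`, as a rotation system. -/
structure BipMap (E : Type) where
  /-- next edge in clockwise order around the black end -/
  black : Perm E
  /-- next edge in clockwise order around the white end -/
  white : Perm E

namespace BipMap

variable {E : Type} (M : BipMap E)

/-- The black vertices incident to an edge are the cycles of `black`. -/
def BlackVertex : Type := Quotient (Perm.SameCycle.setoid M.black)

/-- The white vertices incident to an edge are the cycles of `white`. -/
def WhiteVertex : Type := Quotient (Perm.SameCycle.setoid M.white)

/-- Walk along an edge from its black end to its white end, then along the next edge in clockwise
order to its black end: the next edge to be walked in the same way, always with the same face on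
the left. -/
def facePerm : Perm E := M.black * M.white

/-- The faces incident to an edge are the cycles of `facePerm`. A cycle of length `k` is a face of
degree `2 * k`, the one to the left of its edges when they are walked from black to white. -/
def Face : Type := Quotient (Perm.SameCycle.setoid M.facePerm)

/-- The vertices incident to an edge. -/
abbrev Vertex : Type := M.BlackVertex ⊕ M.WhiteVertex

/-- The black end of an edge. -/
def blackEnd (e : E) : M.Vertex := Sum.inl (Quotient.mk _ e)

/-- The white end of an edge. -/
def whiteEnd (e : E) : M.Vertex := Sum.inr (Quotient.mk _ e)

/-- Two vertices are joined by a path that uses only edges in `S`. -/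
def JoinedBy (S : Set E) : M.Vertex → M.Vertex → Prop :=
  Relation.EqvGen fun p q => ∃ f ∈ S, p = M.blackEnd f ∧ q = M.whiteEnd f

/-- The map is connected. -/
def Connected : Prop := ∀ p q : M.Vertex, M.JoinedBy Set.univ p q

/-- The edge `e` is a bridge: its ends are no longer joined once it is removed. -/
def IsBridge (e : E) : Prop := ¬ M.JoinedBy {e}ᶜ (M.blackEnd e) (M.whiteEnd e)

/-- Deletion of an edge `e`: it is cut out of the rotations at both of its ends. The edge set `E` is
not changed; a deleted edge is fixed by both permutations, thus detached from all other edges. -/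
def delete [DecidableEq E] (e : E) : BipMap E where
  black := M.black * swap e (M.black⁻¹ e)
  white := M.white * swap e (M.white⁻¹ e)

/-- The edge that follows `e` in clockwise order around its black end, if there is another one. -/
def nextBlack [DecidableEq E] (e : E) : Option E :=
  if M.black e = e then none else some (M.black e)

end BipMap

/-- A bipartite map with a root corner at a black vertex, given by the edge that is next to the root
corner in clockwise order. The map without edges, a single black vertex, has `root = none`. -/
structure RootedBipMap (E : Type) extends BipMap E where
  /-- the edge next to the root corner in clockwise order -/
  root : Option E

namespace RootedBipMap

variable {E E' : Type}

open Classical in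
/-- Number of black vertices. The map without edges has one. -/
noncomputable def numBlack (M : RootedBipMap E) : ℕ :=
  if IsEmpty E then 1 else Nat.card M.BlackVertex

/-- Number of white vertices. -/
noncomputable def numWhite (M : RootedBipMap E) : ℕ := Nat.card M.WhiteVertex

open Classical in
/-- Number of faces. The map without edges has one. -/
noncomputable def numFace (M : RootedBipMap E) : ℕ :=
  if IsEmpty E then 1 else Nat.card M.Face

/-- Half-degree of the outer face, the face that contains the root corner. -/
noncomputable def outdeg (M : RootedBipMap E) : ℕ :=
  match M.root with
  | none => 0
  | some r => Function.minimalPeriod M.facePerm r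

/-- The map is connected and planar (Euler's formula), and it has a root if it has an edge. -/
structure IsPlanar (M : RootedBipMap E) : Prop where
  connected : M.Connected
  euler : M.numBlack + M.numWhite + M.numFace = Nat.card E + 2
  rooted : Nonempty E → M.root ≠ none

/-- Two rooted bipartite maps are the same up to the names of their edges. -/
def Iso (M : RootedBipMap E) (N : RootedBipMap E') : Prop :=
  ∃ τ : E ≃ E', (∀ e, N.black (τ e) = τ (M.black e)) ∧ (∀ e, N.white (τ e) = τ (M.white e)) ∧
    N.root = M.root.map τ

end RootedBipMap

/-- Rooted bipartite planar maps with `n` edges, which are named `0, …, n - 1`. -/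
def LabelledMap (n : ℕ) : Type := {M : RootedBipMap (Fin n) // M.IsPlanar}

/-- Equality up to the names of the edges. -/
instance LabelledMap.setoid (n : ℕ) : Setoid (LabelledMap n) where
  r M N := M.1.Iso N.1
  iseqv :=
    { refl := fun M => ⟨Equiv.refl _, by simp, by simp, by simp⟩
      symm := by
        rintro M N ⟨τ, hb, hw, hr⟩
        refine ⟨τ.symm, fun e => ?_, fun e => ?_, ?_⟩
        · have h := hb (τ.symm e)
          rw [Equiv.apply_symm_apply] at h
          rw [h, Equiv.symm_apply_apply]
        · have h := hw (τ.symm e)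
          rw [Equiv.apply_symm_apply] at h
          rw [h, Equiv.symm_apply_apply]
        · rw [hr, Option.map_map]; simp
      trans := by
        rintro M N K ⟨τ, hb, hw, hr⟩ ⟨τ', hb', hw', hr'⟩
        refine ⟨τ.trans τ', fun e => ?_, fun e => ?_, ?_⟩
        · simp [hb, hb']
        · simp [hw, hw']
        · rw [hr', hr, Option.map_map]; rfl }

/-- The set of rooted bipartite planar maps with `n` edges. -/
def PlanarMap (n : ℕ) : Type := Quotient (LabelledMap.setoid n)

/-! ### Dyck paths and new intervals

Up steps are numbered from `0`. -/

/-- The part of a path after its `i`-th up step. -/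
def afterUp : ℕ → List DyckStep → List DyckStep
  | _, [] => []
  | i, D :: l => afterUp i l
  | 0, U :: l => l
  | i + 1, U :: l => afterUp i l

/-- The longest initial part of a path that starts at height `h` and stays at heights `≥ 0`. -/
def untilBelow : ℕ → List DyckStep → List DyckStep
  | _, [] => []
  | 0, D :: _ => []
  | h + 1, D :: l => D :: untilBelow h l
  | h, U :: l => U :: untilBelow (h + 1) l

/-- The part of a path strictly between its `i`-th up step and the matching down step. -/
def matchedPart (l : List DyckStep) (i : ℕ) : List DyckStep := untilBelow 0 (afterUp i l)

/-- The number of rising contacts of a path: the number of its up steps that start on the axis. -/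
def risingContacts (l : List DyckStep) : ℕ :=
  ((Finset.range l.length).filter fun k =>
    l[k]? = some U ∧ (l.take k).count U = (l.take k).count D).card

namespace DyckWord

/-- The bracket vector: the size of the path between the `i`-th up step and the matching down
step. -/
def bracket (p : DyckWord) (i : ℕ) : ℕ := (matchedPart p.toList i).count U

/-- The `i`-th letter of the type of `p` is `1`: the `i`-th up step is followed by an up step. -/
def TypeOne (p : DyckWord) (i : ℕ) : Prop := (afterUp i p.toList).head? = some U

instance (p : DyckWord) (i : ℕ) : Decidable (p.TypeOne i) :=
  inferInstanceAs (Decidable (_ = _))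

end DyckWord

/-- New intervals of size `n` in the Tamari lattice. -/
@[ext]
structure NewInterval (n : ℕ) where
  /-- the lower path `P` -/
  lower : DyckWord
  /-- the upper path `Q` -/
  upper : DyckWord
  lower_size : lower.semilength = n
  upper_size : upper.semilength = n
  tamari : ∀ i < n, lower.bracket i ≤ upper.bracket i
  bracket_first : upper.bracket 0 + 1 = n
  bracket_next : ∀ i < n, 0 < upper.bracket i → lower.bracket i ≤ upper.bracket (i + 1)

namespace NewInterval

variable {n : ℕ} (I : NewInterval n)

/-- The number of indices where the types of the lower and the upper path are `0` and `0`. -/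
def c00 : ℕ :=
  ((Finset.range n).filter fun i => ¬ I.lower.TypeOne i ∧ ¬ I.upper.TypeOne i).card

/-- The number of indices where the types of the lower and the upper path are `0` and `1`. -/
def c01 : ℕ :=
  ((Finset.range n).filter fun i => ¬ I.lower.TypeOne i ∧ I.upper.TypeOne i).card

/-- The number of indices where the types of the lower and the upper path are `1` and `1`. -/
def c11 : ℕ :=
  ((Finset.range n).filter fun i => I.lower.TypeOne i ∧ I.upper.TypeOne i).card

/-- The number of rising contacts of the lower path. -/
def rcont : ℕ := risingContacts I.lower.toList

end NewInterval

/-! ### Edge-labelled plane trees -/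

/-- Plane trees with edges labelled by natural numbers. `point` is the tree with one node. In
`graft a c r` the leftmost descending edge of the root has label `a` and leads to the root of `c`,
and `r` is what remains when this edge and `c` are removed. -/
inductive EdgeTree : Type
  | point : EdgeTree
  | graft (a : ℕ) (c r : EdgeTree) : EdgeTree

/-! ### From maps to trees: exploration of a map

The stack holds the nodes of the leftmost branch of the partial tree, the current one on top. -/

/-- A node on the leftmost branch of the partial tree. -/
structure Frame (E : Type) where
  /-- the next remaining edge of the map around this node, in clockwise order from the last
  tree edge -/
  pending : Option E
  /-- the part of the tree below this node that is finished -/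
  built : EdgeTree
  /-- the label of the tree edge to the parent -/
  label : ℕ

/-- The remaining map and the leftmost branch of the partial tree. -/
structure Exploration (E : Type) where
  map : BipMap E
  stack : List (Frame E)

open Classical in
/-- One step of the exploration. If the current node `u` has a pending edge `e`, with white end `v`:
* if `v` has degree one, `e` becomes a tree edge with label `0` to a leaf, and `u` stays current;
* if `e` is another bridge, let `w` be the black end of the edge next to `e` around `v`: it becomes
  a child of `u` by an edge with label `0`, and the current node;
* if `e` is not a bridge, `u` is split, the part with the remaining edges of the map becomes a child
  of the part with the tree edges and the current node, and the new edge gets as its label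
  the half-degree of the face on the other side of `e`;

and `e` is deleted. If the current node has no pending edge, go back to its parent. -/
noncomputable def Exploration.step {E : Type} [DecidableEq E] : Exploration E → Exploration E
  | ⟨M, ⟨some e, t, l⟩ :: s⟩ =>
    if M.white e = e then
      ⟨M.delete e, ⟨M.nextBlack e, .graft 0 .point t, l⟩ :: s⟩
    else if M.IsBridge e then
      ⟨M.delete e, ⟨some ((M.delete e).black (M.white e)), .point, 0⟩ ::
        ⟨M.nextBlack e, t, l⟩ :: s⟩
    else
      ⟨M.delete e, ⟨some (M.black e), .point, Function.minimalPeriod M.facePerm (M.black e)⟩ ::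
        ⟨none, t, l⟩ :: s⟩
  | ⟨M, ⟨none, t, l⟩ :: ⟨p, t', l'⟩ :: s⟩ => ⟨M, ⟨p, .graft l t t', l'⟩ :: s⟩
  | S => S

/-- The tree of an exploration that is over. -/
def Exploration.result {E : Type} (S : Exploration E) : EdgeTree :=
  match S.stack with
  | [] => .point
  | f :: _ => f.built

/-- The edge-labelled tree of a rooted bipartite planar map. Every edge is deleted in one step and
every node but the root is left at most once, so the exploration is over after `2 * n` steps. -/
noncomputable def RootedBipMap.toTree {n : ℕ} (M : RootedBipMap (Fin n)) : EdgeTree :=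
  (Exploration.step^[2 * n] ⟨M.toBipMap, [⟨M.root, .point, 0⟩]⟩).result

/-! ### From trees to maps -/

namespace EdgeTree

/-- The set of edges. -/
def Edge : EdgeTree → Type
  | point => Empty
  | graft _ c r => Option (c.Edge ⊕ r.Edge)

instance decidableEqEdge : (t : EdgeTree) → DecidableEq t.Edge
  | point => inferInstanceAs (DecidableEq Empty)
  | graft _ c r =>
    haveI := decidableEqEdge c
    haveI := decidableEqEdge r
    inferInstanceAs (DecidableEq (Option (c.Edge ⊕ r.Edge)))

end EdgeTree

/-- For `x` and `y` in different cycles of `σ`, the permutation where the cycle that starts at `x` is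
inserted into the cycle of `y`, immediately before `y`. -/
def splice {E : Type} [DecidableEq E] (σ : Perm E) (x y : E) : Perm E :=
  σ * swap (σ⁻¹ x) (σ⁻¹ y)

/-- The rooted bipartite map of an edge-labelled tree `graft a c r`, from those of `c` and `r`. The
edge of the tree from the root of `c` to its parent is replaced by an edge `x` of the map, which
comes, around the parent, after all the edges of the map of `r`. Write `rc` for the root edge of the
map of `c`.
* If `c` is a single node, `x` leads to a new white vertex of degree one.
* Otherwise, if `a = 0`, then `x` leads to the white end of the last edge around the root of `c`,
  and comes immediately before that edge.
* If `a > 0`, the root of `c` is identified with its parent and `x` comes immediately before `rc`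
  there; the other end of `x` is the corner of the outer face that is reached from the root corner
  by a clockwise walk along `2 * a - 1` edges, which ends on the white end of the `a`-th edge of the
  outer face. -/
def EdgeTree.toMap : (t : EdgeTree) → RootedBipMap t.Edge
  | .point => { black := 1, white := 1, root := none }
  | .graft a c r =>
    let x : (EdgeTree.graft a c r).Edge := (none : Option (c.Edge ⊕ r.Edge))
    let inC : c.Edge → (EdgeTree.graft a c r).Edge := fun e => some (Sum.inl e)
    let inR : r.Edge → (EdgeTree.graft a c r).Edge := fun e => some (Sum.inr e)
    let b : Perm (EdgeTree.graft a c r).Edge :=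
      optionCongr (sumCongr c.toMap.black r.toMap.black)
    let w : Perm (EdgeTree.graft a c r).Edge :=
      optionCongr (sumCongr c.toMap.white r.toMap.white)
    let M : BipMap (EdgeTree.graft a c r).Edge :=
      match c.toMap.root with
      | none => ⟨b, w⟩
      | some rc =>
        if a = 0 then ⟨b, splice w x (b⁻¹ (inC rc))⟩
        else ⟨splice b x (inC rc), splice w x (w (inC ((c.toMap.facePerm ^ (a - 1)) rc)))⟩
    match r.toMap.root with
    | none => { M with root := some x }
    | some rr => { M with black := splice M.black x (inR rr), root := some (inR rr) }

/-! ### From trees to intervals -/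

namespace EdgeTree

/-- The sequence of steps in a traversal of the tree: down an edge of the tree is an up step. -/
def contour : EdgeTree → List DyckStep
  | point => []
  | graft _ c r => U :: c.contour ++ D :: r.contour

/-- The label of the leftmost descending edge of the root (`0` if there is none). -/
def rootLabel : EdgeTree → ℕ
  | point => 0
  | graft a _ _ => a

/-- The labels of the leftmost descending edges of all nodes but the root, in preorder. -/
def lowerLabels : EdgeTree → List ℕ
  | point => []
  | graft _ c r => c.rootLabel :: c.lowerLabels ++ r.lowerLabels

/-- The labels of the leftmost descending edges of all nodes, in preorder (`0` for leaves). -/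
def labels (t : EdgeTree) : List ℕ := t.rootLabel :: t.lowerLabels

end EdgeTree

/-- Given the colours of a sequence of nodes (`true` for black), visit them in order and colour each
visited black node red; stop just before the `(a + 1)`-st black node. Returns the number of visited
nodes and the new colours. -/
def visit : ℕ → List Bool → ℕ × List Bool
  | _, [] => (0, [])
  | a, false :: l => ((visit a l).1 + 1, false :: (visit a l).2)
  | 0, true :: l => (0, true :: l)
  | a + 1, true :: l => ((visit a l).1 + 1, false :: (visit a l).2)

/-- Process nodes in reverse preorder, given the labels of their leftmost descending edges. Returns,
for every node, how far behind it in preorder its certificate is, and the colours of the nodes. -/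
def certify : List ℕ → List ℕ × List Bool
  | [] => ([], [])
  | a :: l =>
    let s := certify l
    let v := if a = 0 then (0, s.2) else visit a s.2
    (v.1 :: s.1, true :: v.2)

namespace EdgeTree

/-- The position in preorder of the certificate of the `i`-th node. -/
def certificate (t : EdgeTree) (i : ℕ) : ℕ := i + (certify t.labels).1.getD i 0

/-- The number of nodes whose certificate is the `j`-th node. -/
def certCount (t : EdgeTree) (j : ℕ) : ℕ :=
  ((Finset.range t.labels.length).filter fun i => t.certificate i = j).card

/-- The lower path of the interval of a tree. -/
def lowerPath (t : EdgeTree) : List DyckStep :=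
  (List.range t.labels.length).flatMap fun j => U :: List.replicate (t.certCount j) D

/-- The upper path of the interval of a tree. -/
def upperPath (t : EdgeTree) : List DyckStep := U :: t.contour ++ [D]

end EdgeTree

/-! ### From intervals to trees -/

/-- The plane tree with the given shape, read as first subtree and remaining tree, where the
leftmost descending edge of the root has label `a`, the leftmost descending edge of any other node
`j` (in preorder) has label `f j`, and all other edges have label `0`. The nodes other than the root
are numbered from `i` on. -/
def labelFrom (f : ℕ → ℕ) : ℕ → ℕ → BinaryTree Unit → EdgeTree
  | _, _, .nil => .point
  | a, i, .node _ c r =>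
    .graft a (labelFrom f (f i) (i + 1) c) (labelFrom f 0 (i + 1 + c.numNodes) r)

/-- The edge-labelled tree of a new interval with upper path `Q = U Q' D`: its shape is the plane
tree with contour `Q'`, and the leftmost descending edge of the `i`-th node is labelled by
the number of rising contacts of the part of the lower path between its `i`-th up step and
the matching down step. -/
def NewInterval.toTree {n : ℕ} (I : NewInterval n) : EdgeTree :=
  let f := fun i => risingContacts (matchedPart I.lower.toList i)
  labelFrom f (f 0) 1 I.upper.insidePart.toTree

/-! Both halves of the bijection pass through degree trees (`IsDegree`): only leftmost edges may
have a nonzero label, and a label is at most the `excess` of its lower end, which is the half-degree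
of the outer face of the map built there (`outdeg_toMap`).

Maps and degree trees. `toMap` repeatedly applies `attach`, which adds one edge to a disjoint union
of two maps. Attachments on the two sides of the root corner commute, so the rightmost child may be
attached last (`toMap_append`); deletion of the root edge then undoes this attachment, and the
exploration of the map of a degree tree returns the tree (`explore`). Conversely, deletion of root
edges shows that every map of genus zero comes from a degree tree (`exists_embedsAt`). A bridge
separates two smaller maps. For any other edge planarity is decisive: its two sides lie in different
faces. If the face on the other side has half-degree `a`, the walk along it becomes an initial part
of the outer walk of the remaining map, so `a` is at most the new outer half-degree and it
determines the white end of the deleted edge.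

Genus zero is equality in Euler's inequality (`euler_le`), for all components at once. Every
operation on maps is a product with transpositions, each of which merges two cycles or splits one.
Deleted edges stay in the edge set as isolated edges, so partial maps are handled as embedded parts
(`EmbedsAt`) of a map with a fixed edge set.

Degree trees and intervals. The labels in preorder are the numbers of children of the nodes of a
plane forest, and the lower path is its contour: in the certificate procedure the black nodes are
the roots of the forest decoded so far, and a certificate is the last descendant of its node
(`certify_eq`). The labels of a degree tree `c` decode to `c.excess + 1` trees with `c.size + 1`
nodes in total (`IsDegree.labels_join`). A label `a` above `c` thus satisfies `a ≤ c.excess` exactly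
when it leaves out one of these trees, that is, when it takes at most `c.size` nodes. This is the
inequality of new intervals between consecutive brackets.

White vertices come from leaves, black vertices from inner nodes with label `0`, and the outer
half-degree from the roots of the forest. The number of faces then follows from Euler's formula. -/

set_option linter.unusedSectionVars false

/-! ### Gluing two classes of an equivalence relation -/

namespace Setoid

variable {E : Type*}

open Classical in
/-- The finest equivalence relation that relates `x` and `y`. -/
noncomputable def pair (x y : E) : Setoid E := ker fun a => if a = y then x else a

theorem pair_rel (x y : E) : pair x y x y := by
  rw [pair, ker_def]; split_ifs <;> simp_all

theorem pair_le {s : Setoid E} {x y : E} (h : s x y) : pair x y ≤ s := by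
  intro a b hab
  rw [pair, ker_def] at hab
  split_ifs at hab with h1 h2 h2
  · exact h1 ▸ h2 ▸ s.refl' y
  · exact h1 ▸ hab ▸ s.symm' h
  · exact h2 ▸ hab ▸ h
  · exact hab ▸ s.refl' a

theorem sup_pair_of_rel {s : Setoid E} {x y : E} (h : s x y) : s ⊔ pair x y = s :=
  sup_eq_left.mpr (pair_le h)

-- An explicit model of the join: the class of `y` is renamed to that of `x` and all others keep
-- their names. Classes and their number can be read off from it.
open Classical in
theorem sup_pair_eq_ker (s : Setoid E) (x y : E) :
    s ⊔ pair x y = ker fun a => if s a y then (Quotient.mk s x) else Quotient.mk s a := by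
  apply le_antisymm
  · refine sup_le (fun a b h => ?_) (pair_le ?_)
    · have h1 : s a y ↔ s b y := ⟨fun h' => s.trans' (s.symm' h) h', fun h' => s.trans' h h'⟩
      simp only [ker_def, h1]
      split_ifs
      · rfl
      · exact Quotient.sound h
    · simp only [ker_def, s.refl', if_true]
      split_ifs <;> rfl
  · intro a b h
    simp only [ker_def] at h
    have hs : ∀ {c d}, s c d → (s ⊔ pair x y) c d := fun h => (le_sup_left : s ≤ _) h
    have hp : (s ⊔ pair x y) x y := (le_sup_right : pair x y ≤ _) (pair_rel x y)
    split_ifs at h with h1 h2 h2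
    · exact trans' _ (hs h1) (symm' _ (hs h2))
    · exact trans' _ (hs h1) (trans' _ (symm' _ hp) (hs (Quotient.exact h)))
    · exact symm' _ (trans' _ (hs h2) (trans' _ (symm' _ hp) (hs (Quotient.exact h.symm))))
    · exact hs (Quotient.exact h)

theorem sup_pair_rel_left {s : Setoid E} {x y : E} {a : E} :
    (s ⊔ pair x y) x a ↔ s x a ∨ s y a := by
  classical
  rw [sup_pair_eq_ker, ker_def]
  constructor
  · intro h
    split_ifs at h with h1 h2 h2
    · exact .inr (s.symm' h2)
    · exact .inl (Quotient.exact h)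
    · exact .inr (s.symm' h2)
    · exact .inl (Quotient.exact h)
  · rintro (h | h)
    · have : s x y ↔ s a y := ⟨fun h' => s.trans' (s.symm' h) h', fun h' => s.trans' h h'⟩
      simp only [this]
      split_ifs
      · rfl
      · exact Quotient.sound h
    · rw [if_pos (s.symm' h)]
      split_ifs <;> rfl

theorem card_quotient_sup_pair [Finite E] {s : Setoid E} {x y : E} (h : ¬ s x y) :
    Nat.card (Quotient (s ⊔ pair x y)) + 1 = Nat.card (Quotient s) := by
  classical
  rw [sup_pair_eq_ker, Nat.card_congr (quotientKerEquivRange _)]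
  have : Set.range (fun a => if s a y then (Quotient.mk s x) else Quotient.mk s a)
      = {Quotient.mk s y}ᶜ := by
    ext q
    induction q using Quotient.inductionOn with | _ b =>
    simp only [Set.mem_range, Set.mem_compl_iff, Set.mem_singleton_iff]
    constructor
    · rintro ⟨a, ha⟩ hb
      rw [hb] at ha
      split_ifs at ha with h1
      · exact h (Quotient.exact ha)
      · exact h1 (Quotient.exact ha)
    · intro hb
      exact ⟨b, if_neg fun h' => hb (Quotient.sound h')⟩
  rw [this, ← Set.ncard_add_ncard_compl {Quotient.mk s y}, Set.ncard_singleton,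
    Nat.card_coe_set_eq, add_comm]

end Setoid

/-! ### Cycles of a permutation multiplied by a transposition -/

namespace Equiv.Perm

variable {E : Type*}

theorem sameCycle_setoid_le [Finite E] {σ : Perm E} {s : Setoid E} (h : ∀ a, s a (σ a)) :
    SameCycle.setoid σ ≤ s := by
  intro a b hab
  obtain ⟨i, rfl⟩ := SameCycle.exists_nat_pow_eq hab
  clear hab
  induction i with
  | zero => exact s.refl' a
  | succ i ih => rw [pow_succ']; exact s.trans' ih (h _)

theorem sameCycle_setoid_apply {σ : Perm E} {a b : E} :
    SameCycle.setoid σ a b ↔ SameCycle σ a b := Iff.rfl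

/-- The number of cycles of a permutation, fixed points included. -/
noncomputable def numCycles (σ : Perm E) : ℕ := Nat.card (Quotient (SameCycle.setoid σ))

/-- The two products are conjugate by `τ`. For maps, this means that exchanging the colours keeps
the number of faces. -/
theorem numCycles_mul_comm (σ τ : Perm E) : numCycles (σ * τ) = numCycles (τ * σ) := by
  refine Nat.card_congr (Quotient.congr τ fun a b => ?_)
  change SameCycle _ _ _ ↔ SameCycle _ _ _
  have := sameCycle_conj (f := σ * τ) (g := τ) (x := τ a) (y := τ b)
  simp only [mul_inv_cancel_right, coe_inv, symm_apply_apply, ← mul_assoc] at this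
  exact this.symm

theorem minimalPeriod_eq_ncard [Finite E] (σ : Perm E) (x : E) :
    Function.minimalPeriod σ x = {f | SameCycle σ x f}.ncard := by
  classical
  have := Fintype.ofFinite E
  have h1 := MulAction.minimalPeriod_eq_card (a := σ) (b := x)
  rw [show (fun y => σ • y) = σ from rfl] at h1
  have h2 : MulAction.orbit (Subgroup.zpowers σ) x = {f | SameCycle σ x f} := by
    ext f
    rw [MulAction.mem_orbit_iff]
    constructor
    · rintro ⟨⟨_, i, rfl⟩, rfl⟩
      exact ⟨i, rfl⟩
    · rintro ⟨i, rfl⟩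
      exact ⟨⟨σ ^ i, i, rfl⟩, rfl⟩
  rw [h1, ← Nat.card_eq_fintype_card, h2, Nat.card_coe_set_eq]

theorem minimalPeriod_eq_of_sameCycle [Finite E] {σ : Perm E} {x y : E} (h : SameCycle σ x y) :
    Function.minimalPeriod σ x = Function.minimalPeriod σ y := by
  simp_rw [minimalPeriod_eq_ncard]
  congr 1
  ext f
  exact ⟨h.symm.trans, h.trans⟩

variable [DecidableEq E]

/-- After a step of `σ`, the transposition only exchanges `x` and `y`, which is invisible once they
are glued. Multiplying by the transposition twice gives the reverse inclusion. -/
theorem sup_pair_swap_mul_le [Finite E] (σ : Perm E) (x y : E) :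
    SameCycle.setoid (swap x y * σ) ⊔ .pair x y ≤ SameCycle.setoid σ ⊔ .pair x y := by
  set s := SameCycle.setoid σ ⊔ .pair x y with hs
  have hp : s x y := (le_sup_right : Setoid.pair x y ≤ _) (Setoid.pair_rel x y)
  refine sup_le (sameCycle_setoid_le fun a => ?_) (Setoid.pair_le hp)
  have ha : s a (σ a) := (le_sup_left : _ ≤ s) (show SameCycle σ a (σ a) from ⟨1, by simp⟩)
  refine s.trans' ha ?_
  rw [mul_apply]
  rcases eq_or_ne (σ a) x with h1 | h1
  · rw [h1, swap_apply_left]; exact hp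
  · rcases eq_or_ne (σ a) y with h2 | h2
    · rw [h2, swap_apply_right]; exact s.symm' hp
    · rw [swap_apply_of_ne_of_ne h1 h2]

theorem sup_pair_swap_mul [Finite E] (σ : Perm E) (x y : E) :
    SameCycle.setoid (swap x y * σ) ⊔ .pair x y = SameCycle.setoid σ ⊔ .pair x y := by
  refine le_antisymm (sup_pair_swap_mul_le σ x y) ?_
  have := sup_pair_swap_mul_le (swap x y * σ) x y
  rwa [swap_mul_self_mul] at this

/-- The new permutation follows the old cycle of `y`, which avoids `x`, up to the step that would
return to `y`; there the transposition redirects it to `x`. -/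
theorem sameCycle_swap_mul_of_not [Finite E] {σ : Perm E} {x y : E} (h : ¬ SameCycle σ x y) :
    SameCycle (swap x y * σ) x y := by
  classical
  have hper : ∃ k, (σ ^ (k + 1)) y = y := by
    obtain ⟨k, hk⟩ := Nat.exists_eq_succ_of_ne_zero (orderOf_pos σ).ne'
    exact ⟨k, by rw [← Nat.succ_eq_add_one, ← hk, pow_orderOf_eq_one, one_apply]⟩
  have key : ∀ i ≤ Nat.find hper, ((swap x y * σ) ^ i) y = (σ ^ i) y := by
    intro i hi
    induction i with
    | zero => rfl
    | succ i ih =>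
      rw [pow_succ', mul_apply, ih (by omega), mul_apply, ← mul_apply σ, ← pow_succ',
        swap_apply_of_ne_of_ne]
      · rintro h'
        exact h (SameCycle.symm ⟨(i + 1 : ℕ), by rw [zpow_natCast]; exact h'⟩)
      · exact Nat.find_min hper (m := i) (by omega)
  refine SameCycle.symm ⟨(Nat.find hper + 1 : ℕ), ?_⟩
  rw [zpow_natCast, pow_succ', mul_apply, key _ le_rfl, mul_apply, ← mul_apply σ, ← pow_succ',
    Nat.find_spec hper, swap_apply_right]

/-- If `y` is first reached from `x` after `j` steps, the new orbit of `x` stays among the first `j`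
points of the old one: the step that would reach `y` leads back to `x`. -/
theorem not_sameCycle_swap_mul [Finite E] {σ : Perm E} {x y : E} (h : SameCycle σ x y)
    (hxy : x ≠ y) : ¬ SameCycle (swap x y * σ) x y := by
  classical
  have hex : ∃ j, (σ ^ j) x = y := h.exists_nat_pow_eq
  set j := Nat.find hex with hj
  have hjs : (σ ^ j) x = y := Nat.find_spec hex
  have hmin : ∀ i < j, (σ ^ i) x ≠ y := fun i hi => Nat.find_min hex hi
  have hj0 : j ≠ 0 := by
    intro h0; rw [h0] at hjs; exact hxy hjs
  intro hc
  obtain ⟨k, hk⟩ := hc.exists_nat_pow_eq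
  have key : ∀ k, ∃ i < j, ((swap x y * σ) ^ k) x = (σ ^ i) x := by
    intro k
    induction k with
    | zero => exact ⟨0, by omega, rfl⟩
    | succ k ih =>
      obtain ⟨i, hi, hik⟩ := ih
      rw [pow_succ', mul_apply, hik, mul_apply, ← mul_apply σ, ← pow_succ']
      rcases eq_or_ne (i + 1) j with h1 | h1
      · exact ⟨0, by omega, by rw [h1, hjs, swap_apply_right]; rfl⟩
      -- A return to `x` before `y` is met would let `y` be reached in fewer than `j` steps.
      · rcases eq_or_ne ((σ ^ (i + 1)) x) x with h2 | h2
        · exfalso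
          have h3 : (σ ^ (j - (i + 1))) x = y := by
            conv_lhs => rw [← h2]
            rw [← mul_apply, ← pow_add, Nat.sub_add_cancel (by omega), hjs]
          exact hmin _ (by omega) h3
        · exact ⟨i + 1, by omega, swap_apply_of_ne_of_ne h2 (hmin _ (by omega))⟩
  obtain ⟨i, hi, h'⟩ := key k
  exact hmin i hi (h'.symm.trans hk)

theorem setoid_swap_mul_of_not [Finite E] {σ : Perm E} {x y : E} (h : ¬ SameCycle σ x y) :
    SameCycle.setoid (swap x y * σ) = SameCycle.setoid σ ⊔ .pair x y := by
  rw [← sup_pair_swap_mul, Setoid.sup_pair_of_rel]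
  exact sameCycle_swap_mul_of_not h

theorem setoid_eq_of_sameCycle [Finite E] {σ : Perm E} {x y : E} (h : SameCycle σ x y) :
    SameCycle.setoid σ = SameCycle.setoid (swap x y * σ) ⊔ .pair x y := by
  rw [sup_pair_swap_mul, Setoid.sup_pair_of_rel]
  exact h

theorem numCycles_swap_mul_of_not [Finite E] {σ : Perm E} {x y : E} (h : ¬ SameCycle σ x y) :
    numCycles (swap x y * σ) + 1 = numCycles σ := by
  rw [numCycles, setoid_swap_mul_of_not h]
  exact Setoid.card_quotient_sup_pair h

theorem numCycles_swap_mul_of_sameCycle [Finite E] {σ : Perm E} {x y : E} (h : SameCycle σ x y)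
    (hxy : x ≠ y) : numCycles (swap x y * σ) = numCycles σ + 1 := by
  conv_rhs => rw [numCycles, setoid_eq_of_sameCycle h]
  exact (Setoid.card_quotient_sup_pair (not_sameCycle_swap_mul h hxy)).symm

theorem minimalPeriod_swap_mul_of_not [Finite E] {σ : Perm E} {x y : E}
    (h : ¬ SameCycle σ x y) : Function.minimalPeriod (swap x y * σ : Perm E) x =
      Function.minimalPeriod σ x + Function.minimalPeriod σ y := by
  simp_rw [minimalPeriod_eq_ncard]
  rw [← Set.ncard_union_eq]
  · congr 1
    ext f
    have := Setoid.sup_pair_rel_left (s := SameCycle.setoid σ) (x := x) (y := y) (a := f)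
    rw [← setoid_swap_mul_of_not h] at this
    exact this
  · rw [Set.disjoint_left]
    intro f hf hf'
    exact h (SameCycle.trans hf (SameCycle.symm hf'))

theorem minimalPeriod_swap_mul_of_sameCycle [Finite E] {σ : Perm E} {x y : E}
    (h : SameCycle σ x y) (hxy : x ≠ y) : Function.minimalPeriod σ x =
      Function.minimalPeriod (swap x y * σ : Perm E) x +
        Function.minimalPeriod (swap x y * σ : Perm E) y := by
  rw [← minimalPeriod_swap_mul_of_not (not_sameCycle_swap_mul h hxy), swap_mul_self_mul]

end Equiv.Perm

/-! ### Euler's inequality for pairs of permutations -/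

namespace BipMap

open Equiv.Perm

variable {E : Type} [Finite E] (M : BipMap E)

/-- Two edges are equivalent if they are in the same component of the map. -/
def compSetoid : Setoid E := SameCycle.setoid M.black ⊔ SameCycle.setoid M.white

/-- The number of components that contain an edge. -/
noncomputable def numComp : ℕ := Nat.card (Quotient M.compSetoid)

/-- Every component has genus zero. -/
def GenusZero : Prop :=
  numCycles M.black + numCycles M.white + numCycles M.facePerm = Nat.card E + 2 * M.numComp

/-- Exchange of the two colours. -/
def flip : BipMap E := ⟨M.white, M.black⟩

theorem flip_compSetoid : M.flip.compSetoid = M.compSetoid := sup_comm _ _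

theorem flip_genusZero : M.flip.GenusZero ↔ M.GenusZero := by
  have h1 : numCycles M.flip.facePerm = numCycles M.facePerm := numCycles_mul_comm _ _
  have h2 : M.flip.numComp = M.numComp := by rw [numComp, numComp, flip_compSetoid]
  rw [GenusZero, GenusZero, h1, h2]
  simp only [flip]
  rw [add_comm (numCycles M.white)]

theorem comp_black {e f : E} (h : SameCycle M.black e f) : M.compSetoid e f :=
  (le_sup_left : _ ≤ M.compSetoid) h

theorem comp_white {e f : E} (h : SameCycle M.white e f) : M.compSetoid e f :=
  (le_sup_right : _ ≤ M.compSetoid) h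

theorem comp_black_apply (e : E) : M.compSetoid e (M.black e) := M.comp_black ⟨1, by simp⟩

theorem comp_white_apply (e : E) : M.compSetoid e (M.white e) := M.comp_white ⟨1, by simp⟩

theorem compSetoid_le {s : Setoid E} (hb : ∀ e, s e (M.black e)) (hw : ∀ e, s e (M.white e)) :
    M.compSetoid ≤ s := sup_le (sameCycle_setoid_le hb) (sameCycle_setoid_le hw)

theorem comp_of_sameCycle_facePerm {e f : E} (h : SameCycle M.facePerm e f) : M.compSetoid e f :=
  sameCycle_setoid_le (s := M.compSetoid)
    (fun a => M.compSetoid.trans' (M.comp_white_apply a) (M.comp_black_apply _)) h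

variable [DecidableEq E]

/-- Multiplication of the rotation at black vertices by a transposition: two vertices are glued or a
vertex is split. -/
def swapBlack (x y : E) : BipMap E := ⟨swap x y * M.black, M.white⟩

/-- Multiplication of the rotation at white vertices by a transposition. -/
def swapWhite (x y : E) : BipMap E := ⟨M.black, swap x y * M.white⟩

theorem flip_swapWhite (x y : E) : (M.swapWhite x y).flip = M.flip.swapBlack x y := rfl

theorem facePerm_swapBlack (x y : E) : (M.swapBlack x y).facePerm = swap x y * M.facePerm :=
  mul_assoc _ _ _

theorem facePerm_swapWhite (x y : E) :
    (M.swapWhite x y).facePerm = swap (M.black x) (M.black y) * M.facePerm := by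
  simp only [facePerm, swapWhite]
  rw [← mul_assoc, mul_swap_eq_swap_mul, mul_assoc]

theorem comp_swapBlack_sup (x y : E) :
    (M.swapBlack x y).compSetoid ⊔ .pair x y = M.compSetoid ⊔ .pair x y := by
  simp only [compSetoid, swapBlack]
  rw [sup_right_comm, sup_pair_swap_mul, sup_right_comm]

theorem comp_swapWhite_sup (x y : E) :
    (M.swapWhite x y).compSetoid ⊔ .pair x y = M.compSetoid ⊔ .pair x y := by
  rw [← flip_compSetoid, flip_swapWhite, comp_swapBlack_sup, flip_compSetoid]

theorem comp_swapBlack_of_not {x y : E} (h : ¬ SameCycle M.black x y) :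
    (M.swapBlack x y).compSetoid = M.compSetoid ⊔ .pair x y := by
  rw [← comp_swapBlack_sup, Setoid.sup_pair_of_rel]
  exact comp_black _ (sameCycle_swap_mul_of_not h)

theorem comp_swapWhite_of_not {x y : E} (h : ¬ SameCycle M.white x y) :
    (M.swapWhite x y).compSetoid = M.compSetoid ⊔ .pair x y := by
  rw [← flip_compSetoid, flip_swapWhite, comp_swapBlack_of_not, flip_compSetoid]
  exact h

/-- Induction on the support of the black rotation; without support, equality holds. Otherwise an
edge is split off its black vertex. If its component stays whole, the gain of a vertex offsets the
change of the faces by one. If it falls apart, vertices, faces and components all grow by one. -/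
theorem euler_le : numCycles M.black + numCycles M.white + numCycles M.facePerm ≤
    Nat.card E + 2 * M.numComp := by
  have := Fintype.ofFinite E
  obtain ⟨b, w⟩ := M
  induction hn : b.support.card using Nat.strong_induction_on generalizing b with | _ n ih =>
  by_cases h1 : b = 1
  · subst h1
    have e1 : numCycles (1 : Perm E) = Nat.card E := by
      refine Nat.card_congr ⟨Quotient.lift id fun a b h => ?_, Quotient.mk _, ?_, ?_⟩
      · exact sameCycle_one.mp h
      · intro q
        induction q using Quotient.inductionOn
        rfl
      · intro a
        rfl
    have e2 : numComp (⟨1, w⟩ : BipMap E) = numCycles w := by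
      rw [numComp, compSetoid, sup_eq_right.mpr]
      · rfl
      · intro a b h
        rw [sameCycle_setoid_apply, sameCycle_one] at h
        exact h ▸ Setoid.refl' _ a
    simp only [facePerm, one_mul, e1, e2]
    omega
  · obtain ⟨x, hx⟩ : ∃ x, b x ≠ x := by
      by_contra! h
      exact h1 (Equiv.ext h)
    have hsame : SameCycle b x (b x) := ⟨1, by simp⟩
    have hlt := card_support_swap_mul hx
    have := ih _ (hn ▸ hlt) (swap x (b x) * b) rfl
    set N : BipMap E := ⟨b, w⟩ with hN
    change numCycles (swap x (b x) * b) + numCycles w + numCycles (N.swapBlack x (b x)).facePerm ≤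
      Nat.card E + 2 * (N.swapBlack x (b x)).numComp at this
    rw [facePerm_swapBlack] at this
    rw [numCycles_swap_mul_of_sameCycle hsame hx.symm] at this
    have hc : (N.swapBlack x (b x)).compSetoid ⊔ .pair x (b x) = N.compSetoid := by
      rw [comp_swapBlack_sup, Setoid.sup_pair_of_rel]
      exact N.comp_black_apply x
    change numCycles b + numCycles w + _ ≤ _
    by_cases hxc : (N.swapBlack x (b x)).compSetoid x (b x)
    · rw [Setoid.sup_pair_of_rel hxc] at hc
      rw [numComp, hc] at this
      change _ ≤ _ + 2 * N.numComp at this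
      by_cases hf : SameCycle N.facePerm x (b x)
      · rw [numCycles_swap_mul_of_sameCycle hf hx.symm] at this
        omega
      · have := numCycles_swap_mul_of_not hf
        omega
    · have hk := Setoid.card_quotient_sup_pair hxc
      rw [hc] at hk
      change N.numComp + 1 = numComp _ at hk
      have hf : ¬ SameCycle (N.swapBlack x (b x)).facePerm x (b x) :=
        fun h => hxc (comp_of_sameCycle_facePerm _ h)
      have h2 := numCycles_swap_mul_of_not hf
      rw [facePerm_swapBlack, swap_mul_self_mul] at h2
      omega

variable {M} {x y : E}

/-- The number of faces changes by one. If no component falls apart, `euler_le` for the new map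
leaves only the loss of a face, which balances the new vertex. Otherwise the two parts have no
common face, so a face is gained along with a component. -/
theorem GenusZero.swapBlack_split (hM : M.GenusZero) (hxy : x ≠ y) (h : SameCycle M.black x y) :
    (M.swapBlack x y).GenusZero := by
  have hle := (M.swapBlack x y).euler_le
  have hc : (M.swapBlack x y).compSetoid ⊔ .pair x y = M.compSetoid := by
    rw [comp_swapBlack_sup, Setoid.sup_pair_of_rel]
    exact M.comp_black h
  rw [GenusZero] at hM ⊢
  rw [facePerm_swapBlack] at hle ⊢
  change numCycles (swap x y * M.black) + numCycles M.white + _ = _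
  change numCycles (swap x y * M.black) + numCycles M.white + _ ≤ _ at hle
  rw [numCycles_swap_mul_of_sameCycle h hxy] at hle ⊢
  by_cases hxc : (M.swapBlack x y).compSetoid x y
  · rw [Setoid.sup_pair_of_rel hxc] at hc
    rw [numComp, hc] at hle ⊢
    change _ ≤ _ + 2 * M.numComp at hle
    change _ = _ + 2 * M.numComp
    by_cases hf : SameCycle M.facePerm x y
    · rw [numCycles_swap_mul_of_sameCycle hf hxy] at hle
      omega
    · have := numCycles_swap_mul_of_not hf
      omega
  · have hk := Setoid.card_quotient_sup_pair hxc
    rw [hc] at hk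
    change M.numComp + 1 = numComp _ at hk
    have hf : ¬ SameCycle (M.swapBlack x y).facePerm x y :=
      fun h => hxc (comp_of_sameCycle_facePerm _ h)
    have h2 := numCycles_swap_mul_of_not hf
    rw [facePerm_swapBlack, swap_mul_self_mul] at h2
    omega

theorem GenusZero.swapWhite_split (hM : M.GenusZero) (hxy : x ≠ y) (h : SameCycle M.white x y) :
    (M.swapWhite x y).GenusZero := by
  rw [← flip_genusZero, flip_swapWhite]
  rw [← flip_genusZero] at hM
  exact hM.swapBlack_split hxy h

theorem not_sameCycle_black_of_not_comp (h : ¬ M.compSetoid x y) : ¬ SameCycle M.black x y :=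
  fun h' => h (M.comp_black h')

theorem not_sameCycle_face_of_not_comp (h : ¬ M.compSetoid x y) : ¬ SameCycle M.facePerm x y :=
  fun h' => h (M.comp_of_sameCycle_facePerm h')

/-- Vertices, faces and components each lose one, since different components share neither vertices
nor faces. -/
theorem GenusZero.swapBlack_join (hM : M.GenusZero) (h : ¬ M.compSetoid x y) :
    (M.swapBlack x y).GenusZero := by
  have hk := Setoid.card_quotient_sup_pair h
  rw [← comp_swapBlack_of_not _ (not_sameCycle_black_of_not_comp h)] at hk
  change numComp _ + 1 = numComp _ at hk
  have h1 := numCycles_swap_mul_of_not (not_sameCycle_black_of_not_comp h)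
  have h2 := numCycles_swap_mul_of_not (not_sameCycle_face_of_not_comp h)
  rw [GenusZero] at hM ⊢
  rw [facePerm_swapBlack]
  change numCycles (swap x y * M.black) + numCycles M.white + _ = _
  omega

theorem GenusZero.swapWhite_join (hM : M.GenusZero) (h : ¬ M.compSetoid x y) :
    (M.swapWhite x y).GenusZero := by
  rw [← flip_genusZero, flip_swapWhite]
  rw [← flip_genusZero] at hM
  rw [← flip_compSetoid] at h
  exact hM.swapBlack_join h

/-- Gluing two vertices at corners of one face loses a vertex, cuts the face in two and keeps the
components. -/
theorem GenusZero.swapWhite_cut (hM : M.GenusZero) (hxy : x ≠ y) (hc : M.compSetoid x y)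
    (hw : ¬ SameCycle M.white x y) (hf : SameCycle M.facePerm (M.black x) (M.black y)) :
    (M.swapWhite x y).GenusZero := by
  have hk : (M.swapWhite x y).compSetoid = M.compSetoid := by
    rw [comp_swapWhite_of_not _ hw, Setoid.sup_pair_of_rel hc]
  have h1 := numCycles_swap_mul_of_not hw
  have h2 := numCycles_swap_mul_of_sameCycle hf (M.black.injective.ne hxy)
  rw [GenusZero] at hM ⊢
  rw [facePerm_swapWhite, numComp, hk]
  change numCycles M.black + numCycles (swap x y * M.white) + _ = _ + 2 * M.numComp
  omega

end BipMap

/-! ### Disjoint unions of maps with one more edge -/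

namespace Setoid

variable {A B : Type*}

/-- The disjoint union of two equivalence relations, with one more element. -/
def block (s : Setoid A) (t : Setoid B) : Setoid (Option (A ⊕ B)) :=
  ker (Option.map (Sum.map (Quotient.mk s) (Quotient.mk t)))

theorem block_inl {s : Setoid A} {t : Setoid B} {a b : A} :
    block s t (some (.inl a)) (some (.inl b)) ↔ s a b := by
  rw [block, ker_def]; simp [Quotient.eq]

theorem block_inr {s : Setoid A} {t : Setoid B} {a b : B} :
    block s t (some (.inr a)) (some (.inr b)) ↔ t a b := by
  rw [block, ker_def]; simp [Quotient.eq]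

theorem block_le {s : Setoid A} {t : Setoid B} {u : Setoid (Option (A ⊕ B))}
    (hs : ∀ a b, s a b → u (some (.inl a)) (some (.inl b)))
    (ht : ∀ a b, t a b → u (some (.inr a)) (some (.inr b))) : block s t ≤ u := by
  intro a b h
  rw [block, ker_def] at h
  match a, b with
  | none, none => exact u.refl' _
  | some (.inl a), some (.inl b) => simp [Quotient.eq] at h; exact hs _ _ h
  | some (.inr a), some (.inr b) => simp [Quotient.eq] at h; exact ht _ _ h
  | none, some (.inl b) => simp at h
  | none, some (.inr b) => simp at h
  | some (.inl b), none => simp at h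
  | some (.inr b), none => simp at h
  | some (.inl b), some (.inr _) => simp at h
  | some (.inr b), some (.inl _) => simp at h

theorem card_quotient_block [Finite A] [Finite B] (s : Setoid A) (t : Setoid B) :
    Nat.card (Quotient (block s t)) = Nat.card (Quotient s) + Nat.card (Quotient t) + 1 := by
  rw [block, Nat.card_congr (quotientKerEquivOfSurjective _ _), Finite.card_option, Nat.card_sum]
  rintro (_ | q | q)
  · exact ⟨none, rfl⟩
  · obtain ⟨a, rfl⟩ := Quotient.mk_surjective q
    exact ⟨some (.inl a), rfl⟩
  · obtain ⟨a, rfl⟩ := Quotient.mk_surjective q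
    exact ⟨some (.inr a), rfl⟩

end Setoid

namespace Equiv.Perm

variable {A B : Type*} [Finite A] [Finite B]

theorem setoid_optionCongr_sumCongr (σ : Perm A) (τ : Perm B) :
    SameCycle.setoid (optionCongr (Equiv.sumCongr σ τ)) =
      (SameCycle.setoid σ).block (SameCycle.setoid τ) := by
  apply le_antisymm
  · refine sameCycle_setoid_le fun a => ?_
    match a with
    | none => exact Setoid.refl' _ _
    | some (.inl a) => exact Setoid.block_inl.mpr ⟨1, by simp⟩
    | some (.inr a) => exact Setoid.block_inr.mpr ⟨1, by simp⟩
  · refine Setoid.block_le (fun a b h => ?_) (fun a b h => ?_)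
    · exact sameCycle_setoid_le (σ := σ)
        (s := Setoid.comap (fun a => some (Sum.inl a)) (SameCycle.setoid _))
        (fun a => ⟨1, by simp⟩) h
    · exact sameCycle_setoid_le (σ := τ)
        (s := Setoid.comap (fun a => some (Sum.inr a)) (SameCycle.setoid _))
        (fun a => ⟨1, by simp⟩) h

theorem numCycles_optionCongr_sumCongr (σ : Perm A) (τ : Perm B) :
    numCycles (optionCongr (Equiv.sumCongr σ τ)) = numCycles σ + numCycles τ + 1 := by
  rw [numCycles, setoid_optionCongr_sumCongr, Setoid.card_quotient_block]; rfl

theorem minimalPeriod_semiconj {f : Perm A} {g : Perm B} {φ : A → B}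
    (hφ : Function.Injective φ) (h : ∀ a, g (φ a) = φ (f a)) (a : A) :
    Function.minimalPeriod g (φ a) = Function.minimalPeriod f a := by
  rw [Function.minimalPeriod_eq_minimalPeriod_iff]
  intro n
  have : g^[n] (φ a) = φ (f^[n] a) :=
    ((Function.Semiconj.iterate_right (f := φ) (ga := f) (gb := g) (fun a => (h a).symm) n) a).symm
  rw [Function.IsPeriodicPt, Function.IsPeriodicPt, Function.IsFixedPt, Function.IsFixedPt, this]
  exact hφ.eq_iff

end Equiv.Perm

namespace BipMap

open Equiv.Perm

variable {A B E : Type} [Finite A] [Finite B] [Finite E]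

theorem comp_of_semiconj {M : BipMap A} {N : BipMap E} {φ : A → E}
    (hb : ∀ a, N.black (φ a) = φ (M.black a)) (hw : ∀ a, N.white (φ a) = φ (M.white a))
    {a b : A} (h : M.compSetoid a b) : N.compSetoid (φ a) (φ b) :=
  M.compSetoid_le (s := N.compSetoid.comap φ)
    (fun a => (show N.compSetoid _ _ from hb a ▸ N.comp_black_apply (φ a)))
    (fun a => (show N.compSetoid _ _ from hw a ▸ N.comp_white_apply (φ a))) h

/-- The disjoint union of two maps, with one more isolated edge. -/
def disjointUnion (M : BipMap A) (N : BipMap B) : BipMap (Option (A ⊕ B)) :=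
  ⟨optionCongr (Equiv.sumCongr M.black N.black), optionCongr (Equiv.sumCongr M.white N.white)⟩

variable (M : BipMap A) (N : BipMap B)

theorem facePerm_disjointUnion : (M.disjointUnion N).facePerm =
    optionCongr (Equiv.sumCongr M.facePerm N.facePerm) := by
  ext1 e
  match e with
  | none => rfl
  | some (.inl a) => rfl
  | some (.inr a) => rfl

theorem compSetoid_disjointUnion :
    (M.disjointUnion N).compSetoid = M.compSetoid.block N.compSetoid := by
  apply le_antisymm
  · refine compSetoid_le _ (fun a => ?_) (fun a => ?_)
    · match a with
      | none => exact Setoid.refl' _ _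
      | some (.inl a) => exact Setoid.block_inl.mpr (comp_black_apply _ _)
      | some (.inr a) => exact Setoid.block_inr.mpr (comp_black_apply _ _)
    · match a with
      | none => exact Setoid.refl' _ _
      | some (.inl a) => exact Setoid.block_inl.mpr (comp_white_apply _ _)
      | some (.inr a) => exact Setoid.block_inr.mpr (comp_white_apply _ _)
  · refine Setoid.block_le (fun a b h => ?_) (fun a b h => ?_)
    · exact comp_of_semiconj (M := M) (φ := fun a => some (Sum.inl a)) (fun a => rfl)
        (fun a => rfl) h
    · exact comp_of_semiconj (M := N) (φ := fun a => some (Sum.inr a)) (fun a => rfl)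
        (fun a => rfl) h

variable {M N} in
theorem GenusZero.disjointUnion (hM : M.GenusZero) (hN : N.GenusZero) :
    (M.disjointUnion N).GenusZero := by
  rw [GenusZero] at *
  rw [facePerm_disjointUnion, numComp, compSetoid_disjointUnion, Setoid.card_quotient_block]
  simp only [BipMap.disjointUnion, numCycles_optionCongr_sumCongr, Finite.card_option, Nat.card_sum]
  rw [numComp] at hM hN
  omega

end BipMap

/-! ### Attachment of a map to the root of another map -/

/-- A rooted map whose edges are all in the component of the root. -/
structure RootedBipMap.IsRooted {E : Type} (M : RootedBipMap E) : Prop where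
  comp_root : ∀ r ∈ M.root, ∀ e, M.compSetoid r e
  isEmpty : M.root = none → IsEmpty E

namespace RootedBipMap

open Equiv.Perm BipMap

variable {A B : Type} [DecidableEq A] [DecidableEq B]

/-- A new edge at a new black vertex is linked to the map `C` at a white vertex if `a = 0`, or at
the root and a white vertex such that it closes a face of degree `2 * a` if `a > 0`. -/
def link (a : ℕ) (C : RootedBipMap A) (R : BipMap B) : BipMap (Option (A ⊕ B)) :=
  match C.root with
  | none => C.disjointUnion R
  | some rc =>
    if a = 0 then (C.disjointUnion R).swapWhite none (some (.inl (C.black⁻¹ rc)))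
    else ((C.disjointUnion R).swapBlack none (some (.inl rc))).swapWhite none
      (some (.inl (C.white ((C.facePerm ^ (a - 1)) rc))))

/-- The map `C` is linked to the last corner around the root of `R` by a new edge. -/
def attach (a : ℕ) (C : RootedBipMap A) (R : RootedBipMap B) :
    RootedBipMap (Option (A ⊕ B)) :=
  match R.root with
  | none => ⟨link a C R.toBipMap, some none⟩
  | some rr => ⟨(link a C R.toBipMap).swapBlack none (some (.inr rr)), some (some (.inr rr))⟩

end RootedBipMap

theorem splice_eq {E : Type} [DecidableEq E] (σ : Perm E) (x y : E) :
    splice σ x y = swap x y * σ := by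
  rw [splice, mul_swap_eq_swap_mul]; simp

/-- `splice` is a left multiplication by a transposition, so the calculus of merged and split cycles
applies to `toMap`. -/
theorem EdgeTree.toMap_graft (a : ℕ) (c r : EdgeTree) :
    (graft a c r).toMap = RootedBipMap.attach a c.toMap r.toMap := by
  have h : (EdgeTree.decidableEqEdge (graft a c r)) =
    (inferInstance : DecidableEq (Option (c.Edge ⊕ r.Edge))) := Subsingleton.elim _ _
  rw [EdgeTree.toMap, h]
  cases h1 : c.toMap.root with
  | none =>
    cases h2 : r.toMap.root with
    | none => simp only [RootedBipMap.attach, RootedBipMap.link, h1, h2]; rfl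
    | some rr =>
      simp only [RootedBipMap.attach, RootedBipMap.link, h1, h2]
      exact congrArg (fun b => RootedBipMap.mk (BipMap.mk b _) _) (splice_eq _ _ _)
  | some rc =>
    cases h2 : r.toMap.root with
    | none =>
      simp only [RootedBipMap.attach, RootedBipMap.link, h1, h2]
      split_ifs
      · exact congrArg (fun w => RootedBipMap.mk (BipMap.mk _ w) _) (splice_eq _ _ _)
      · exact congrArg₂ (fun b w => RootedBipMap.mk (BipMap.mk b w) _) (splice_eq _ _ _)
          (splice_eq _ _ _)
    | some rr =>
      simp only [RootedBipMap.attach, RootedBipMap.link, h1, h2]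
      split_ifs
      · exact congrArg₂ (fun b w => RootedBipMap.mk (BipMap.mk b w) _) (splice_eq _ _ _)
          (splice_eq _ _ _)
      · exact congrArg₂ (fun b w => RootedBipMap.mk (BipMap.mk b w) _)
          ((splice_eq _ _ _).trans (congrArg (fun σ : Perm (Option (c.Edge ⊕ r.Edge)) =>
            swap none (some (.inr rr)) * σ) (splice_eq _ _ _))) (splice_eq _ _ _)

theorem Setoid.sup_pair_congr {E : Type*} {s : Setoid E} {x y z : E} (h : s y z) :
    s ⊔ .pair x y = s ⊔ .pair x z := by
  have key : ∀ {y z : E}, s y z → s ⊔ .pair x y ≤ s ⊔ .pair x z := fun {y z} h =>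
    sup_le le_sup_left (Setoid.pair_le (Setoid.trans' _
      ((le_sup_right : Setoid.pair x z ≤ _) (Setoid.pair_rel x z))
      (Setoid.symm' _ ((le_sup_left : s ≤ _) h))))
  exact le_antisymm (key h) (key (s.symm' h))

/-! ### Adding an isolated edge as a bridge or as an edge that closes a face -/

namespace BipMap

open Equiv.Perm

theorem not_sameCycle_of_fixed {E : Type*} {σ : Perm E} {x y : E} (h : σ x = x) (hxy : x ≠ y) :
    ¬ SameCycle σ x y := fun h' => hxy (h'.eq_of_left h)

variable {E : Type} [Finite E] [DecidableEq E]

section Bridge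

variable {N : BipMap E} {x r : E} (hb : N.black x = x)
include hb

theorem facePerm_addBridge :
    (N.swapWhite x (N.black⁻¹ r)).facePerm = swap x r * N.facePerm := by
  rw [facePerm_swapWhite, hb]; simp

theorem minimalPeriod_addBridge (hw : N.white x = x) (hr : x ≠ r) :
    Function.minimalPeriod (N.swapWhite x (N.black⁻¹ r)).facePerm x =
      1 + Function.minimalPeriod N.facePerm r := by
  have hf : N.facePerm x = x := by rw [facePerm, mul_apply, hw, hb]
  rw [facePerm_addBridge hb, minimalPeriod_swap_mul_of_not (not_sameCycle_of_fixed hf hr),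
    Function.minimalPeriod_eq_one_iff_isFixedPt.mpr hf]

end Bridge

section Loop

variable (N : BipMap E) (x r : E) (a : ℕ)

/-- A loop-closing edge `x` is added at the root: it comes immediately before `r` around its black
end, and closes a face of degree `2 * a`. -/
def addLoop : BipMap E :=
  (N.swapBlack x r).swapWhite x (N.white ((N.facePerm ^ (a - 1)) r))

variable {N x r a} (hb : N.black x = x) (hw : N.white x = x) (hr : x ≠ r) (ha : 0 < a)
include hb hw hr ha

theorem pow_facePerm_ne (k : ℕ) : (N.facePerm ^ k) r ≠ x := by
  have hf : N.facePerm x = x := by rw [facePerm, mul_apply, hw, hb]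
  intro h
  have : ((N.facePerm) ^ k) x = x := by
    rw [coe_pow]; exact Function.iterate_fixed hf k
  exact hr ((N.facePerm ^ k).injective (h.trans this.symm)).symm

/-- The inner transposition merges the trivial face of `x` into the face of `r`; the outer one cuts
the result after `a` steps. The inner `swap x r` in the cutting point matters only if the walk is
back at `r` after `a` steps: the cut is then made at `x`. -/
theorem facePerm_addLoop : (N.addLoop x r a).facePerm =
    swap r (swap x r ((N.facePerm ^ a) r)) * (swap x r * N.facePerm) := by
  rw [addLoop, facePerm_swapWhite, facePerm_swapBlack]
  simp only [swapBlack]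
  rw [mul_apply, hb, swap_apply_left, mul_apply]
  congr 3
  rw [← mul_apply N.black, ← mul_apply, ← facePerm, ← pow_succ', Nat.sub_add_cancel ha]

theorem ne_swap_pow : r ≠ swap x r ((N.facePerm ^ a) r) := by
  intro h
  have h2 := (Equiv.eq_symm_apply _).mpr h.symm
  rw [symm_swap, swap_apply_right] at h2
  exact pow_facePerm_ne hb hw hr ha a h2

theorem sameCycle_addLoop :
    SameCycle (swap x r * N.facePerm) r (swap x r ((N.facePerm ^ a) r)) := by
  have hf : N.facePerm x = x := by rw [facePerm, mul_apply, hw, hb]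
  have h1 : SameCycle (swap x r * N.facePerm) r ((N.facePerm ^ (a - 1)) r) := by
    rw [← sameCycle_setoid_apply, setoid_swap_mul_of_not (not_sameCycle_of_fixed hf hr)]
    exact (le_sup_left : SameCycle.setoid N.facePerm ≤ _) ⟨(a - 1 : ℕ), by rw [zpow_natCast]⟩
  have h2 : swap x r ((N.facePerm ^ a) r) =
      (swap x r * N.facePerm) ((N.facePerm ^ (a - 1)) r) := by
    rw [mul_apply, ← mul_apply N.facePerm, ← pow_succ', Nat.sub_add_cancel ha]
  rw [h2, sameCycle_apply_right]
  exact h1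

/-- Below the period the walk does not return to `r`, and the cutting point is the image of step `a
- 1`, so neither exceptional point is met before step `a`. -/
theorem facePerm_addLoop_pow (had : a ≤ Function.minimalPeriod N.facePerm r) {i : ℕ}
    (hi : i < a) : ((N.addLoop x r a).facePerm ^ i) r = (N.facePerm ^ i) r := by
  induction i with
  | zero => rfl
  | succ i ih =>
    have hr' : (N.facePerm ^ (i + 1)) r ≠ r := by
      intro h
      rw [coe_pow] at h
      have := Function.IsPeriodicPt.minimalPeriod_le (n := i + 1) (by omega) h
      omega
    have h1 : (swap x r * N.facePerm) ((N.facePerm ^ i) r) = (N.facePerm ^ (i + 1)) r := by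
      rw [mul_apply, ← mul_apply N.facePerm, ← pow_succ',
        swap_apply_of_ne_of_ne (pow_facePerm_ne hb hw hr ha _) hr']
    rw [pow_succ', mul_apply, ih (by omega), facePerm_addLoop hb hw hr ha, mul_apply, h1,
      swap_apply_of_ne_of_ne hr']
    intro h
    have h2 : (swap x r) ((N.facePerm ^ a) r) =
        (swap x r * N.facePerm) ((N.facePerm ^ (a - 1)) r) := by
      rw [mul_apply, ← mul_apply N.facePerm, ← pow_succ', Nat.sub_add_cancel ha]
    rw [h2, ← h1] at h
    have h3 := (swap x r * N.facePerm).injective h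
    rw [coe_pow, coe_pow] at h3
    have := (Function.iterate_injOn_Iio_minimalPeriod (f := N.facePerm) (x := r))
      (show i < _ by omega) (show a - 1 < _ by omega) h3
    omega

theorem minimalPeriod_addLoop_inner (had : a ≤ Function.minimalPeriod N.facePerm r) :
    Function.minimalPeriod (N.addLoop x r a).facePerm r = a := by
  have h1 : ((N.addLoop x r a).facePerm ^ a) r = r := by
    obtain ⟨a, rfl⟩ := Nat.exists_eq_succ_of_ne_zero ha.ne'
    rw [pow_succ', mul_apply, facePerm_addLoop_pow hb hw hr ha had (Nat.lt_succ_self a),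
      facePerm_addLoop hb hw hr ha, mul_apply, mul_apply, ← mul_apply N.facePerm, ← pow_succ',
      swap_apply_right]
  rw [coe_pow] at h1
  have h2 : 0 < Function.minimalPeriod (N.addLoop x r a).facePerm r :=
    Function.IsPeriodicPt.minimalPeriod_pos ha h1
  refine le_antisymm (Function.IsPeriodicPt.minimalPeriod_le ha h1) ?_
  by_contra! hlt
  have h3 := facePerm_addLoop_pow hb hw hr ha had hlt
  rw [coe_pow, coe_pow, Function.iterate_minimalPeriod] at h3
  have := Function.IsPeriodicPt.minimalPeriod_le h2 h3.symm
  omega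

/-- The merged face has length one more than the old face of `r`, and the inner face removes `a`
from it. -/
theorem minimalPeriod_addLoop_outer (had : a ≤ Function.minimalPeriod N.facePerm r) :
    Function.minimalPeriod (N.addLoop x r a).facePerm x + a =
      1 + Function.minimalPeriod N.facePerm r := by
  have hf : N.facePerm x = x := by rw [facePerm, mul_apply, hw, hb]
  have h1 := minimalPeriod_swap_mul_of_sameCycle (sameCycle_addLoop hb hw hr ha)
    (ne_swap_pow hb hw hr ha)
  rw [← facePerm_addLoop hb hw hr ha, minimalPeriod_addLoop_inner hb hw hr ha had] at h1
  have h2 : SameCycle (N.addLoop x r a).facePerm x (swap x r ((N.facePerm ^ a) r)) := by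
    refine ⟨1, ?_⟩
    rw [zpow_one, facePerm_addLoop hb hw hr ha, mul_apply, mul_apply, hf, swap_apply_left,
      swap_apply_left]
  rw [minimalPeriod_eq_of_sameCycle h2, add_comm, ← h1,
    ← minimalPeriod_eq_of_sameCycle (sameCycle_swap_mul_of_not (not_sameCycle_of_fixed hf hr)),
    minimalPeriod_swap_mul_of_not (not_sameCycle_of_fixed hf hr),
    Function.minimalPeriod_eq_one_iff_isFixedPt.mpr hf]

theorem ne_white_pow : x ≠ N.white ((N.facePerm ^ (a - 1)) r) := by
  intro h
  have : N.white x = N.white ((N.facePerm ^ (a - 1)) r) := hw.trans h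
  exact pow_facePerm_ne hb hw hr ha _ (N.white.injective this).symm

theorem comp_white_pow : N.compSetoid r (N.white ((N.facePerm ^ (a - 1)) r)) :=
  Setoid.trans' _ (comp_of_sameCycle_facePerm _ ⟨(a - 1 : ℕ), by rw [zpow_natCast]⟩)
    (comp_white_apply _ _)

theorem compSetoid_addLoop : (N.addLoop x r a).compSetoid = N.compSetoid ⊔ .pair x r := by
  have h1 : ¬ SameCycle (N.swapBlack x r).white x (N.white ((N.facePerm ^ (a - 1)) r)) :=
    not_sameCycle_of_fixed hw (ne_white_pow hb hw hr ha)
  rw [addLoop, comp_swapWhite_of_not _ h1,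
    comp_swapBlack_of_not _ (not_sameCycle_of_fixed hb hr), Setoid.sup_pair_of_rel]
  · exact Setoid.trans' _ ((le_sup_right : Setoid.pair x r ≤ _) (Setoid.pair_rel x r))
      ((le_sup_left : N.compSetoid ≤ _) (comp_white_pow hb hw hr ha))

/-- The black end joins two components; the white end then cuts a face of the joined component. -/
theorem GenusZero.addLoop (hN : N.GenusZero) (hc : ¬ N.compSetoid x r) :
    (N.addLoop x r a).GenusZero := by
  refine (hN.swapBlack_join hc).swapWhite_cut (ne_white_pow hb hw hr ha) ?_
    (not_sameCycle_of_fixed hw (ne_white_pow hb hw hr ha)) ?_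
  · rw [comp_swapBlack_of_not _ (not_sameCycle_of_fixed hb hr)]
    exact Setoid.trans' _ ((le_sup_right : Setoid.pair x r ≤ _) (Setoid.pair_rel x r))
      ((le_sup_left : N.compSetoid ≤ _) (comp_white_pow hb hw hr ha))
  · have h := sameCycle_addLoop hb hw hr ha
    rw [facePerm_swapBlack]
    convert h using 1
    · simp only [swapBlack, mul_apply, hb, swap_apply_left]
    · simp only [swapBlack, mul_apply]
      rw [← mul_apply N.black, ← facePerm, ← mul_apply N.facePerm, ← pow_succ',
        Nat.sub_add_cancel ha]

end Loop

end BipMap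

/-! ### Components, genus, vertices and outer face of an attached map -/

namespace RootedBipMap

open Equiv.Perm BipMap

variable {A B : Type} [DecidableEq A] [DecidableEq B]

section Link

variable [Finite A] [Finite B] (a : ℕ) (C : RootedBipMap A) (R : BipMap B)

/-- The three shapes of a link, expressed on the disjoint union so that the results on single new
edges apply directly. -/
theorem link_cases : (C.root = none ∧ link a C R = C.disjointUnion R) ∨
    (∃ rc, C.root = some rc ∧ a = 0 ∧ link a C R = (C.disjointUnion R).swapWhite none
      ((C.disjointUnion R).black⁻¹ (some (.inl rc)))) ∨
    (∃ rc, C.root = some rc ∧ 0 < a ∧ link a C R =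
      (C.disjointUnion R).addLoop none (some (.inl rc)) a) := by
  cases h : C.root with
  | none => left; simp only [link, h, and_self]
  | some rc =>
    right
    rcases Nat.eq_zero_or_pos a with ha | ha
    · left
      refine ⟨rc, rfl, ha, ?_⟩
      simp only [link, h, if_pos ha]
      congr 1
    · right
      refine ⟨rc, rfl, ha, ?_⟩
      simp only [link, h, if_neg ha.ne', addLoop]
      congr 1
      have key : ∀ k : ℕ, ((C.disjointUnion R).facePerm ^ k) (some (.inl rc)) =
          some (.inl ((C.facePerm ^ k) rc)) := by
        intro k
        induction k with
        | zero => rfl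
        | succ k ih => rw [pow_succ', mul_apply, ih, facePerm_disjointUnion, pow_succ']; rfl
      rw [key]
      rfl

theorem link_black_inr (f : B) : (link a C R).black (some (.inr f)) = some (.inr (R.black f)) := by
  unfold link
  split
  · rfl
  · split_ifs
    · rfl
    · simp only [swapBlack, swapWhite, disjointUnion, mul_apply]
      rw [swap_apply_of_ne_of_ne] <;> simp

theorem link_white_inr (f : B) : (link a C R).white (some (.inr f)) = some (.inr (R.white f)) := by
  unfold link
  split
  · rfl
  · split_ifs
    all_goals
      simp only [swapBlack, swapWhite, disjointUnion, mul_apply]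
      rw [swap_apply_of_ne_of_ne] <;> simp

theorem link_facePerm_inr (f : B) :
    (link a C R).facePerm (some (.inr f)) = some (.inr (R.facePerm f)) := by
  rw [facePerm, mul_apply, link_white_inr, link_black_inr]; rfl

variable {a C R}

theorem none_ne_disjointUnion_inv (M : BipMap A) (e : A ⊕ B) :
    none ≠ (M.disjointUnion R).black⁻¹ (some e) := by
  rw [Ne, eq_inv_iff_eq]
  exact (Option.some_ne_none e).symm

theorem disjointUnion_not_comp (M : BipMap A) {e : Option (A ⊕ B)} (he : none ≠ e) :
    ¬ (M.disjointUnion R).compSetoid none e := by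
  rw [compSetoid_disjointUnion, Setoid.block, Setoid.ker_def]
  match e with
  | none => exact absurd rfl he
  | some (.inl _) => simp
  | some (.inr _) => simp

theorem link_genusZero (hC : C.GenusZero) (hR : R.GenusZero) : (link a C R).GenusZero := by
  have h0 := hC.disjointUnion hR
  rcases link_cases a C R with ⟨-, h⟩ | ⟨rc, -, -, h⟩ | ⟨rc, -, ha, h⟩ <;> rw [h]
  · exact h0
  · exact h0.swapWhite_join (disjointUnion_not_comp _ (none_ne_disjointUnion_inv _ _))
  · exact h0.addLoop rfl rfl (by simp) ha (disjointUnion_not_comp _ (by simp))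

theorem compSetoid_link_of_some {rc : A} (hr : C.root = some rc) : (link a C R).compSetoid =
    (C.disjointUnion R).compSetoid ⊔ .pair none (some (.inl rc)) := by
  rcases link_cases a C R with ⟨h1, -⟩ | ⟨rc', h1, -, h⟩ | ⟨rc', h1, ha, h⟩
  · simp [hr] at h1
  · rw [hr] at h1
    cases h1
    rw [h, comp_swapWhite_of_not, Setoid.sup_pair_congr]
    · have := comp_black_apply (C.disjointUnion R) ((C.disjointUnion R).black⁻¹ (some (.inl rc)))
      simpa using this
    · exact not_sameCycle_of_fixed rfl (none_ne_disjointUnion_inv _ _)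
  · rw [hr] at h1
    cases h1
    rw [h, compSetoid_addLoop rfl rfl (by simp) ha]

theorem link_not_comp (f : B) : ¬ (link a C R).compSetoid none (some (.inr f)) := by
  -- The invariant that separates the edges of `R` from all others.
  let s : Setoid (Option (A ⊕ B)) := Setoid.ker fun e => ∃ f, e = some (.inr f)
  have h0 : (C.disjointUnion R).compSetoid ≤ s := by
    rw [compSetoid_disjointUnion]
    refine Setoid.block_le (fun a b _ => ?_) (fun a b _ => ?_) <;>
      · rw [Setoid.ker_def]; simp
  have h : (link a C R).compSetoid ≤ s := by
    rcases hr : C.root with _ | rc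
    · simp only [link, hr]
      exact h0
    · rw [compSetoid_link_of_some hr]
      refine sup_le h0 (Setoid.pair_le ?_)
      rw [Setoid.ker_def]; simp
  intro h'
  have := h h'
  rw [Setoid.ker_def] at this
  simp at this

theorem link_comp_inl (hC : C.IsRooted) (e : A) :
    (link a C R).compSetoid none (some (.inl e)) := by
  rcases hr : C.root with _ | rc
  · exact ((hC.isEmpty hr).false e).elim
  · have h0 : (C.disjointUnion R).compSetoid (some (.inl rc)) (some (.inl e)) := by
      rw [compSetoid_disjointUnion, Setoid.block_inl]
      exact hC.comp_root rc hr e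
    rw [compSetoid_link_of_some hr]
    exact Setoid.trans' _ ((le_sup_right : Setoid.pair _ _ ≤ _) (Setoid.pair_rel _ _))
      ((le_sup_left : (C.disjointUnion R).compSetoid ≤ _) h0)

open Classical in
theorem numCycles_white_link : numCycles (link a C R).white =
    numCycles C.white + numCycles R.white + if C.root = none then 1 else 0 := by
  have h0 : numCycles (C.disjointUnion R).white = _ := numCycles_optionCongr_sumCongr _ _
  rcases link_cases a C R with ⟨h1, h⟩ | ⟨rc, h1, -, h⟩ | ⟨rc, h1, ha, h⟩ <;> rw [h, h1]
  · simpa using h0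
  · have := numCycles_swap_mul_of_not (σ := (C.disjointUnion R).white) (x := none)
      (y := (C.disjointUnion R).black⁻¹ (some (.inl rc)))
      (not_sameCycle_of_fixed rfl (none_ne_disjointUnion_inv _ _))
    simp only [swapWhite, reduceCtorEq, if_false]
    omega
  · have := numCycles_swap_mul_of_not (not_sameCycle_of_fixed
      (σ := (C.disjointUnion R).white) (x := none) rfl (ne_white_pow
        (N := C.disjointUnion R) (r := some (.inl rc)) rfl rfl (by simp) ha))
    simp only [addLoop, swapWhite, swapBlack, reduceCtorEq, if_false]
    omega

/-- The new edge brings a black vertex of its own, which is identified with the root of `C` if `a >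
0`. The hypothesis is needed because the link to a single vertex ignores `a`. -/
theorem numCycles_black_link (ha : C.root = none → a = 0) : numCycles (link a C R).black =
    numCycles C.black + numCycles R.black + if a = 0 then 1 else 0 := by
  have h0 : numCycles (C.disjointUnion R).black = _ := numCycles_optionCongr_sumCongr _ _
  rcases link_cases a C R with ⟨h1, h⟩ | ⟨rc, h1, h2, h⟩ | ⟨rc, h1, h2, h⟩ <;> rw [h]
  · simpa [ha h1] using h0
  · simpa [h2, swapWhite] using h0
  · have := numCycles_swap_mul_of_not (σ := (C.disjointUnion R).black) (x := none)
      (y := some (.inl rc)) (not_sameCycle_of_fixed rfl (by simp))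
    simp only [addLoop, swapWhite, swapBlack, h2.ne', if_false]
    omega

theorem minimalPeriod_disjointUnion_inl (M : BipMap A) (e : A) :
    Function.minimalPeriod (M.disjointUnion R).facePerm (some (.inl e)) =
      Function.minimalPeriod M.facePerm e :=
  minimalPeriod_semiconj (φ := fun e => some (Sum.inl e)) (fun a b => by simp)
    (fun a => by rw [facePerm_disjointUnion]; rfl) e

theorem minimalPeriod_link (ha : a ≤ C.outdeg) :
    Function.minimalPeriod (link a C R).facePerm none + a = 1 + C.outdeg := by
  rcases link_cases a C R with ⟨h1, h⟩ | ⟨rc, h1, h2, h⟩ | ⟨rc, h1, h2, h⟩ <;> rw [h] <;>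
    simp only [outdeg, h1] at ha ⊢
  · rw [Function.minimalPeriod_eq_one_iff_isFixedPt.mpr
      (show Function.IsFixedPt (C.disjointUnion R).facePerm none from rfl)]
    omega
  · rw [minimalPeriod_addBridge (N := C.disjointUnion R) rfl rfl (by simp),
      minimalPeriod_disjointUnion_inl, h2]
    rfl
  · rw [← minimalPeriod_disjointUnion_inl (R := R) C.toBipMap] at ha ⊢
    exact minimalPeriod_addLoop_outer (N := C.disjointUnion R) (x := none) rfl rfl (by simp) h2 ha

theorem minimalPeriod_link_inner (ha : a ≤ C.outdeg) (ha' : 0 < a) {rc : A}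
    (hrc : C.root = some rc) :
    Function.minimalPeriod (link a C R).facePerm (some (.inl rc)) = a := by
  rcases link_cases a C R with ⟨h1, h⟩ | ⟨rc, h1, h2, h⟩ | ⟨rc, h1, h2, h⟩
  · simp [h1] at hrc
  · omega
  · rw [h1] at hrc
    cases hrc
    simp only [outdeg, h1] at ha
    rw [← minimalPeriod_disjointUnion_inl (R := R) C.toBipMap] at ha
    rw [h]
    exact minimalPeriod_addLoop_inner (N := C.disjointUnion R) (x := none) rfl rfl (by simp) h2 ha

end Link

section Attach

variable [Finite A] [Finite B] {a : ℕ} {C : RootedBipMap A} {R : RootedBipMap B}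

theorem attach_of_none (h : R.root = none) :
    attach a C R = ⟨link a C R.toBipMap, some none⟩ := by
  simp only [attach, h]

theorem attach_of_some {rr : B} (h : R.root = some rr) : attach a C R =
    ⟨(link a C R.toBipMap).swapBlack none (some (.inr rr)), some (some (.inr rr))⟩ := by
  simp only [attach, h]

theorem attach_root_ne_none : (attach a C R).root ≠ none := by
  unfold attach
  split <;> simp

theorem attach_genusZero (hC : C.GenusZero) (hR : R.GenusZero) : (attach a C R).GenusZero := by
  rcases h : R.root with _ | rr
  · rw [attach_of_none h]
    exact link_genusZero hC hR
  · rw [attach_of_some h]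
    exact (link_genusZero hC hR).swapBlack_join (link_not_comp _)

theorem attach_isRooted (hC : C.IsRooted) (hR : R.IsRooted) : (attach a C R).IsRooted := by
  refine ⟨?_, fun h => absurd h attach_root_ne_none⟩
  have key : ∀ M : BipMap (Option (A ⊕ B)), (∀ e, M.compSetoid none e) →
      ∀ e f, M.compSetoid e f :=
    fun M h e f => Setoid.trans' _ (Setoid.symm' _ (h e)) (h f)
  have : ∀ e f, (attach a C R).compSetoid e f := by
    refine key _ ?_
    rcases h : R.root with _ | rr
    · rw [attach_of_none h]
      intro e
      match e with
      | none => exact Setoid.refl' _ _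
      | some (.inl e) => exact link_comp_inl hC e
      | some (.inr e) => exact ((hR.isEmpty h).false e).elim
    · rw [attach_of_some h]
      intro e
      rw [comp_swapBlack_of_not _ (not_sameCycle_black_of_not_comp (link_not_comp _))]
      match e with
      | none => exact Setoid.refl' _ _
      | some (.inl e) =>
        exact (le_sup_left : (link a C R.toBipMap).compSetoid ≤ _) (link_comp_inl hC e)
      | some (.inr e) =>
        refine Setoid.trans' _ ((le_sup_right : Setoid.pair _ _ ≤ _) (Setoid.pair_rel _ _)) ?_
        refine (le_sup_left : (link a C R.toBipMap).compSetoid ≤ _) ?_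
        exact comp_of_semiconj (M := R.toBipMap) (φ := fun e => some (Sum.inr e))
          (fun e => link_black_inr ..) (fun e => link_white_inr ..) (hR.comp_root rr h e)
  exact fun r _ e => this r e

open Classical in
theorem numCycles_white_attach : numCycles (attach a C R).white =
    numCycles C.white + numCycles R.white + if C.root = none then 1 else 0 := by
  rw [← numCycles_white_link (a := a)]
  unfold attach
  split <;> rfl

open Classical in
theorem numCycles_black_attach (ha : C.root = none → a = 0) :
    numCycles (attach a C R).black + (if R.root = none then 0 else 1) =
    numCycles C.black + numCycles R.black + if a = 0 then 1 else 0 := by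
  rw [← numCycles_black_link ha]
  rcases h : R.root with _ | rr
  · simp [attach_of_none h]
  · simp only [attach_of_some h, swapBlack, reduceCtorEq, if_false]
    exact numCycles_swap_mul_of_not (not_sameCycle_black_of_not_comp (link_not_comp _))

/-- Gluing the link to the root of `R` merges the outer faces of the two components, so their
lengths add. -/
theorem outdeg_attach (ha : a ≤ C.outdeg) :
    (attach a C R).outdeg + a = 1 + C.outdeg + R.outdeg := by
  have h := minimalPeriod_link (R := R.toBipMap) ha
  rcases hr : R.root with _ | rr
  · simp only [attach, outdeg, hr]
    exact h
  · have h1 := not_sameCycle_face_of_not_comp (link_not_comp (a := a) (C := C) (R := R.toBipMap) rr)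
    have h2 := minimalPeriod_swap_mul_of_not h1
    rw [minimalPeriod_eq_of_sameCycle (sameCycle_swap_mul_of_not h1)] at h2
    have h3 : Function.minimalPeriod (link a C R.toBipMap).facePerm (some (.inr rr)) =
      Function.minimalPeriod R.facePerm rr :=
        minimalPeriod_semiconj (f := R.facePerm) (φ := fun e => some (Sum.inr e))
          (fun a b => by simp) (fun e => link_facePerm_inr ..) rr
    rw [← h]
    simp only [attach, outdeg, hr]
    rw [facePerm_swapBlack, h2, h3]
    omega

end Attach

end RootedBipMap

/-! ### Isomorphisms, embedded parts and commuting attachments -/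

namespace RootedBipMap

open Equiv.Perm BipMap

variable {A B C E : Type}

theorem Iso.refl (M : RootedBipMap A) : M.Iso M := ⟨Equiv.refl _, by simp, by simp, by simp⟩

theorem Iso.symm {M : RootedBipMap A} {N : RootedBipMap B} : M.Iso N → N.Iso M := by
  rintro ⟨τ, hb, hw, hr⟩
  refine ⟨τ.symm, fun e => ?_, fun e => ?_, ?_⟩
  · rw [eq_symm_apply, ← hb, apply_symm_apply]
  · rw [eq_symm_apply, ← hw, apply_symm_apply]
  · rw [hr, Option.map_map]; simp

theorem Iso.trans {M : RootedBipMap A} {N : RootedBipMap B} {K : RootedBipMap C} :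
    M.Iso N → N.Iso K → M.Iso K := by
  rintro ⟨τ, hb, hw, hr⟩ ⟨τ', hb', hw', hr'⟩
  exact ⟨τ.trans τ', fun e => by simp [hb, hb'], fun e => by simp [hw, hw'],
    by rw [hr', hr, Option.map_map]; rfl⟩

/-- `φ` identifies `M` with the part of `N` that is rooted at `p`. -/
structure EmbedsAt (M : RootedBipMap A) (N : BipMap E) (p : Option E) (φ : A → E) : Prop where
  injective : Function.Injective φ
  black : ∀ e, N.black (φ e) = φ (M.black e)
  white : ∀ e, N.white (φ e) = φ (M.white e)
  root : p = M.root.map φ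

theorem Iso.embedsAt {M : RootedBipMap A} {N : RootedBipMap B} : M.Iso N →
    ∃ φ : A → B, M.EmbedsAt N.toBipMap N.root φ := by
  rintro ⟨τ, hb, hw, hr⟩
  exact ⟨τ, τ.injective, hb, hw, hr⟩

theorem EmbedsAt.comp {M : RootedBipMap A} {N : RootedBipMap B} {K : BipMap E} {p : Option E}
    {φ : A → B} {ψ : B → E} (hφ : M.EmbedsAt N.toBipMap N.root φ) (hψ : N.EmbedsAt K p ψ) :
    M.EmbedsAt K p (ψ ∘ φ) where
  injective := hψ.injective.comp hφ.injective
  black e := by simp [hψ.black, hφ.black]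
  white e := by simp [hψ.white, hφ.white]
  root := by rw [hψ.root, hφ.root, Option.map_map]

theorem Iso.exists_embedsAt_iff {M : RootedBipMap A} {N : RootedBipMap B} (h : M.Iso N)
    {K : BipMap E} {p : Option E} : (∃ φ, M.EmbedsAt K p φ) ↔ ∃ φ, N.EmbedsAt K p φ := by
  constructor
  · rintro ⟨φ, hφ⟩
    obtain ⟨ψ, hψ⟩ := h.symm.embedsAt
    exact ⟨_, hψ.comp hφ⟩
  · rintro ⟨φ, hφ⟩
    obtain ⟨ψ, hψ⟩ := h.embedsAt
    exact ⟨_, hψ.comp hφ⟩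

theorem EmbedsAt.facePerm {M : RootedBipMap A} {N : BipMap E} {p : Option E} {φ : A → E}
    (h : M.EmbedsAt N p φ) (e : A) : N.facePerm (φ e) = φ (M.facePerm e) := by
  simp [BipMap.facePerm, h.black, h.white]

variable [DecidableEq A] [DecidableEq B] [DecidableEq C]

/-- The attached map, rooted at the new edge. -/
def attachFirst (a : ℕ) (C : RootedBipMap A) (R : RootedBipMap B) :
    RootedBipMap (Option (A ⊕ B)) :=
  ⟨(attach a C R).toBipMap, some none⟩

theorem attach_congr (a : ℕ) (K : RootedBipMap C) {M : RootedBipMap A} {N : RootedBipMap B}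
    (h : M.Iso N) : (attach a K M).Iso (attach a K N) := by
  obtain ⟨τ, hb, hw, hr⟩ := h
  have hinj : Function.Injective (Option.map (Sum.map id τ) : Option (C ⊕ A) → _) :=
    Option.map_injective (Function.injective_id.sumMap τ.injective)
  refine ⟨optionCongr (Equiv.sumCongr (Equiv.refl C) τ), fun e => ?_, fun e => ?_, ?_⟩
  · rcases hM : M.root with _ | m <;> rw [hM] at hr <;>
      simp only [Option.map_none, Option.map_some] at hr <;>
    rcases hK : K.root with _ | k <;> (try by_cases ha : a = 0) <;>
    rcases e with _ | e | e <;>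
    simp [attach, link, swapBlack, swapWhite, disjointUnion, swap_apply_def, apply_ite, *]
  · rcases hM : M.root with _ | m <;> rw [hM] at hr <;>
      simp only [Option.map_none, Option.map_some] at hr <;>
    rcases hK : K.root with _ | k <;> (try by_cases ha : a = 0) <;>
    rcases e with _ | e | e <;>
    simp [attach, link, swapBlack, swapWhite, disjointUnion, swap_apply_def, apply_ite, *]
  · rcases hM : M.root with _ | m <;> rw [hM] at hr <;>
      simp only [Option.map_none, Option.map_some] at hr <;>
    simp [attach, hM, hr]

/-- Two successive attachments commute. -/
def commEquiv (A B C : Type) : Option (A ⊕ Option (B ⊕ C)) ≃ Option (B ⊕ Option (A ⊕ C)) where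
  toFun
    | none => some (.inr none)
    | some (.inl a) => some (.inr (some (.inl a)))
    | some (.inr none) => none
    | some (.inr (some (.inl b))) => some (.inl b)
    | some (.inr (some (.inr c))) => some (.inr (some (.inr c)))
  invFun
    | none => some (.inr none)
    | some (.inl a) => some (.inr (some (.inl a)))
    | some (.inr none) => none
    | some (.inr (some (.inl b))) => some (.inl b)
    | some (.inr (some (.inr c))) => some (.inr (some (.inr c)))
  left_inv := by rintro (_ | a | _ | b | c) <;> rfl
  right_inv := by rintro (_ | a | _ | b | c) <;> rfl

/-- The two attachments use the same root corner from opposite sides: the edge to `K` comes last in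
clockwise order around the root, the edge to `L` comes first. They commute, which is checked on each
kind of edge. -/
theorem attach_attachFirst (a : ℕ) (K : RootedBipMap A) (L : RootedBipMap B) (R : RootedBipMap C) :
    (attach a K (attachFirst 0 L R)).Iso (attachFirst 0 L (attach a K R)) := by
  refine ⟨commEquiv A B C, fun e => ?_, fun e => ?_, ?_⟩
  · rcases hR : R.root with _ | r <;> rcases hK : K.root with _ | k <;>
    rcases hL : L.root with _ | l <;> (try by_cases ha : a = 0) <;>
    rcases e with _ | e | _ | e | e <;>
    simp [attach, attachFirst, link, swapBlack, swapWhite, disjointUnion, swap_apply_def,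
      commEquiv, *] <;>
    split_ifs <;> simp_all
  · rcases hR : R.root with _ | r <;> rcases hK : K.root with _ | k <;>
    rcases hL : L.root with _ | l <;> (try by_cases ha : a = 0) <;>
    rcases e with _ | e | _ | e | e <;>
    simp [attach, attachFirst, link, swapBlack, swapWhite, disjointUnion, swap_apply_def,
      commEquiv, apply_ite, *]
  · simp [attach, attachFirst, commEquiv]

end RootedBipMap

/-! ### Deletion of an edge -/

namespace BipMap

open Equiv.Perm

variable {E : Type} [DecidableEq E] (N : BipMap E) (e : E)

theorem delete_black : (N.delete e).black = swap e (N.black e) * N.black := by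
  simp [delete, mul_swap_eq_swap_mul, swap_comm]

theorem delete_white : (N.delete e).white = swap e (N.white e) * N.white := by
  simp [delete, mul_swap_eq_swap_mul, swap_comm]

theorem delete_eq_swap : N.delete e =
    (N.swapWhite e (N.white e)).swapBlack e (N.black e) := by
  rw [show N.delete e = ⟨(N.delete e).black, (N.delete e).white⟩ from rfl, delete_black,
    delete_white]
  rfl

theorem delete_black_self : (N.delete e).black e = e := by simp [delete_black]

theorem delete_white_self : (N.delete e).white e = e := by simp [delete_white]

variable {N e}

theorem delete_black_of_ne {f : E} (hf : f ≠ e) (h : N.black f ≠ e) :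
    (N.delete e).black f = N.black f := by
  rw [delete_black, mul_apply, swap_apply_of_ne_of_ne h (N.black.injective.ne hf)]

theorem delete_white_of_ne {f : E} (hf : f ≠ e) (h : N.white f ≠ e) :
    (N.delete e).white f = N.white f := by
  rw [delete_white, mul_apply, swap_apply_of_ne_of_ne h (N.white.injective.ne hf)]

theorem semiconj_delete {A : Type} [DecidableEq A] {M : BipMap A} {φ : A → E} {x : A}
    (hφ : Function.Injective φ)
    (hb : ∀ a, N.black (φ a) = φ (M.black a)) (hw : ∀ a, N.white (φ a) = φ (M.white a)) (a : A) :
    (N.delete (φ x)).black (φ a) = φ ((M.delete x).black a) ∧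
    (N.delete (φ x)).white (φ a) = φ ((M.delete x).white a) := by
  simp only [delete_black, delete_white, mul_apply, hb, hw, hφ.swap_apply, and_self]

/-- Deletion multiplies each rotation by a transposition that depends only on the value at the
deleted edge. To extend an embedding over this edge, it is enough to compare the two values there.
-/
theorem semiconj_of_delete {A : Type} [DecidableEq A] {M : BipMap A} {φ : A → E} {x : A}
    (hφ : Function.Injective φ)
    (hb : ∀ a, (N.delete (φ x)).black (φ a) = φ ((M.delete x).black a))
    (hw : ∀ a, (N.delete (φ x)).white (φ a) = φ ((M.delete x).white a))
    (hbx : N.black (φ x) = φ (M.black x)) (hwx : N.white (φ x) = φ (M.white x)) (a : A) :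
    N.black (φ a) = φ (M.black a) ∧ N.white (φ a) = φ (M.white a) := by
  constructor
  · have := hb a
    rw [delete_black, delete_black, mul_apply, mul_apply, ← hφ.swap_apply, ← hbx] at this
    exact (swap _ _).injective this
  · have := hw a
    rw [delete_white, delete_white, mul_apply, mul_apply, ← hφ.swap_apply, ← hwx] at this
    exact (swap _ _).injective this

variable [Finite E]

theorem GenusZero.delete (hN : N.GenusZero) (e : E) : (N.delete e).GenusZero := by
  have h1 : (N.swapWhite e (N.white e)).GenusZero := by
    by_cases h : N.white e = e
    · rw [h, swapWhite, swap_self, ← Perm.one_def, one_mul]; exact hN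
    · exact hN.swapWhite_split (Ne.symm h) ⟨1, by simp⟩
  rw [delete_eq_swap]
  by_cases h : N.black e = e
  · rw [h, swapBlack, swap_self, ← Perm.one_def, one_mul]; exact h1
  · exact h1.swapBlack_split (Ne.symm h) ⟨1, by simp [swapWhite]⟩

theorem eq_of_comp_isolated {M : BipMap E} {e f : E} (hb : M.black e = e) (hw : M.white e = e)
    (h : M.compSetoid e f) : f = e := by
  let s : Setoid E := Setoid.ker fun f => f = e
  have hs : M.compSetoid ≤ s := by
    refine M.compSetoid_le (fun f => ?_) (fun f => ?_) <;> rw [Setoid.ker_def, eq_iff_iff]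
    · exact ⟨fun h => h ▸ hb, fun h => M.black.injective (h.trans hb.symm)⟩
    · exact ⟨fun h => h ▸ hw, fun h => M.white.injective (h.trans hw.symm)⟩
  have := hs h
  rw [Setoid.ker_def, eq_iff_iff] at this
  exact this.mp rfl

theorem comp_delete_of_sameCycle_black {f g : E} (hf : f ≠ e) (hg : g ≠ e)
    (h : SameCycle N.black f g) : (N.delete e).compSetoid f g := by
  obtain ⟨k, rfl⟩ := h.exists_nat_pow_eq
  -- The rotation may pass through the deleted edge. At that moment the invariant refers to the
  -- successor of `e`, to which the rotation jumps after deletion.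
  have key : ∀ k : ℕ, ((N.black ^ k) f ≠ e → (N.delete e).compSetoid f ((N.black ^ k) f)) ∧
      ((N.black ^ k) f = e → (N.delete e).compSetoid f (N.black e)) := by
    intro k
    induction k with
    | zero => exact ⟨fun _ => Setoid.refl' _ _, fun h => absurd h hf⟩
    | succ k ih =>
      rw [pow_succ', mul_apply]
      by_cases hz : (N.black ^ k) f = e
      · rw [hz]
        exact ⟨fun _ => ih.2 hz, fun _ => ih.2 hz⟩
      · have h1 := ih.1 hz
        have h2 := comp_black_apply (N.delete e) ((N.black ^ k) f)
        constructor
        · intro h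
          rw [delete_black_of_ne hz h] at h2
          exact Setoid.trans' _ h1 h2
        · intro h
          rw [delete_black, mul_apply, h, swap_apply_left] at h2
          exact Setoid.trans' _ h1 h2
  exact (key k).1 hg

theorem delete_flip : N.flip.delete e = (N.delete e).flip := rfl

theorem comp_delete_of_sameCycle_white {f g : E} (hf : f ≠ e) (hg : g ≠ e)
    (h : SameCycle N.white f g) : (N.delete e).compSetoid f g := by
  rw [← flip_compSetoid, ← delete_flip]
  exact comp_delete_of_sameCycle_black hf hg h

/-- This passes from paths between vertices to components of edges. If `N.black e = e`, the black
end of `e` is left without edges after deletion, so no component of edges represents it. -/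
theorem isBridge_iff (he : N.white e ≠ e) : N.IsBridge e ↔
    (N.black e = e ∨ ¬ (N.delete e).compSetoid (N.black e) (N.white e)) := by
  constructor
  · intro h
    by_contra! hc
    obtain ⟨hb, hc⟩ := hc
    apply h
    let J := N.JoinedBy {e}ᶜ
    have hJ : Equivalence J := Relation.EqvGen.is_equivalence _
    have key : ∀ f, f ≠ e → J (N.blackEnd f) (N.whiteEnd f) :=
      fun f hf => .rel _ _ ⟨f, hf, rfl, rfl⟩
    -- The deleted edge is isolated and forms a class of its own; other edges are related if their
    -- black ends are joined without `e`.
    let s : Setoid E := ⟨fun f g => f = g ∨ f ≠ e ∧ g ≠ e ∧ J (N.blackEnd f) (N.blackEnd g),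
      fun f => .inl rfl, by
        rintro f g (rfl | ⟨h1, h2, h3⟩)
        · exact .inl rfl
        · exact .inr ⟨h2, h1, hJ.symm h3⟩, by
        rintro f g h (rfl | ⟨h1, h2, h3⟩) (rfl | ⟨h4, h5, h6⟩)
        · exact .inl rfl
        · exact .inr ⟨h4, h5, h6⟩
        · exact .inr ⟨h1, h2, h3⟩
        · exact .inr ⟨h1, h5, hJ.trans h3 h6⟩⟩
    have hend : ∀ f, N.blackEnd (N.black f) = N.blackEnd f := fun f =>
      congrArg Sum.inl (Quotient.sound (show SameCycle _ _ _ from sameCycle_apply_left.mpr .rfl))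
    have hendw : ∀ f, N.whiteEnd (N.white f) = N.whiteEnd f := fun f =>
      congrArg Sum.inr (Quotient.sound (show SameCycle _ _ _ from sameCycle_apply_left.mpr .rfl))
    have hs : (N.delete e).compSetoid ≤ s := by
      refine compSetoid_le _ (fun f => ?_) (fun f => ?_)
      · by_cases hf : f = e
        · left; rw [hf, delete_black_self]
        · right
          refine ⟨hf, fun h => hf ?_, ?_⟩
          · exact (N.delete e).black.injective (h.trans (delete_black_self N e).symm)
          · by_cases h1 : N.black f = e
            · rw [delete_black, mul_apply, h1, swap_apply_left, hend, ← h1, hend]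
              exact hJ.refl _
            · rw [delete_black_of_ne hf h1, hend]
              exact hJ.refl _
      · by_cases hf : f = e
        · left; rw [hf, delete_white_self]
        · right
          have h2 : (N.delete e).white f ≠ e := fun h => hf
            ((N.delete e).white.injective (h.trans (delete_white_self N e).symm))
          refine ⟨hf, h2, ?_⟩
          refine hJ.trans (key f hf) (hJ.symm ?_)
          have h3 := key _ h2
          refine hJ.trans h3 ?_
          by_cases h1 : N.white f = e
          · rw [delete_white, mul_apply, h1, swap_apply_left, hendw, ← h1, hendw]
            exact hJ.refl _
          · rw [delete_white_of_ne hf h1, hendw]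
            exact hJ.refl _
    have h1 : J (N.blackEnd (N.black e)) (N.blackEnd (N.white e)) := by
      rcases hs hc with h | h
      · rw [h]; exact hJ.refl _
      · exact h.2.2
    have h2 := hJ.trans h1 (key _ he)
    rw [hend, hendw] at h2
    exact h2
  · intro hc hJ
    -- The vertices with an edge other than `e` in the component of `N.white e` after deletion. A
    -- path that avoids `e` cannot leave this set.
    let side : N.Vertex → Prop := Sum.elim
      (Quotient.lift (fun f => ∃ g, g ≠ e ∧ SameCycle N.black f g ∧
        (N.delete e).compSetoid g (N.white e)) fun f g hfg => by
          have hfg : SameCycle N.black f g := hfg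
          refine propext ⟨?_, ?_⟩
          · rintro ⟨k, h1, h2, h3⟩; exact ⟨k, h1, hfg.symm.trans h2, h3⟩
          · rintro ⟨k, h1, h2, h3⟩; exact ⟨k, h1, hfg.trans h2, h3⟩)
      (Quotient.lift (fun f => ∃ g, g ≠ e ∧ SameCycle N.white f g ∧
        (N.delete e).compSetoid g (N.white e)) fun f g hfg => by
          have hfg : SameCycle N.white f g := hfg
          refine propext ⟨?_, ?_⟩
          · rintro ⟨k, h1, h2, h3⟩; exact ⟨k, h1, hfg.symm.trans h2, h3⟩
          · rintro ⟨k, h1, h2, h3⟩; exact ⟨k, h1, hfg.trans h2, h3⟩)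
    have hside : ∀ p q, N.JoinedBy {e}ᶜ p q → (side p ↔ side q) := by
      intro p q h
      induction h with
      | rel p q h =>
        obtain ⟨f, hf, rfl, rfl⟩ := h
        have hf : f ≠ e := hf
        have h1 : side (N.blackEnd f) ↔ (N.delete e).compSetoid f (N.white e) := by
          constructor
          · rintro ⟨g, hg, h2, h3⟩
            exact Setoid.trans' _ (comp_delete_of_sameCycle_black hf hg h2) h3
          · intro h
            exact ⟨f, hf, .rfl, h⟩
        have h2 : side (N.whiteEnd f) ↔ (N.delete e).compSetoid f (N.white e) := by
          constructor
          · rintro ⟨g, hg, h2, h3⟩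
            exact Setoid.trans' _ (comp_delete_of_sameCycle_white hf hg h2) h3
          · intro h
            exact ⟨f, hf, .rfl, h⟩
        rw [h1, h2]
      | refl => rfl
      | symm _ _ _ ih => exact ih.symm
      | trans _ _ _ _ _ ih1 ih2 => exact ih1.trans ih2
    have hw : side (N.whiteEnd e) :=
      ⟨N.white e, he, ⟨1, by simp⟩, Setoid.refl' _ _⟩
    obtain ⟨g, hg, h1, h2⟩ := (hside _ _ hJ).mpr hw
    have h1 : SameCycle N.black e g := h1
    have hbe : N.black e ≠ e := fun h => hg (h1.eq_of_left h).symm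
    have hc := hc.resolve_left hbe
    exact hc (Setoid.trans' _ (comp_delete_of_sameCycle_black hbe hg
      (sameCycle_apply_left.mpr h1)) h2)

section Loop

variable (hN : N.GenusZero) (hw : N.white e ≠ e) (hb : N.black e ≠ e)
  (hc : (N.delete e).compSetoid (N.black e) (N.white e))
include hN hw hb hc

/-- Detaching the white end of `e` keeps genus zero and, by `hc`, the components. It adds a white
vertex, so it cannot also split a face, as it would if both sides of `e` were in one face. -/
theorem not_sameCycle_facePerm_of_comp :
    ¬ SameCycle N.facePerm (N.black e) (N.black (N.white e)) := by
  intro h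
  set N₁ := N.swapWhite e (N.white e) with hN₁
  have hg : N₁.GenusZero := hN.swapWhite_split hw.symm ⟨1, by simp⟩
  have hdel : N.delete e = N₁.swapBlack e (N.black e) := delete_eq_swap N e
  have hc1 : N₁.compSetoid e (N.white e) := by
    have h1 : N₁.compSetoid e (N.black e) := N₁.comp_black_apply e
    refine Setoid.trans' _ h1 ?_
    have h2 := comp_swapBlack_sup N₁ e (N.black e)
    rw [← hdel, Setoid.sup_pair_of_rel h1] at h2
    rw [← h2]
    exact (le_sup_left : (N.delete e).compSetoid ≤ _) hc
  have hcomp : N₁.compSetoid = N.compSetoid := by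
    have := comp_swapWhite_sup N e (N.white e)
    rwa [← hN₁, Setoid.sup_pair_of_rel hc1, Setoid.sup_pair_of_rel (N.comp_white_apply e)] at this
  have h1 : numCycles N₁.white = numCycles N.white + 1 :=
    numCycles_swap_mul_of_sameCycle ⟨1, by simp⟩ hw.symm
  have h2 : numCycles N₁.facePerm = numCycles N.facePerm + 1 := by
    rw [hN₁, facePerm_swapWhite]
    exact numCycles_swap_mul_of_sameCycle h (N.black.injective.ne hw.symm)
  rw [GenusZero, numComp] at hN hg
  rw [hcomp] at hg
  have h3 : N₁.black = N.black := rfl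
  rw [h3] at hg
  omega

/-- Deletion changes the face walk only on arrival at `e`, `N.black e` or `N.black (N.white e)`. The
first and the last lie on the other side of `e`, and the walk has not yet returned to the second. -/
theorem facePerm_pow_delete {i : ℕ} (hi : i < Function.minimalPeriod N.facePerm (N.black e)) :
    ((N.delete e).facePerm ^ i) (N.black e) = (N.facePerm ^ i) (N.black e) := by
  have hns := not_sameCycle_facePerm_of_comp hN hw hb hc
  induction i with
  | zero => rfl
  | succ i ih =>
    have h1 : ((N.delete e).facePerm ^ (i + 1)) (N.black e) =
        (N.delete e).facePerm ((N.facePerm ^ i) (N.black e)) := by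
      rw [pow_succ', mul_apply, ih (by omega)]
    have h2 : (N.delete e).facePerm = swap e (N.black e) *
        (swap (N.black e) (N.black (N.white e)) * N.facePerm) := by
      rw [delete_eq_swap, facePerm_swapBlack, facePerm_swapWhite]
    have h3 : (N.facePerm ^ (i + 1)) (N.black e) ≠ N.black e := by
      intro h
      rw [coe_pow] at h
      have := Function.IsPeriodicPt.minimalPeriod_le (n := i + 1) (by omega) h
      omega
    have h4 : (N.facePerm ^ (i + 1)) (N.black e) ≠ N.black (N.white e) := fun h =>
      hns ⟨(i + 1 : ℕ), by rw [zpow_natCast, h]⟩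
    have h5 : (N.facePerm ^ (i + 1)) (N.black e) ≠ e := fun h =>
      hns ⟨(i + 2 : ℕ), by rw [zpow_natCast, pow_succ', mul_apply, h]; rfl⟩
    rw [h1, h2, mul_apply, mul_apply, ← mul_apply N.facePerm, ← pow_succ',
      swap_apply_of_ne_of_ne h3 h4, swap_apply_of_ne_of_ne h5 h3]

theorem minimalPeriod_le_delete : Function.minimalPeriod N.facePerm (N.black e) ≤
    Function.minimalPeriod (N.delete e).facePerm (N.black e) := by
  by_contra! h
  have h1 := facePerm_pow_delete hN hw hb hc h
  rw [coe_pow, coe_pow, Function.iterate_minimalPeriod] at h1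
  have h2 : 0 < Function.minimalPeriod (N.delete e).facePerm (N.black e) :=
    Function.minimalPeriod_pos_of_mem_periodicPts
      ((N.delete e).facePerm.injective.mem_periodicPts _)
  have := Function.IsPeriodicPt.minimalPeriod_le h2 h1.symm
  omega

/-- The last edge of the inner face precedes `e` around its white end; after deletion it is followed
by the old successor of `e`. This recovers the place where the white end of `e` was. -/
theorem white_eq_delete_pow : N.white e = (N.delete e).white
    (((N.delete e).facePerm ^ (Function.minimalPeriod N.facePerm (N.black e) - 1))
      (N.black e)) := by
  have h2 : 0 < Function.minimalPeriod N.facePerm (N.black e) :=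
    Function.minimalPeriod_pos_of_mem_periodicPts (N.facePerm.injective.mem_periodicPts _)
  rw [facePerm_pow_delete hN hw hb hc (by omega)]
  set z := (N.facePerm ^ (Function.minimalPeriod N.facePerm (N.black e) - 1)) (N.black e)
  have h1 : N.facePerm z = N.black e := by
    rw [← mul_apply, ← pow_succ', Nat.sub_add_cancel h2, coe_pow, Function.iterate_minimalPeriod]
  have h3 : N.white z = e := N.black.injective h1
  rw [delete_white, mul_apply, h3, swap_apply_left]

end Loop

end BipMap

/-! ### Degree trees -/

namespace EdgeTree

instance finite_edge : (t : EdgeTree) → Finite t.Edge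
  | point => inferInstanceAs (Finite Empty)
  | graft _ c r =>
    haveI := finite_edge c
    haveI := finite_edge r
    inferInstanceAs (Finite (Option (c.Edge ⊕ r.Edge)))

/-- The number of edges. -/
def size : EdgeTree → ℕ
  | point => 0
  | graft _ c r => c.size + r.size + 1

/-- The half-degree of the outer face of the map of a tree. -/
def excess : EdgeTree → ℕ
  | point => 0
  | graft a c r => 1 + c.excess + r.excess - a

/-- Only leftmost edges have a nonzero label, and it is at most the excess of their lower end. -/
def IsDegree : EdgeTree → Prop
  | point => True
  | graft a c r => c.IsDegree ∧ r.IsDegree ∧ r.rootLabel = 0 ∧ a ≤ c.excess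

/-- The trees `s` and `t` joined at their roots, `s` on the left. -/
def append : EdgeTree → EdgeTree → EdgeTree
  | point, t => t
  | graft a c r, t => graft a c (r.append t)

theorem append_point (t : EdgeTree) : t.append point = t := by
  induction t with
  | point => rfl
  | graft a c r _ ih => rw [append, ih]

theorem append_assoc (s t u : EdgeTree) : (s.append t).append u = s.append (t.append u) := by
  induction s with
  | point => rfl
  | graft a c r _ ih => rw [append, append, ih, append]

theorem size_append (s t : EdgeTree) : (s.append t).size = s.size + t.size := by
  induction s with
  | point => simp [append, size]
  | graft a c r _ ih => rw [append, size, ih, size]; omega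

theorem card_edge (t : EdgeTree) : Nat.card t.Edge = t.size := by
  induction t with
  | point => exact Nat.card_eq_zero.mpr (.inl (inferInstanceAs (IsEmpty Empty)))
  | graft a c r ihc ihr =>
    rw [size, ← ihc, ← ihr]
    change Nat.card (Option (c.Edge ⊕ r.Edge)) = _
    rw [Finite.card_option, Nat.card_sum]

theorem isDegree_append {t c : EdgeTree} (ht : t.IsDegree) (hc : c.IsDegree) :
    (t.append (graft 0 c point)).IsDegree := by
  induction t with
  | point => exact ⟨hc, trivial, rfl, Nat.zero_le _⟩
  | graft a c' r _ ih =>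
    refine ⟨ht.1, ih ht.2.1, ?_, ht.2.2.2⟩
    have := ht.2.2.1
    cases r with
    | point => rfl
    | graft b _ _ => exact this

/-- The cases of the exploration, which meets the rightmost child first. A positive label is on a
leftmost edge, so it is met first only if the root has a single child. -/
theorem exists_eq_append {t : EdgeTree} (ht : t.IsDegree) (h : t ≠ point) :
    (∃ s c : EdgeTree, t = s.append (graft 0 c point) ∧ s.IsDegree ∧ c.IsDegree) ∨
    ∃ a c, 0 < a ∧ t = graft a c point ∧ c.IsDegree ∧ a ≤ c.excess := by
  induction t with
  | point => exact absurd rfl h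
  | graft a c r _ ih =>
    obtain ⟨hc, hr, h0, ha⟩ := ht
    cases r with
    | point =>
      rcases Nat.eq_zero_or_pos a with rfl | ha'
      · exact .inl ⟨point, c, rfl, trivial, hc⟩
      · exact .inr ⟨a, c, ha', rfl, hc, ha⟩
    | graft b c' r' =>
      rcases ih hr (by simp) with ⟨s, d, h1, h2, h3⟩ | ⟨a', d, ha', h1, -⟩
      · refine .inl ⟨graft a c s, d, by rw [append, h1], ⟨hc, h2, ?_, ha⟩, h3⟩
        cases s with
        | point => rfl
        | graft b' _ _ =>
          rw [h1] at h0
          exact h0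
      · rw [h1] at h0
        exact absurd h0 ha'.ne'

theorem root_toMap_eq_none {t : EdgeTree} : t.toMap.root = none ↔ t = point := by
  cases t with
  | point => simp [toMap]
  | graft a c r =>
    rw [toMap_graft]
    simp only [reduceCtorEq, iff_false]
    exact RootedBipMap.attach_root_ne_none

theorem toMap_genusZero (t : EdgeTree) : t.toMap.GenusZero := by
  induction t with
  | point =>
    have : IsEmpty (point.Edge) := inferInstanceAs (IsEmpty Empty)
    have h : ∀ s : Setoid point.Edge, Nat.card (Quotient s) = 0 := fun s =>
      Nat.card_eq_zero.mpr (.inl ⟨fun q => Quotient.inductionOn q this.false⟩)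
    simp only [BipMap.GenusZero, Perm.numCycles, BipMap.numComp, h]
    simp
  | graft a c r ihc ihr =>
    rw [toMap_graft]
    exact RootedBipMap.attach_genusZero ihc ihr

theorem toMap_isRooted (t : EdgeTree) : t.toMap.IsRooted := by
  induction t with
  | point => exact ⟨fun r _ e => e.elim, fun _ => inferInstanceAs (IsEmpty Empty)⟩
  | graft a c r ihc ihr =>
    rw [toMap_graft]
    exact RootedBipMap.attach_isRooted ihc ihr

theorem outdeg_toMap {t : EdgeTree} (h : t.IsDegree) : t.toMap.outdeg = t.excess := by
  induction t with
  | point => rfl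
  | graft a c r ihc ihr =>
    have := RootedBipMap.outdeg_attach (R := r.toMap) (h.2.2.2.trans_eq (ihc h.1).symm)
    rw [toMap_graft, excess]
    rw [ihc h.1, ihr h.2.1] at this
    exact Nat.eq_sub_of_add_eq this

theorem toMap_graft_iso (a : ℕ) (c r : EdgeTree) :
    (graft a c r).toMap.Iso (RootedBipMap.attach a c.toMap r.toMap) := by
  rw [toMap_graft]; exact .refl _

/-- `toMap` attaches the leftmost child last. By commutation a rightmost child with label `0` may be
attached last instead, and its edge is then the root edge. -/
theorem toMap_append (t c : EdgeTree) : (t.append (graft 0 c point)).toMap.Iso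
    (RootedBipMap.attachFirst 0 c.toMap t.toMap) := by
  induction t with
  | point =>
    refine (toMap_graft_iso 0 c point).trans ?_
    rw [RootedBipMap.attachFirst, RootedBipMap.attach_of_none rfl]
    exact .refl _
  | graft a c' r _ ih =>
    refine (toMap_graft_iso a c' _).trans ((RootedBipMap.attach_congr a _ ih).trans
      ((RootedBipMap.attach_attachFirst a _ _ _).trans ?_))
    rw [toMap_graft]
    exact .refl _

end EdgeTree

/-! ### Embedded maps under deletion of the root edge -/

namespace RootedBipMap

open Equiv.Perm BipMap

variable {A B E : Type} [DecidableEq A] [DecidableEq B] [DecidableEq E]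
  [Finite A] [Finite B] [Finite E]

theorem _root_.BipMap.ext_perm {M N : BipMap A} (hb : M.black = N.black)
    (hw : M.white = N.white) : M = N := by
  cases M
  cases N
  cases hb
  cases hw
  rfl

theorem link_delete (a : ℕ) (C : RootedBipMap A) (R : BipMap B) :
    (link a C R).delete none = C.disjointUnion R := by
  rw [delete_eq_swap]
  rcases link_cases a C R with ⟨-, h⟩ | ⟨rc, -, -, h⟩ | ⟨rc, -, ha, h⟩ <;> rw [h]
  · change (BipMap.mk _ _) = _
    simp only [show (C.disjointUnion R).black none = none from rfl,
      show (C.disjointUnion R).white none = none from rfl, swapWhite, swap_self, ← Perm.one_def,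
      one_mul]
  · simp only [swapWhite, swapBlack, mul_apply,
      show (C.disjointUnion R).black none = none from rfl,
      show (C.disjointUnion R).white none = none from rfl, swap_self, ← Perm.one_def,
      one_mul, swap_apply_left, swap_mul_self_mul]
  · simp only [addLoop, swapWhite, swapBlack, mul_apply,
      show (C.disjointUnion R).black none = none from rfl,
      show (C.disjointUnion R).white none = none from rfl,
      swap_apply_left, swap_mul_self_mul]

theorem link_zero_black (C : RootedBipMap A) (R : BipMap B) :
    (link 0 C R).black = (C.disjointUnion R).black := by
  rcases link_cases 0 C R with ⟨-, h⟩ | ⟨rc, -, -, h⟩ | ⟨rc, -, ha, h⟩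
  · rw [h]
  · rw [h]; rfl
  · omega

theorem attach_zero_black_none (C : RootedBipMap A) (R : RootedBipMap B) :
    (attach 0 C R).black none = R.root.elim none (fun r => some (.inr r)) := by
  rcases h : R.root with _ | rr
  · rw [attach_of_none h]
    simp only [link_zero_black]
    rfl
  · rw [attach_of_some h]
    simp only [swapBlack, link_zero_black, mul_apply]
    exact swap_apply_left _ _

theorem attach_white (a : ℕ) (C : RootedBipMap A) (R : RootedBipMap B) :
    (attach a C R).white = (link a C R.toBipMap).white := by
  unfold attach
  split <;> rfl

theorem attach_zero_delete (C : RootedBipMap A) (R : RootedBipMap B) :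
    (attach 0 C R).delete none = C.disjointUnion R.toBipMap := by
  have hb : ((attach 0 C R).delete none).black = (C.disjointUnion R.toBipMap).black := by
    rw [delete_black, attach_zero_black_none]
    rcases h : R.root with _ | rr
    · rw [attach_of_none h]
      simp only [link_zero_black, Option.elim_none, swap_self, ← Perm.one_def, one_mul]
    · rw [attach_of_some h]
      simp only [swapBlack, link_zero_black, Option.elim_some, swap_mul_self_mul]
  have hw : ((attach 0 C R).delete none).white = (C.disjointUnion R.toBipMap).white := by
    rw [← link_delete 0 C R.toBipMap, delete_white, delete_white, attach_white]
  exact ext_perm hb hw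

theorem link_white_none (a : ℕ) (C : RootedBipMap A) (R : BipMap B) :
    (link a C R).white none = C.root.elim none (fun rc =>
      some (.inl (if a = 0 then C.black⁻¹ rc else C.white ((C.facePerm ^ (a - 1)) rc)))) := by
  rcases h : C.root with _ | rc
  · simp only [link, h]; rfl
  · simp only [link, h, Option.elim_some]
    split_ifs
    · exact swap_apply_left (none : Option (A ⊕ B)) _
    · exact swap_apply_left (none : Option (A ⊕ B)) _

theorem link_black_none {a : ℕ} (ha : 0 < a) (C : RootedBipMap A) (R : BipMap B) {rc : A}
    (h : C.root = some rc) : (link a C R).black none = some (.inl rc) := by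
  simp only [link, h, if_neg ha.ne']
  exact swap_apply_left (none : Option (A ⊕ B)) _

theorem EmbedsAt.comp_of_comp {M : RootedBipMap A} {N : BipMap E} {p : Option E} {φ : A → E}
    (h : M.EmbedsAt N p φ) {f g : A} (hfg : M.compSetoid f g) : N.compSetoid (φ f) (φ g) :=
  comp_of_semiconj h.black h.white hfg

/-- An embedded part is closed under both rotations and their inverses, so it is a union of
components. -/
theorem EmbedsAt.mem_range_of_comp {M : RootedBipMap A} {N : BipMap E} {p : Option E} {φ : A → E}
    (h : M.EmbedsAt N p φ) {f g : E} (hfg : N.compSetoid f g) (hf : f ∈ Set.range φ) :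
    g ∈ Set.range φ := by
  let s : Setoid E := Setoid.ker fun f => f ∈ Set.range φ
  have hs : N.compSetoid ≤ s := by
    refine compSetoid_le _ (fun f => ?_) (fun f => ?_) <;> rw [Setoid.ker_def, eq_iff_iff]
    · constructor
      · rintro ⟨a, rfl⟩
        exact ⟨_, (h.black a).symm⟩
      · rintro ⟨a, ha⟩
        refine ⟨M.black⁻¹ a, N.black.injective ?_⟩
        rw [h.black, ← ha]; simp
    · constructor
      · rintro ⟨a, rfl⟩
        exact ⟨_, (h.white a).symm⟩
      · rintro ⟨a, ha⟩
        refine ⟨M.white⁻¹ a, N.white.injective ?_⟩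
        rw [h.white, ← ha]; simp
  have := hs hfg
  rw [Setoid.ker_def, eq_iff_iff] at this
  exact this.mp hf

/-- The parts of a map that is embedded with an attached part, after deletion of the root edge. -/
structure Splits (C : RootedBipMap A) (R : RootedBipMap B) (N : BipMap E) (e : E)
    (q p : Option E) (φ : A → E) (ψ : B → E) : Prop where
  left : C.EmbedsAt (N.delete e) q φ
  right : R.EmbedsAt (N.delete e) p ψ
  disjoint : ∀ a b, φ a ≠ ψ b
  left_ne : ∀ a, φ a ≠ e
  right_ne : ∀ b, ψ b ≠ e

variable {C : RootedBipMap A} {R : RootedBipMap B} {N : BipMap E} {e : E}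

theorem splits_of_semiconj {M : BipMap (Option (A ⊕ B))}
    (hM : M.delete none = C.disjointUnion R.toBipMap)
    {φ : Option (A ⊕ B) → E} (hφ : Function.Injective φ) (he : φ none = e)
    (hb : ∀ a, N.black (φ a) = φ (M.black a)) (hw : ∀ a, N.white (φ a) = φ (M.white a)) :
    Splits C R N e (C.root.map fun c => φ (some (.inl c))) (R.root.map fun r => φ (some (.inr r)))
      (fun c => φ (some (.inl c))) (fun r => φ (some (.inr r))) := by
  subst he
  have h := semiconj_delete (x := none) hφ hb hw
  rw [hM] at h
  exact {
    left := ⟨fun a b h => by simpa using hφ h, fun a => (h _).1, fun a => (h _).2, rfl⟩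
    right := ⟨fun a b h => by simpa using hφ h, fun a => (h _).1, fun a => (h _).2, rfl⟩
    disjoint := fun a b h => by simpa using hφ h
    left_ne := fun a h => by simpa using hφ h
    right_ne := fun a h => by simpa using hφ h }

/-- The embedding of an attached map from those of its parts. -/
def glue (e : E) (φ : A → E) (ψ : B → E) : Option (A ⊕ B) → E
  | none => e
  | some (.inl a) => φ a
  | some (.inr b) => ψ b

theorem Splits.glue_injective {q p : Option E} {φ : A → E} {ψ : B → E}
    (h : Splits C R N e q p φ ψ) : Function.Injective (glue e φ ψ) := by
  rintro (_ | a | b) (_ | a' | b') hab <;> simp only [glue] at hab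
  · rfl
  · exact absurd hab.symm (h.left_ne a')
  · exact absurd hab.symm (h.right_ne b')
  · exact absurd hab (h.left_ne a)
  · rw [h.left.injective hab]
  · exact absurd hab (h.disjoint _ _)
  · exact absurd hab (h.right_ne b)
  · exact absurd hab.symm (h.disjoint _ _)
  · rw [h.right.injective hab]

theorem Splits.semiconj {q p : Option E} {φ : A → E} {ψ : B → E} (h : Splits C R N e q p φ ψ)
    {M : BipMap (Option (A ⊕ B))} (hM : M.delete none = C.disjointUnion R.toBipMap)
    (hb : N.black e = glue e φ ψ (M.black none)) (hw : N.white e = glue e φ ψ (M.white none))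
    (a : Option (A ⊕ B)) : N.black (glue e φ ψ a) = glue e φ ψ (M.black a) ∧
      N.white (glue e φ ψ a) = glue e φ ψ (M.white a) := by
  refine semiconj_of_delete (x := none) h.glue_injective (fun a => ?_) (fun a => ?_) hb hw a
  · rw [hM]
    match a with
    | none => exact delete_black_self _ _
    | some (.inl a) => exact h.left.black a
    | some (.inr a) => exact h.right.black a
  · rw [hM]
    match a with
    | none => exact delete_white_self _ _
    | some (.inl a) => exact h.left.white a
    | some (.inr a) => exact h.right.white a

end RootedBipMap

/-! ### The case distinction at the root edge of an attached map, and its reversal -/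

namespace RootedBipMap

open Equiv.Perm BipMap

variable {A B E : Type} [DecidableEq A] [DecidableEq B] [DecidableEq E]
  [Finite A] [Finite B] [Finite E]
variable {C : RootedBipMap A} {R : RootedBipMap B} {N : BipMap E} {e : E}

section Forward

variable {φ : Option (A ⊕ B) → E}

theorem EmbedsAt.splits_attachFirst (h : (attachFirst 0 C R).EmbedsAt N (some e) φ) :
    Splits C R N e (C.root.map fun c => φ (some (.inl c))) (N.nextBlack e)
      (fun c => φ (some (.inl c))) (fun r => φ (some (.inr r))) := by
  have he : φ none = e := (Option.some.inj h.root).symm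
  have hn : N.nextBlack e = R.root.map fun r => φ (some (.inr r)) := by
    have h1 := h.black none
    simp only [attachFirst, attach_zero_black_none, he] at h1
    rcases hr : R.root with _ | r
    · rw [hr] at h1
      simp only [Option.elim_none, he] at h1
      simp [nextBlack, h1]
    · rw [hr] at h1
      simp only [Option.elim_some] at h1
      have : φ (some (.inr r)) ≠ e := fun h' => by simpa using h.injective (h'.trans he.symm)
      simp [nextBlack, h1, this]
  rw [hn]
  exact splits_of_semiconj (attach_zero_delete C R) h.injective he h.black h.white

theorem EmbedsAt.splits_attach {a : ℕ} (hR : R.root = none)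
    (h : (attach a C R).EmbedsAt N (some e) φ) :
    Splits C R N e (C.root.map fun c => φ (some (.inl c))) (R.root.map fun r => φ (some (.inr r)))
      (fun c => φ (some (.inl c))) (fun r => φ (some (.inr r))) := by
  rw [attach_of_none hR] at h
  have he : φ none = e := (Option.some.inj h.root).symm
  exact splits_of_semiconj (link_delete a C R.toBipMap) h.injective he h.black h.white

theorem EmbedsAt.white_attachFirst (h : (attachFirst 0 C R).EmbedsAt N (some e) φ) :
    N.white e = C.root.elim e (fun rc => φ (some (.inl (C.black⁻¹ rc)))) := by
  have he : φ none = e := (Option.some.inj h.root).symm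
  have h1 := h.white none
  simp only [attachFirst, attach_white, link_white_none, he] at h1
  rw [h1]
  rcases C.root with _ | rc
  · exact he
  · simp

theorem EmbedsAt.bridge_attachFirst (h : (attachFirst 0 C R).EmbedsAt N (some e) φ) {rc : A}
    (hrc : C.root = some rc) : N.white e ≠ e ∧ N.IsBridge e ∧
      (N.delete e).black (N.white e) = φ (some (.inl rc)) := by
  have hs := h.splits_attachFirst
  have h1 := h.white_attachFirst
  rw [hrc, Option.elim_some] at h1
  have h2 : N.white e ≠ e := h1 ▸ hs.left_ne _
  refine ⟨h2, ?_, ?_⟩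
  · rw [isBridge_iff h2]
    -- An edge common to both components would be in the image of `R` and of `C`, which are disjoint
    -- after deletion.
    by_contra! hc
    have hroot := hs.right.root
    rw [nextBlack, if_neg hc.1] at hroot
    obtain ⟨r, -, hr⟩ := Option.map_eq_some_iff.mp hroot.symm
    obtain ⟨b, hb⟩ := hs.right.mem_range_of_comp hc.2 ⟨r, hr⟩
    exact hs.disjoint _ b (h1.symm.trans hb.symm)
  · rw [h1]
    exact (hs.left.black _).trans (by simp)

theorem EmbedsAt.loop_attach {a : ℕ} (ha : 0 < a) (had : a ≤ C.outdeg) (hC : C.IsRooted)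
    (hR : R.root = none)
    (h : (attach a C R).EmbedsAt N (some e) φ) {rc : A} (hrc : C.root = some rc) :
    N.white e ≠ e ∧ ¬ N.IsBridge e ∧ N.black e = φ (some (.inl rc)) ∧
      Function.minimalPeriod N.facePerm (N.black e) = a := by
  have hs := h.splits_attach hR
  rw [attach_of_none hR] at h
  have he : φ none = e := (Option.some.inj h.root).symm
  have h1 := h.white none
  simp only [link_white_none, he, hrc, Option.elim_some, if_neg ha.ne'] at h1
  have h2 := h.black none
  simp only [link_black_none ha C _ hrc, he] at h2
  have h3 : N.white e ≠ e := h1 ▸ hs.left_ne _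
  refine ⟨h3, ?_, h2, ?_⟩
  · rw [isBridge_iff h3]
    push Not
    refine ⟨h2 ▸ hs.left_ne _, ?_⟩
    rw [h1, h2]
    exact hs.left.comp_of_comp (hC.comp_root rc hrc _)
  · rw [h2, minimalPeriod_semiconj (f := (link a C R.toBipMap).facePerm) h.injective h.facePerm]
    exact minimalPeriod_link_inner had ha hrc

end Forward

section Backward

variable {q p : Option E} {φ : A → E} {ψ : B → E}

/-- Only the values at `e` have to be compared. The white successor of `e` is determined by its
black successor in the remaining map, which is the root of the left part. -/
theorem Splits.attachFirst (h : Splits C R N e q (N.nextBlack e) φ ψ)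
    (hw : ∀ f ∈ q, (N.delete e).black (N.white e) = f) (hq : q = none → N.white e = e) :
    (attachFirst 0 C R).EmbedsAt N (some e) (glue e φ ψ) := by
  have key := h.semiconj (attach_zero_delete C R) ?_ ?_
  · exact ⟨h.glue_injective, fun a => (key a).1, fun a => (key a).2, rfl⟩
  · rw [attach_zero_black_none]
    have h1 := h.right.root
    rcases hr : R.root with _ | r
    · rw [hr, nextBlack] at h1
      split_ifs at h1 with h2
      · exact h2
      · simp at h1
    · rw [hr, nextBlack] at h1
      split_ifs at h1 with h2
      · simp at h1
      · exact Option.some.inj h1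
  · rw [attach_white, link_white_none]
    have h1 := h.left.root
    rcases hc : C.root with _ | c
    · rw [hc] at h1
      exact hq h1
    · rw [hc] at h1
      have h2 := hw (φ c) h1
      apply (N.delete e).black.injective
      rw [h2]
      simp only [Option.elim_some, if_true, glue, h.left.black]
      simp

/-- The half-degree of the face beyond `e` is an admissible label because this face becomes an
initial part of the outer walk of the remaining map, and the end of this part is where the white end
of `e` was. -/
theorem Splits.attach (h : Splits C R N e (some (N.black e)) p φ ψ) (hN : N.GenusZero)
    (hw : N.white e ≠ e) (hb : N.black e ≠ e) (hR : R.root = none)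
    (hc : (N.delete e).compSetoid (N.black e) (N.white e)) :
    0 < Function.minimalPeriod N.facePerm (N.black e) ∧
    Function.minimalPeriod N.facePerm (N.black e) ≤ C.outdeg ∧
    (attach (Function.minimalPeriod N.facePerm (N.black e)) C R).EmbedsAt N (some e)
      (glue e φ ψ) := by
  obtain ⟨rc, hrc, h1⟩ := Option.map_eq_some_iff.mp h.left.root.symm
  have hpos : 0 < Function.minimalPeriod N.facePerm (N.black e) :=
    Function.minimalPeriod_pos_of_mem_periodicPts (N.facePerm.injective.mem_periodicPts _)
  refine ⟨hpos, ?_, ?_⟩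
  · refine (minimalPeriod_le_delete hN hw hb hc).trans_eq ?_
    rw [← h1, minimalPeriod_semiconj (f := C.facePerm) h.left.injective h.left.facePerm]
    simp only [outdeg, hrc]
  · rw [attach_of_none hR]
    set a := Function.minimalPeriod N.facePerm (N.black e) with ha
    have key := h.semiconj (link_delete a C R.toBipMap) ?_ ?_
    · exact ⟨h.glue_injective, fun a => (key a).1, fun a => (key a).2, rfl⟩
    · rw [link_black_none hpos C _ hrc]
      exact h1.symm
    · rw [link_white_none, hrc, Option.elim_some, if_neg hpos.ne', white_eq_delete_pow hN hw hb hc]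
      have hpow : ∀ k : ℕ, ((N.delete e).facePerm ^ k) (N.black e) = φ ((C.facePerm ^ k) rc) := by
        intro k
        induction k with
        | zero => exact h1.symm
        | succ k ih => rw [pow_succ', mul_apply, ih, h.left.facePerm, pow_succ', mul_apply]
      rw [hpow]
      exact h.left.white _

end Backward

theorem EmbedsAt.congr {M : RootedBipMap A} {N N' : BipMap E} {p : Option E} {φ : A → E}
    (h : M.EmbedsAt N p φ) (hN : ∀ a, N'.black (φ a) = N.black (φ a) ∧
      N'.white (φ a) = N.white (φ a)) : M.EmbedsAt N' p φ :=
  ⟨h.injective, fun a => (hN a).1.trans (h.black a), fun a => (hN a).2.trans (h.white a), h.root⟩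

end RootedBipMap

open RootedBipMap BipMap

/-! ### Exploration of the map of a degree tree -/

namespace EdgeTree

variable {E : Type} [DecidableEq E] [Finite E]

theorem root_toMap_ne_point {t : EdgeTree} (h : t ≠ point) : ∃ r, t.toMap.root = some r := by
  rcases hr : t.toMap.root with _ | r
  · exact absurd (root_toMap_eq_none.mp hr) h
  · exact ⟨r, rfl⟩

/-- The embedded form, with arbitrary `t₀` and `s`, is what the recursion needs: subtrees are
explored inside a larger map, from right to left, and added in front of the finished part `t₀`. The
bound allows two steps per edge of the tree, one for its deletion and one for the return from its
lower end. -/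
theorem explore (t : EdgeTree) (ht : t.IsDegree) (N : BipMap E) (p : Option E) (φ : t.Edge → E)
    (h : t.toMap.EmbedsAt N p φ) (t₀ : EdgeTree) (l : ℕ) (s : List (Frame E)) :
    ∃ k ≤ 2 * t.size, ∃ N' : BipMap E,
      Exploration.step^[k] ⟨N, ⟨p, t₀, l⟩ :: s⟩ = ⟨N', ⟨none, t.append t₀, l⟩ :: s⟩ ∧
      ∀ f ∉ Set.range φ, N'.black f = N.black f ∧ N'.white f = N.white f := by
  induction hn : t.size using Nat.strong_induction_on generalizing t N p t₀ l s with | _ n ih =>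
  subst hn
  by_cases hp : t = point
  · subst hp
    exact ⟨0, Nat.zero_le _, N, by rw [h.root]; rfl, fun _ _ => ⟨rfl, rfl⟩⟩
  obtain ⟨r, hr⟩ := root_toMap_ne_point hp
  obtain ⟨e, rfl⟩ : ∃ e, p = some e := ⟨φ r, by rw [h.root, hr]; rfl⟩
  rcases exists_eq_append ht hp with ⟨u, c, rfl, hu, hc⟩ | ⟨a, c, ha, rfl, hc, hac⟩
  · obtain ⟨χ, hχ⟩ := (toMap_append u c).symm.embedsAt
    have hΦ := hχ.comp h
    set Φ := φ ∘ χ with hΦdef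
    have hrange : ∀ x, Φ x ∈ Set.range φ := fun x => ⟨χ x, rfl⟩
    have hs := hΦ.splits_attachFirst
    have he : Φ none = e := (Option.some.inj hΦ.root).symm
    have hfe : ∀ f ∉ Set.range φ, f ≠ e := fun f hf h => hf (h ▸ he ▸ hrange none)
    have hdel : ∀ f ∉ Set.range φ, (N.delete e).black f = N.black f ∧
        (N.delete e).white f = N.white f := by
      intro f hf
      refine ⟨delete_black_of_ne (hfe f hf) fun h' => hf ?_,
        delete_white_of_ne (hfe f hf) fun h' => hf ?_⟩
      · refine h.mem_range_of_comp (f := e) ?_ (he ▸ hrange none)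
        have := N.comp_black_apply f
        rw [h'] at this
        exact Setoid.symm' _ this
      · refine h.mem_range_of_comp (f := e) ?_ (he ▸ hrange none)
        have := N.comp_white_apply f
        rw [h'] at this
        exact Setoid.symm' _ this
    have hsize : (u.append (graft 0 c point)).size = u.size + c.size + 1 := by
      rw [size_append, size, size]; omega
    by_cases hcp : c = point
    · subst hcp
      have hw : N.white e = e := hΦ.white_attachFirst
      obtain ⟨k, hk, N', hN', hN''⟩ := ih u.size (by omega) u hu _ _ _ hs.right
        (graft 0 point t₀) l s rfl
      refine ⟨k + 1, by omega, N', ?_, ?_⟩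
      · rw [Function.iterate_succ_apply, Exploration.step, if_pos hw, hN', append_assoc]
        rfl
      · intro f hf
        have h1 := hN'' f (by rintro ⟨b, rfl⟩; exact hf (hrange _))
        exact ⟨h1.1.trans (hdel f hf).1, h1.2.trans (hdel f hf).2⟩
    · obtain ⟨rc, hrc⟩ := root_toMap_ne_point hcp
      obtain ⟨hw, hbr, hroot⟩ := hΦ.bridge_attachFirst hrc
      obtain ⟨k, hk, N', hN', hN''⟩ := ih c.size (by omega) c hc _ _ _ hs.left
        point 0 (⟨N.nextBlack e, t₀, l⟩ :: s) rfl
      -- The exploration of `c` changes nothing outside its own part, so the map of `u` is still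
      -- intact.
      have hs' : u.toMap.EmbedsAt N' (N.nextBlack e) fun r => Φ (some (.inr r)) :=
        hs.right.congr fun b => hN'' _ (by rintro ⟨a, ha⟩; exact hs.disjoint a b ha)
      obtain ⟨k', hk', N'', hN3, hN4⟩ := ih u.size (by omega) u hu _ _ _ hs'
        (graft 0 c t₀) l s rfl
      -- Read from right to left: deletion of `e`, exploration of `c`, return to the parent,
      -- exploration of `u`.
      refine ⟨k' + 1 + k + 1, by omega, N'', ?_, ?_⟩
      · rw [Function.iterate_succ_apply, Exploration.step, if_neg hw, if_pos hbr,
          Function.iterate_add_apply]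
        rw [hrc, Option.map_some, ← hroot] at hN'
        rw [hN', Function.iterate_succ_apply, Exploration.step, append_point, hN3, append_assoc]
        rfl
      · intro f hf
        have h1 := hN4 f (by rintro ⟨b, rfl⟩; exact hf (hrange _))
        have h2 := hN'' f (by rintro ⟨b, rfl⟩; exact hf (hrange _))
        exact ⟨(h1.1.trans h2.1).trans (hdel f hf).1, (h1.2.trans h2.2).trans (hdel f hf).2⟩
  · have hcp : c ≠ point := by
      rintro rfl
      simp only [excess] at hac
      omega
    obtain ⟨rc, hrc⟩ := root_toMap_ne_point hcp
    obtain ⟨χ, hχ⟩ := (toMap_graft_iso a c point).symm.embedsAt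
    have hΦ := hχ.comp h
    set Φ := φ ∘ χ with hΦdef
    have hrange : ∀ x, Φ x ∈ Set.range φ := fun x => ⟨χ x, rfl⟩
    have hs := hΦ.splits_attach rfl
    have hb := hΦ.loop_attach ha (hac.trans_eq (outdeg_toMap hc).symm) (toMap_isRooted c) rfl hrc
    obtain ⟨hw, hbr, hroot, hper⟩ := hb
    have he : Φ none = e := by
      rw [attach_of_none rfl] at hΦ
      exact (Option.some.inj hΦ.root).symm
    have hfe : ∀ f ∉ Set.range φ, f ≠ e := fun f hf h => hf (h ▸ he ▸ hrange none)
    have hdel : ∀ f ∉ Set.range φ, (N.delete e).black f = N.black f ∧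
        (N.delete e).white f = N.white f := by
      intro f hf
      refine ⟨delete_black_of_ne (hfe f hf) fun h' => hf ?_,
        delete_white_of_ne (hfe f hf) fun h' => hf ?_⟩
      · refine h.mem_range_of_comp (f := e) ?_ (he ▸ hrange none)
        have := N.comp_black_apply f
        rw [h'] at this
        exact Setoid.symm' _ this
      · refine h.mem_range_of_comp (f := e) ?_ (he ▸ hrange none)
        have := N.comp_white_apply f
        rw [h'] at this
        exact Setoid.symm' _ this
    obtain ⟨k, hk, N', hN', hN''⟩ := ih c.size (by simp [size]) c hc _ _ _ hs.left
        point a (⟨none, t₀, l⟩ :: s) rfl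
    refine ⟨1 + k + 1, by simp only [size]; omega, N', ?_, ?_⟩
    · rw [Function.iterate_succ_apply, Exploration.step, if_neg hw, if_neg hbr,
          Function.iterate_add_apply]
      rw [hrc, Option.map_some, ← hroot] at hN'
      rw [hper, hN', Function.iterate_one, Exploration.step, append_point]
      rfl
    · intro f hf
      have h1 := hN'' f (by rintro ⟨b, rfl⟩; exact hf (hrange _))
      exact ⟨h1.1.trans (hdel f hf).1, h1.2.trans (hdel f hf).2⟩

/-! ### Every map of genus zero is the map of a degree tree -/

/-- Induction on the number of edges that are not isolated. The embedding covers only the component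
of `p`, which suits the parts that remain after deletions. -/
theorem exists_embedsAt (N : BipMap E) (hN : N.GenusZero) (p : Option E) :
    ∃ (t : EdgeTree) (φ : t.Edge → E), t.IsDegree ∧ t.toMap.EmbedsAt N p φ := by
  induction hn : {f | N.black f ≠ f ∨ N.white f ≠ f}.ncard using Nat.strong_induction_on
    generalizing N p with | _ n ih =>
  subst hn
  have hpoint : ∀ N : BipMap E, point.toMap.EmbedsAt N none (fun x : point.Edge => Empty.elim x) :=
    fun N => ⟨fun x => Empty.elim x, fun x => Empty.elim x, fun x => Empty.elim x, rfl⟩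
  rcases p with _ | e
  · exact ⟨point, _, trivial, hpoint N⟩
  have hlt : N.black e ≠ e ∨ N.white e ≠ e →
      {f | (N.delete e).black f ≠ f ∨ (N.delete e).white f ≠ f}.ncard <
      {f | N.black f ≠ f ∨ N.white f ≠ f}.ncard := by
    intro h
    refine Set.ncard_lt_ncard ⟨fun f hf => ?_, fun h' => ?_⟩
    · by_contra hc
      simp only [Set.mem_ofPred_eq, not_or, not_not] at hc
      by_cases hfe : f = e
      · subst hfe
        exact absurd h (by simp [hc])
      · rcases hf with hf | hf
        · rw [delete_black_of_ne hfe (by rwa [hc.1])] at hf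
          exact hf hc.1
        · rw [delete_white_of_ne hfe (by rwa [hc.2])] at hf
          exact hf hc.2
    · rcases h' (show e ∈ {f | N.black f ≠ f ∨ N.white f ≠ f} from h) with h1 | h1
      · exact h1 (delete_black_self _ _)
      · exact h1 (delete_white_self _ _)
  have hisol : ∀ {f}, (N.delete e).compSetoid e f → f = e :=
    eq_of_comp_isolated (delete_black_self N e) (delete_white_self N e)
  have hcomp : ∀ {t : EdgeTree} {q : Option E} {φ : t.Edge → E},
      t.toMap.EmbedsAt (N.delete e) q φ → ∀ x, ∃ r ∈ q, (N.delete e).compSetoid r (φ x) := by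
    intro t q φ h x
    rcases hr : t.toMap.root with _ | r
    · exact ((t.toMap_isRooted.isEmpty hr).false x).elim
    · exact ⟨φ r, by rw [h.root, hr]; rfl, h.comp_of_comp (t.toMap_isRooted.comp_root r hr x)⟩
  have hne : ∀ {t : EdgeTree} {q : Option E} {φ : t.Edge → E},
      t.toMap.EmbedsAt (N.delete e) q φ → (∀ r ∈ q, r ≠ e) → ∀ x, φ x ≠ e := by
    intro t q φ h hq x hx
    obtain ⟨r, hr, h1⟩ := hcomp h x
    rw [hx] at h1
    exact hq r hr (hisol (Setoid.symm' _ h1))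
  -- Deletion of an isolated edge does not lower the measure; but if `N.black e = e`, nothing
  -- remains at this vertex and no induction is needed.
  have hnext : ∃ (t : EdgeTree) (ψ : t.Edge → E), t.IsDegree ∧
      t.toMap.EmbedsAt (N.delete e) (N.nextBlack e) ψ := by
    by_cases hb : N.black e = e
    · rw [nextBlack, if_pos hb]
      exact ⟨point, _, trivial, hpoint _⟩
    · exact ih _ (hlt (.inl hb)) _ (hN.delete e) _ rfl
  have hnext_ne : ∀ r ∈ N.nextBlack e, r ≠ e := by
    intro r hr
    rw [nextBlack] at hr
    split_ifs at hr with hb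
    · simp at hr
    · simp only [Option.mem_def, Option.some.injEq] at hr
      exact hr ▸ hb
  by_cases hw : N.white e = e
  · obtain ⟨t, ψ, ht, hψ⟩ := hnext
    have hs : Splits point.toMap t.toMap N e none (N.nextBlack e)
        (fun x : point.Edge => Empty.elim x) ψ :=
      ⟨hpoint _, hψ, fun x => Empty.elim x, fun x => Empty.elim x, hne hψ hnext_ne⟩
    have h := hs.attachFirst (by simp) (fun _ => hw)
    obtain ⟨χ, hχ⟩ := (toMap_append t point).exists_embedsAt_iff.mpr ⟨_, h⟩
    exact ⟨_, χ, isDegree_append ht trivial, hχ⟩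
  · by_cases hbr : N.IsBridge e
    · obtain ⟨t, ψ, ht, hψ⟩ := hnext
      obtain ⟨c, φ, hc, hφ⟩ := ih _ (hlt (.inr hw)) _ (hN.delete e)
        (some ((N.delete e).black (N.white e))) rfl
      have hs : Splits c.toMap t.toMap N e (some ((N.delete e).black (N.white e)))
          (N.nextBlack e) φ ψ := by
        -- A common edge of the two parts would connect `N.black e` with `N.white e` after deletion,
        -- and `e` would not be a bridge.
        refine ⟨hφ, hψ, fun a b hab => ?_, hne hφ ?_, hne hψ hnext_ne⟩
        · obtain ⟨r, hr, h1⟩ := hcomp hφ a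
          obtain ⟨r', hr', h2⟩ := hcomp hψ b
          simp only [Option.mem_def, Option.some.injEq] at hr
          subst hr
          rw [nextBlack] at hr'
          split_ifs at hr' with hb
          · simp at hr'
          · simp only [Option.mem_def, Option.some.injEq] at hr'
            subst hr'
            refine ((isBridge_iff hw).mp hbr).resolve_left hb ?_
            rw [hab] at h1
            exact Setoid.trans' _ h2 (Setoid.symm' _
              (Setoid.trans' _ (comp_black_apply (N.delete e) (N.white e)) h1))
        · rintro r hr rfl
          simp only [Option.mem_def, Option.some.injEq] at hr
          exact hw ((N.delete r).black.injective (hr.trans (delete_black_self N r).symm))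
      have h := hs.attachFirst (by simp) (by simp)
      obtain ⟨χ, hχ⟩ := (toMap_append t c).exists_embedsAt_iff.mpr ⟨_, h⟩
      exact ⟨_, χ, isDegree_append ht hc, hχ⟩
    · obtain ⟨c, φ, hc, hφ⟩ := ih _ (hlt (.inr hw)) _ (hN.delete e) (some (N.black e)) rfl
      rw [isBridge_iff hw] at hbr
      push Not at hbr
      have hs : Splits c.toMap point.toMap N e (some (N.black e)) none φ
          (fun x : point.Edge => Empty.elim x) :=
        ⟨hφ, hpoint _, fun _ x => Empty.elim x, hne hφ (by simpa using hbr.1),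
          fun x => Empty.elim x⟩
      obtain ⟨-, h2, h3⟩ := hs.attach hN hw hbr.1 rfl hbr.2
      obtain ⟨χ, hχ⟩ := (toMap_graft_iso _ c point).exists_embedsAt_iff.mpr ⟨_, h3⟩
      exact ⟨_, χ, ⟨hc, trivial, rfl, h2.trans_eq (outdeg_toMap hc)⟩, hχ⟩

end EdgeTree

open RootedBipMap BipMap Equiv.Perm

/-! ### Invariance under isomorphism -/

namespace Equiv.Perm

variable {A B : Type*} [Finite A] [Finite B]

theorem sameCycle_semiconj {σ : Perm A} {τ : Perm B} {φ : A ≃ B} (h : ∀ a, τ (φ a) = φ (σ a))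
    {a b : A} : SameCycle τ (φ a) (φ b) ↔ SameCycle σ a b := by
  constructor
  · intro h'
    have := sameCycle_setoid_le (σ := τ) (s := (SameCycle.setoid σ).comap φ.symm) (fun x => by
      obtain ⟨a, rfl⟩ := φ.surjective x
      rw [h, Setoid.comap_rel, symm_apply_apply, symm_apply_apply]
      exact ⟨1, by simp⟩) h'
    rw [Setoid.comap_rel, symm_apply_apply, symm_apply_apply] at this
    exact this
  · intro h'
    exact sameCycle_setoid_le (σ := σ) (s := (SameCycle.setoid τ).comap φ) (fun x => by
      rw [Setoid.comap_rel, ← h]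
      exact ⟨1, by simp⟩) h'

theorem numCycles_semiconj {σ : Perm A} {τ : Perm B} {φ : A ≃ B} (h : ∀ a, τ (φ a) = φ (σ a)) :
    numCycles σ = numCycles τ :=
  Nat.card_congr (Quotient.congr φ fun _ _ => (sameCycle_semiconj h).symm)

end Equiv.Perm

namespace RootedBipMap

variable {A B : Type} [Finite A] [Finite B] {M : RootedBipMap A} {N : RootedBipMap B}

theorem Iso.numCycles_black : M.Iso N → numCycles M.black = numCycles N.black :=
  fun ⟨_, hb, _, _⟩ => numCycles_semiconj hb

theorem Iso.numCycles_white : M.Iso N → numCycles M.white = numCycles N.white :=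
  fun ⟨_, _, hw, _⟩ => numCycles_semiconj hw

theorem Iso.card_eq : M.Iso N → Nat.card A = Nat.card B := fun ⟨τ, _⟩ => Nat.card_congr τ

theorem Iso.outdeg_eq : M.Iso N → M.outdeg = N.outdeg := by
  rintro ⟨τ, hb, hw, hr⟩
  rcases h : M.root with _ | r <;> rw [h] at hr <;> simp only [outdeg, h, hr, Option.map]
  refine (minimalPeriod_semiconj τ.injective (fun a => ?_) r).symm
  simp [BipMap.facePerm, hb, hw]

theorem Iso.isRooted (h : M.Iso N) (hM : M.IsRooted) : N.IsRooted := by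
  obtain ⟨τ, hb, hw, hr⟩ := h
  refine ⟨fun r hr' e => ?_, fun h => ?_⟩
  · rw [hr] at hr'
    obtain ⟨r, hr'', rfl⟩ := Option.map_eq_some_iff.mp hr'
    rw [← τ.apply_symm_apply e]
    exact comp_of_semiconj hb hw (hM.comp_root r hr'' _)
  · rw [hr, Option.map_eq_none_iff] at h
    have := hM.isEmpty h
    exact τ.symm.isEmpty

theorem Iso.genusZero (h : M.Iso N) (hM : M.GenusZero) : N.GenusZero := by
  have h1 := h.numCycles_black
  have h2 := h.numCycles_white
  have h3 := h.card_eq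
  have h' := h.symm
  obtain ⟨τ, hb, hw, -⟩ := h
  obtain ⟨τ', hb', hw', -⟩ := h'
  have h4 : numCycles M.facePerm = numCycles N.facePerm :=
    numCycles_semiconj (φ := τ) (fun a => by simp [BipMap.facePerm, hb, hw])
  have hb' : ∀ b, M.black (τ.symm b) = τ.symm (N.black b) := fun b => by
    rw [eq_symm_apply, ← hb, apply_symm_apply]
  have hw' : ∀ b, M.white (τ.symm b) = τ.symm (N.white b) := fun b => by
    rw [eq_symm_apply, ← hw, apply_symm_apply]
  have h5 : M.numComp = N.numComp := by
    refine Nat.card_congr (Quotient.congr τ fun a b => ⟨fun h => comp_of_semiconj hb hw h,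
      fun h => ?_⟩)
    have := comp_of_semiconj hb' hw' h
    rwa [symm_apply_apply, symm_apply_apply] at this
  rw [BipMap.GenusZero] at hM ⊢
  rw [← h1, ← h2, ← h3, ← h4, ← h5, hM]

/-! ### Planarity -/

theorem numCycles_of_isEmpty {E : Type} [IsEmpty E] (σ : Perm E) : numCycles σ = 0 :=
  Nat.card_eq_zero.mpr (.inl ⟨fun q => Quotient.inductionOn q fun e => isEmptyElim e⟩)

theorem comp_of_connected {M : BipMap A} (h : M.Connected) (e f : A) : M.compSetoid e f := by
  let c : M.Vertex → Quotient M.compSetoid := Sum.elim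
    (Quotient.lift (Quotient.mk _) fun _ _ h => Quotient.sound (M.comp_black h))
    (Quotient.lift (Quotient.mk _) fun _ _ h => Quotient.sound (M.comp_white h))
  have key : ∀ p q, M.JoinedBy Set.univ p q → c p = c q := by
    intro p q h
    induction h with
    | rel p q h => obtain ⟨f, -, rfl, rfl⟩ := h; rfl
    | refl => rfl
    | symm _ _ _ ih => exact ih.symm
    | trans _ _ _ _ _ ih1 ih2 => exact ih1.trans ih2
  exact Quotient.exact (key _ _ (h (M.blackEnd e) (M.blackEnd f)))

theorem connected_of_comp {M : BipMap A} (h : ∀ e f, M.compSetoid e f) : M.Connected := by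
  have hJ : Equivalence (M.JoinedBy Set.univ) := Relation.EqvGen.is_equivalence _
  have hbw : ∀ e, M.JoinedBy Set.univ (M.blackEnd e) (M.whiteEnd e) :=
    fun e => .rel _ _ ⟨e, trivial, rfl, rfl⟩
  let s : Setoid A := Setoid.comap M.blackEnd ⟨_, hJ⟩
  have hs : M.compSetoid ≤ s := by
    refine M.compSetoid_le (fun e => ?_) (fun e => ?_)
    · change M.JoinedBy _ _ _
      rw [show M.blackEnd (M.black e) = M.blackEnd e from congrArg Sum.inl
        (Quotient.sound (show SameCycle _ _ _ from sameCycle_apply_left.mpr .rfl))]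
      exact hJ.refl _
    · refine hJ.trans (hbw e) (hJ.symm ?_)
      have := hbw (M.white e)
      rwa [show M.whiteEnd (M.white e) = M.whiteEnd e from congrArg Sum.inr
        (Quotient.sound (show SameCycle _ _ _ from sameCycle_apply_left.mpr .rfl))] at this
  have hrep : ∀ p : M.Vertex, ∃ e, M.JoinedBy Set.univ p (M.blackEnd e) := by
    rintro (p | p)
    · induction p using Quotient.inductionOn with | _ e => exact ⟨e, hJ.refl _⟩
    · induction p using Quotient.inductionOn with | _ e => exact ⟨e, hJ.symm (hbw e)⟩
  intro p q
  obtain ⟨e, he⟩ := hrep p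
  obtain ⟨f, hf⟩ := hrep q
  exact hJ.trans he (hJ.trans (hs (h e f)) (hJ.symm hf))

theorem numComp_eq_one [Nonempty A] {M : BipMap A} (h : ∀ e f, M.compSetoid e f) :
    M.numComp = 1 := by
  rw [numComp, Nat.card_eq_one_iff_unique]
  refine ⟨⟨fun p q => ?_⟩, ⟨Quotient.mk _ (Classical.arbitrary A)⟩⟩
  induction p using Quotient.inductionOn with | _ e =>
  induction q using Quotient.inductionOn with | _ f => exact Quotient.sound (h e f)

theorem numBlack_of_nonempty [Nonempty A] : M.numBlack = numCycles M.black := by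
  rw [numBlack, if_neg (not_isEmpty_of_nonempty A)]; rfl

theorem numFace_of_nonempty [Nonempty A] : M.numFace = numCycles M.facePerm := by
  rw [numFace, if_neg (not_isEmpty_of_nonempty A)]; rfl

theorem numWhite_eq : M.numWhite = numCycles M.white := rfl

theorem IsPlanar.genusZero (h : M.IsPlanar) : M.GenusZero := by
  rcases isEmpty_or_nonempty A with hA | hA
  · have : M.numComp = 0 :=
      Nat.card_eq_zero.mpr (.inl ⟨fun q => Quotient.inductionOn q fun e => isEmptyElim e⟩)
    rw [BipMap.GenusZero, numCycles_of_isEmpty, numCycles_of_isEmpty, numCycles_of_isEmpty, this,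
      Nat.card_of_isEmpty]
  · have := h.euler
    rw [numBlack_of_nonempty, numFace_of_nonempty, numWhite_eq] at this
    rw [BipMap.GenusZero, numComp_eq_one (comp_of_connected h.connected), this]

theorem IsRooted.comp (h : M.IsRooted) (e f : A) : M.compSetoid e f := by
  rcases hr : M.root with _ | r
  · exact ((h.isEmpty hr).false e).elim
  · exact Setoid.trans' _ (Setoid.symm' _ (h.comp_root r hr e)) (h.comp_root r hr f)

theorem isPlanar_of_genusZero (hg : M.GenusZero) (hr : M.IsRooted) : M.IsPlanar := by
  refine ⟨connected_of_comp hr.comp, ?_, fun h hn => (hr.isEmpty hn).false h.some⟩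
  rcases isEmpty_or_nonempty A with hA | hA
  · rw [numBlack, numFace, if_pos hA, if_pos hA, numWhite_eq, numCycles_of_isEmpty,
      Nat.card_of_isEmpty]
  · rw [numBlack_of_nonempty, numFace_of_nonempty, numWhite_eq, hg, numComp_eq_one hr.comp]

end RootedBipMap

/-! ### Maps and degree trees -/

namespace EdgeTree

theorem exists_toMap_iso {n : ℕ} (M : LabelledMap n) :
    ∃ t : EdgeTree, t.IsDegree ∧ t.toMap.Iso M.1 := by
  obtain ⟨t, φ, ht, hφ⟩ := exists_embedsAt M.1.toBipMap M.2.genusZero M.1.root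
  refine ⟨t, ht, Equiv.ofBijective φ ⟨hφ.injective, fun e => ?_⟩, hφ.black, hφ.white, hφ.root⟩
  obtain ⟨r, hr⟩ := Option.ne_none_iff_exists'.mp (M.2.rooted ⟨e⟩)
  have h := hφ.root
  rw [hr] at h
  obtain ⟨x, -, hx⟩ := Option.map_eq_some_iff.mp h.symm
  exact hφ.mem_range_of_comp (comp_of_connected M.2.connected r e) ⟨x, hx⟩

theorem size_eq_of_iso {n : ℕ} {t : EdgeTree} {M : RootedBipMap (Fin n)} (h : t.toMap.Iso M) :
    t.size = n := by
  rw [← card_edge, h.card_eq, Nat.card_fin]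

theorem toTree_eq_of_iso {n : ℕ} {t : EdgeTree} (ht : t.IsDegree) {M : RootedBipMap (Fin n)}
    (h : t.toMap.Iso M) : M.toTree = t := by
  obtain ⟨φ, hφ⟩ := h.embedsAt
  obtain ⟨k, hk, N, hN, -⟩ := t.explore ht _ _ φ hφ point 0 []
  rw [size_eq_of_iso h] at hk
  -- The final state, the root alone without a pending edge, is fixed by `step`, so surplus steps
  -- are harmless.
  rw [RootedBipMap.toTree, ← Nat.sub_add_cancel hk, Function.iterate_add_apply, hN,
    Function.iterate_fixed, append_point]
  · rfl
  · rfl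

theorem exists_labelledMap {n : ℕ} {t : EdgeTree} (hn : t.size = n) :
    ∃ M : LabelledMap n, t.toMap.Iso M.1 := by
  have hcard : Nat.card t.Edge = n := by rw [card_edge, hn]
  let τ : t.Edge ≃ Fin n := Finite.equivFinOfCardEq hcard
  let M : RootedBipMap (Fin n) :=
    ⟨⟨τ.permCongr t.toMap.black, τ.permCongr t.toMap.white⟩, t.toMap.root.map τ⟩
  have h : t.toMap.Iso M := ⟨τ, fun e => by simp [M], fun e => by simp [M], rfl⟩
  exact ⟨⟨M, isPlanar_of_genusZero (h.genusZero t.toMap_genusZero) (h.isRooted t.toMap_isRooted)⟩,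
    h⟩

/-- The number of leaves other than the root. -/
def numLeaves : EdgeTree → ℕ
  | point => 0
  | graft _ c r => c.numLeaves + r.numLeaves + if c.size = 0 then 1 else 0

/-- The number of inner nodes, other than the root, with label `0`. -/
def numLowerZeros : EdgeTree → ℕ
  | point => 0
  | graft _ c r => c.numLowerZeros + r.numLowerZeros +
      if c.size ≠ 0 ∧ c.rootLabel = 0 then 1 else 0

theorem size_eq_zero {t : EdgeTree} : t.size = 0 ↔ t = point := by
  cases t <;> simp [size]

/-- Only the edge to a leaf brings a new white vertex; all other edges end at an existing one. -/
theorem numCycles_white_toMap (t : EdgeTree) : numCycles t.toMap.white = t.numLeaves := by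
  induction t with
  | point =>
    have : IsEmpty point.Edge := inferInstanceAs (IsEmpty Empty)
    exact numCycles_of_isEmpty _
  | graft a c r ihc ihr =>
    rw [(toMap_graft_iso a c r).numCycles_white, numCycles_white_attach, ihc, ihr, numLeaves]
    by_cases h : c = point
    · rw [if_pos (root_toMap_eq_none.mpr h), if_pos (size_eq_zero.mpr h)]
    · rw [if_neg (mt root_toMap_eq_none.mp h), if_neg (mt size_eq_zero.mp h)]

/-- A positive label identifies a node with its leftmost child, so each black vertex is represented
by the lowest node of such a chain, which has label `0`. This node is not a leaf, since the excess
`0` of a leaf admits no positive label above it. -/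
theorem numCycles_black_toMap {t : EdgeTree} (ht : t.IsDegree) : numCycles t.toMap.black =
    t.numLowerZeros + if t.size ≠ 0 ∧ t.rootLabel = 0 then 1 else 0 := by
  induction t with
  | point =>
    have : IsEmpty point.Edge := inferInstanceAs (IsEmpty Empty)
    exact numCycles_of_isEmpty _
  | graft a c r ihc ihr =>
    have h1 : c.toMap.root = none → a = 0 := by
      intro h
      rw [root_toMap_eq_none] at h
      have := ht.2.2.2
      rw [h, excess] at this
      omega
    have := numCycles_black_attach (a := a) (C := c.toMap) (R := r.toMap) h1
    rw [(toMap_graft_iso a c r).numCycles_black]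
    rw [ihc ht.1, ihr ht.2.1] at this
    have h2 : (graft a c r).size ≠ 0 := by rw [Ne, size_eq_zero]; simp
    have h3 : (graft a c r).rootLabel = a := rfl
    have h4 := ht.2.2.1
    rw [numLowerZeros, h3]
    by_cases h : r = point
    · rw [if_pos (root_toMap_eq_none.mpr h)] at this
      simp only [size_eq_zero.mpr h, h2, ne_eq, not_true_eq_false, false_and, if_false,
        not_false_eq_true, true_and] at this ⊢
      omega
    · rw [if_neg (mt root_toMap_eq_none.mp h)] at this
      simp only [mt size_eq_zero.mp h, h2, h4, ne_eq, and_true, if_true,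
        not_false_eq_true, true_and] at this ⊢
      omega

end EdgeTree

/-! ### Forests -/

namespace BinaryTree

/-- The contour of a plane forest, read as children of the first root and remaining forest. -/
def contour (F : BinaryTree Unit) : List DyckStep := (DyckWord.ofTree F).toList

theorem contour_nil : contour nil = [] := rfl

theorem contour_node (u : Unit) (c r : BinaryTree Unit) :
    contour (node u c r) = U :: c.contour ++ D :: r.contour := by
  simp [contour, DyckWord.ofTree, DyckWord.nest, HAdd.hAdd, Add.add]

/-- The number of roots. -/
def roots : BinaryTree Unit → ℕ
  | nil => 0
  | node _ _ r => r.roots + 1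

/-- Concatenation of forests. -/
def join : BinaryTree Unit → BinaryTree Unit → BinaryTree Unit
  | nil, G => G
  | node u c r, G => node u c (r.join G)

/-- The first `a` trees of a forest. -/
def takeTrees : ℕ → BinaryTree Unit → BinaryTree Unit
  | 0, _ => nil
  | _ + 1, nil => nil
  | a + 1, node u c r => node u c (takeTrees a r)

/-- All but the first `a` trees of a forest. -/
def dropTrees : ℕ → BinaryTree Unit → BinaryTree Unit
  | 0, F => F
  | _ + 1, nil => nil
  | a + 1, node _ _ r => dropTrees a r

/-- The numbers of children of the nodes, in preorder. -/
def arities : BinaryTree Unit → List ℕ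
  | nil => []
  | node _ c r => c.roots :: c.arities ++ r.arities

/-- The numbers of nodes strictly below each node, in preorder. -/
def sizes : BinaryTree Unit → List ℕ
  | nil => []
  | node _ c r => c.numNodes :: c.sizes ++ r.sizes

/-- The forest with the given numbers of children in preorder. -/
def ofArities : List ℕ → BinaryTree Unit
  | [] => nil
  | a :: l => node () (takeTrees a (ofArities l)) (dropTrees a (ofArities l))

/-- The list is the list of arities of a forest. -/
def IsArities : List ℕ → Prop
  | [] => True
  | a :: l => a ≤ (ofArities l).roots ∧ IsArities l

theorem join_nil (F : BinaryTree Unit) : F.join nil = F := by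
  induction F with
  | nil => rfl
  | node u c r _ ih => rw [join, ih]

theorem join_assoc (F G H : BinaryTree Unit) : (F.join G).join H = F.join (G.join H) := by
  induction F with
  | nil => rfl
  | node u c r _ ih => rw [join, join, ih, join]

theorem roots_join (F G : BinaryTree Unit) : (F.join G).roots = F.roots + G.roots := by
  induction F with
  | nil => simp [join, roots]
  | node u c r _ ih => rw [join, roots, ih, roots]; omega

theorem numNodes_join (F G : BinaryTree Unit) :
    (F.join G).numNodes = F.numNodes + G.numNodes := by
  induction F with
  | nil => simp [join]
  | node u c r _ ih => simp only [join, numNodes, ih]; omega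

theorem arities_join (F G : BinaryTree Unit) : (F.join G).arities = F.arities ++ G.arities := by
  induction F with
  | nil => rfl
  | node u c r _ ih => simp [join, arities, ih]

theorem sizes_join (F G : BinaryTree Unit) : (F.join G).sizes = F.sizes ++ G.sizes := by
  induction F with
  | nil => rfl
  | node u c r _ ih => simp [join, sizes, ih]

theorem take_join_drop (a : ℕ) (F : BinaryTree Unit) :
    (takeTrees a F).join (dropTrees a F) = F := by
  induction F generalizing a with
  | nil => cases a <;> rfl
  | node u c r _ ih =>
    cases a with
    | zero => rfl
    | succ a => rw [takeTrees, dropTrees, join, ih]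

theorem takeTrees_join {a : ℕ} {F : BinaryTree Unit} (h : a ≤ F.roots) (G : BinaryTree Unit) :
    takeTrees a (F.join G) = takeTrees a F := by
  induction F generalizing a with
  | nil =>
    rw [roots, Nat.le_zero] at h
    rw [h]; rfl
  | node u c r _ ih =>
    cases a with
    | zero => rfl
    | succ a => rw [join, takeTrees, takeTrees, ih (Nat.le_of_succ_le_succ h)]

theorem dropTrees_join {a : ℕ} {F : BinaryTree Unit} (h : a ≤ F.roots) (G : BinaryTree Unit) :
    dropTrees a (F.join G) = (dropTrees a F).join G := by
  induction F generalizing a with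
  | nil =>
    rw [roots, Nat.le_zero] at h
    rw [h]; rfl
  | node u c r _ ih =>
    cases a with
    | zero => rfl
    | succ a => rw [join, dropTrees, dropTrees, ih (Nat.le_of_succ_le_succ h)]

theorem takeTrees_roots (F : BinaryTree Unit) : takeTrees F.roots F = F := by
  induction F with
  | nil => rfl
  | node u c r _ ih => rw [roots, takeTrees, ih]

theorem dropTrees_roots (F : BinaryTree Unit) : dropTrees F.roots F = nil := by
  induction F with
  | nil => rfl
  | node u c r _ ih => rw [roots, dropTrees, ih]

theorem roots_takeTrees {a : ℕ} {F : BinaryTree Unit} (h : a ≤ F.roots) :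
    (takeTrees a F).roots = a := by
  induction F generalizing a with
  | nil =>
    rw [roots, Nat.le_zero] at h
    rw [h]; rfl
  | node u c r _ ih =>
    cases a with
    | zero => rfl
    | succ a => rw [takeTrees, roots, ih (Nat.le_of_succ_le_succ h)]

/-- A tree that is left out has at least one node. Together with `numNodes_le_takeTrees_join`, this
translates bounds on numbers of trees into the bounds on numbers of nodes in bracket vectors. -/
theorem numNodes_takeTrees_lt {a : ℕ} {F : BinaryTree Unit} (h : a < F.roots) :
    (takeTrees a F).numNodes < F.numNodes := by
  have h1 := congrArg numNodes (take_join_drop a F)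
  have h2 := congrArg roots (take_join_drop a F)
  rw [numNodes_join] at h1
  rw [roots_join, roots_takeTrees h.le] at h2
  rcases hd : dropTrees a F with _ | ⟨u, c, r⟩
  · rw [hd, roots] at h2
    omega
  · rw [hd, numNodes] at h1
    omega

theorem numNodes_le_takeTrees_join {a : ℕ} {F G : BinaryTree Unit} (h : F.roots ≤ a) :
    F.numNodes ≤ (takeTrees a (F.join G)).numNodes := by
  induction F generalizing a with
  | nil => simp
  | node u c r _ ih =>
    cases a with
    | zero => simp [roots] at h
    | succ a =>
      have := ih (Nat.le_of_succ_le_succ h)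
      rw [join, takeTrees, numNodes, numNodes]
      omega

/-- Decoding works from the end of the list: when a node is reached, the trees of its children are
the first ones present, and it takes exactly these. -/
theorem ofArities_arities_append (F : BinaryTree Unit) (l : List ℕ) :
    ofArities (F.arities ++ l) = F.join (ofArities l) := by
  induction F generalizing l with
  | nil => rfl
  | node u c r ihc ihr =>
    rw [arities, List.cons_append, List.cons_append, List.append_assoc, ofArities, ihc, ihr,
      takeTrees_join le_rfl, takeTrees_roots, dropTrees_join le_rfl, dropTrees_roots, join, join]

theorem ofArities_arities (F : BinaryTree Unit) : ofArities F.arities = F := by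
  have := ofArities_arities_append F []
  rwa [List.append_nil, ofArities, join_nil] at this

theorem arities_ofArities {l : List ℕ} (h : IsArities l) : (ofArities l).arities = l := by
  induction l with
  | nil => rfl
  | cons a l ih =>
    rw [ofArities, arities, roots_takeTrees h.1, List.cons_append, ← arities_join,
      take_join_drop, ih h.2]

theorem sizes_ofArities (a : ℕ) (l : List ℕ) : (ofArities (a :: l)).sizes =
    (takeTrees a (ofArities l)).numNodes :: (ofArities l).sizes := by
  rw [ofArities, sizes, List.cons_append, ← sizes_join, take_join_drop]

theorem numNodes_ofArities (l : List ℕ) : (ofArities l).numNodes = l.length := by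
  induction l with
  | nil => rfl
  | cons a l ih =>
    have := congrArg numNodes (take_join_drop a (ofArities l))
    rw [numNodes_join] at this
    rw [ofArities, numNodes, List.length_cons, ← ih, ← this]

theorem length_sizes (F : BinaryTree Unit) : F.sizes.length = F.numNodes := by
  induction F with
  | nil => rfl
  | node u c r ihc ihr => simp [sizes, ihc, ihr]

theorem length_arities (F : BinaryTree Unit) : F.arities.length = F.numNodes := by
  induction F with
  | nil => rfl
  | node u c r ihc ihr => simp [arities, ihc, ihr]

theorem count_contour (F : BinaryTree Unit) : F.contour.count U = F.numNodes := by
  induction F with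
  | nil => rfl
  | node u c r ihc ihr =>
    rw [contour_node]
    simp [ihc, ihr]

/-! ### The part of a path between an up step and the matching down step -/

/-- The forest below the `i`-th node in preorder. -/
def subforest : BinaryTree Unit → ℕ → BinaryTree Unit
  | nil, _ => nil
  | node _ c _, 0 => c
  | node _ c r, i + 1 => if i < c.numNodes then c.subforest i else r.subforest (i - c.numNodes)

theorem sizes_getD (F : BinaryTree Unit) (i : ℕ) : F.sizes.getD i 0 = (F.subforest i).numNodes := by
  induction F generalizing i with
  | nil => rfl
  | node u c r ihc ihr =>
    cases i with
    | zero => rfl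
    | succ i =>
      rw [sizes, subforest, List.cons_append, List.getD_cons_succ]
      split_ifs with h
      · rw [List.getD_append _ _ _ _ (by rwa [length_sizes]), ihc]
      · rw [List.getD_append_right _ _ _ _ (by rw [length_sizes]; omega), ihr, length_sizes]

theorem arities_getD (F : BinaryTree Unit) (i : ℕ) :
    F.arities.getD i 0 = (F.subforest i).roots := by
  induction F generalizing i with
  | nil => rfl
  | node u c r ihc ihr =>
    cases i with
    | zero => rfl
    | succ i =>
      rw [arities, subforest, List.cons_append, List.getD_cons_succ]
      split_ifs with h
      · rw [List.getD_append _ _ _ _ (by rwa [length_arities]), ihc]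
      · rw [List.getD_append_right _ _ _ _ (by rw [length_arities]; omega), ihr, length_arities]

theorem afterUp_add_contour (F : BinaryTree Unit) (i : ℕ) (m : List DyckStep) :
    afterUp (F.numNodes + i) (F.contour ++ m) = afterUp i m := by
  induction F generalizing i m with
  | nil => rw [numNodes, zero_add]; rfl
  | node u c r ihc ihr =>
    rw [contour_node, numNodes, show c.numNodes + r.numNodes + 1 + i =
      c.numNodes + (r.numNodes + i) + 1 by omega]
    simp only [List.cons_append, List.append_assoc, afterUp, ihc, ihr]

/-- The rest `l` does not depend on the continuation `m`, so the induction can enter `c` with the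
remainder of the contour as continuation. -/
theorem afterUp_contour (F : BinaryTree Unit) {i : ℕ} (hi : i < F.numNodes) :
    ∃ l, ∀ m, afterUp i (F.contour ++ m) = (F.subforest i).contour ++ D :: (l ++ m) := by
  induction F generalizing i with
  | nil => simp at hi
  | node u c r ihc ihr =>
    cases i with
    | zero =>
      refine ⟨r.contour, fun m => ?_⟩
      rw [contour_node]
      simp only [List.cons_append, List.append_assoc, afterUp, subforest]
    | succ i =>
      by_cases h : i < c.numNodes
      · obtain ⟨l, hl⟩ := ihc h
        refine ⟨l ++ D :: r.contour, fun m => ?_⟩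
        rw [contour_node]
        simp only [List.cons_append, List.append_assoc, afterUp, subforest, if_pos h, hl]
      · have h' : i - c.numNodes < r.numNodes := by
          rw [numNodes] at hi
          omega
        obtain ⟨l, hl⟩ := ihr h'
        refine ⟨l, fun m => ?_⟩
        have := afterUp_add_contour c (i - c.numNodes) (D :: (r.contour ++ m))
        rw [Nat.add_sub_cancel' (by omega)] at this
        rw [contour_node]
        simp only [List.cons_append, List.append_assoc, afterUp, subforest, if_neg h, this, hl]

theorem untilBelow_contour (F : BinaryTree Unit) (h : ℕ) (m : List DyckStep) :
    untilBelow h (F.contour ++ m) = F.contour ++ untilBelow h m := by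
  induction F generalizing h m with
  | nil => rfl
  | node u c r ihc ihr =>
    rw [contour_node]
    simp only [List.cons_append, List.append_assoc]
    cases h <;> simp only [untilBelow, ihc, ihr]

theorem matchedPart_contour (F : BinaryTree Unit) {i : ℕ} (hi : i < F.numNodes) :
    matchedPart F.contour i = (F.subforest i).contour := by
  obtain ⟨l, hl⟩ := afterUp_contour F hi
  have := hl []
  rw [List.append_nil] at this
  rw [matchedPart, this, untilBelow_contour, untilBelow, List.append_nil]

theorem head_afterUp_contour (F : BinaryTree Unit) {i : ℕ} (hi : i < F.numNodes) :
    (afterUp i F.contour).head? = some U ↔ F.arities.getD i 0 ≠ 0 := by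
  obtain ⟨l, hl⟩ := afterUp_contour F hi
  have := hl []
  rw [List.append_nil] at this
  rw [this, arities_getD]
  cases F.subforest i with
  | nil => simp [contour_nil, roots]
  | node u c r => simp [contour_node, roots]

theorem risingContacts_append {l m : List DyckStep} (h : l.count U = l.count D) :
    risingContacts (l ++ m) = risingContacts l + risingContacts m := by
  simp only [risingContacts, Finset.card_filter, List.length_append, Finset.sum_range_add]
  congr 1
  · refine Finset.sum_congr rfl fun k hk => ?_
    rw [Finset.mem_range] at hk
    rw [List.getElem?_append_left hk, List.take_append_of_le_length hk.le]
  · refine Finset.sum_congr rfl fun k hk => ?_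
    rw [List.getElem?_append_right (by omega), List.take_append, Nat.add_sub_cancel_left,
      List.take_of_length_le (by omega)]
    simp [h]

/-- After the first step, no up step starts on the axis, because no prefix of a Dyck word has more
down steps than up steps. -/
theorem risingContacts_nest (w : DyckWord) : risingContacts (U :: w.toList ++ [D]) = 1 := by
  have hl : (U :: w.toList ++ [D]).length = w.toList.length + 1 + 1 := by simp
  simp only [risingContacts, Finset.card_filter, hl]
  rw [Finset.sum_range_succ', Finset.sum_eq_zero]
  · simp
  · intro k hk
    rw [Finset.mem_range] at hk
    refine if_neg ?_
    rintro ⟨h1, h2⟩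
    have h3 := w.count_D_le_count_U k
    rw [List.cons_append, List.take_succ_cons, List.take_append_of_le_length (by omega)] at h2
    simp at h2
    omega

theorem risingContacts_contour (F : BinaryTree Unit) : risingContacts F.contour = F.roots := by
  induction F with
  | nil => rfl
  | node u c r _ ih =>
    have h : contour (node u c r) = (U :: c.contour ++ [D]) ++ r.contour := by
      rw [contour_node]; simp
    rw [h, risingContacts_append, ih, contour, risingContacts_nest, roots, add_comm]
    have := (DyckWord.ofTree c).count_U_eq_count_D
    rw [contour]
    simp [this]

end BinaryTree

namespace BinaryTree

/-! ### Certificates -/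

/-- The roots of a forest are black and all other nodes are red. -/
def colours : BinaryTree Unit → List Bool
  | nil => []
  | node _ c r => true :: List.replicate c.numNodes false ++ r.colours

theorem visit_replicate (a m : ℕ) (l : List Bool) :
    visit a (List.replicate m false ++ l) =
      ((visit a l).1 + m, List.replicate m false ++ (visit a l).2) := by
  induction m with
  | zero => rfl
  | succ m ih =>
    rw [List.replicate_succ, List.cons_append, visit, ih]
    rfl

/-- Black nodes are roots, so stopping before the `(a + 1)`-st black node means passing through
exactly the first `a` trees. -/
theorem visit_colours {a : ℕ} {F : BinaryTree Unit} (h : a ≤ F.roots) : visit a F.colours =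
    ((takeTrees a F).numNodes,
      List.replicate (takeTrees a F).numNodes false ++ (dropTrees a F).colours) := by
  induction F generalizing a with
  | nil =>
    rw [roots, Nat.le_zero] at h
    rw [h]; rfl
  | node u c r _ ih =>
    cases a with
    | zero => rfl
    | succ a =>
      rw [colours, List.cons_append, visit, visit_replicate, ih (Nat.le_of_succ_le_succ h)]
      rw [takeTrees, dropTrees, numNodes, ← List.append_assoc, List.replicate_append_replicate,
        ← List.cons_append, ← List.replicate_succ]
      simp only [Prod.mk.injEq, and_true]
      omega

/-- The invariant of the procedure: a node is black as long as it is a root of the forest decoded so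
far. A visit makes the first `a` trees children of the new node, and the number of visited nodes is
the size below it. -/
theorem certify_eq {l : List ℕ} (h : IsArities l) :
    certify l = ((ofArities l).sizes, (ofArities l).colours) := by
  induction l with
  | nil => rfl
  | cons a l ih =>
    -- For label `0` both sides visit nothing, as the colours of a nonempty forest begin with a
    -- black node.
    have hv : (if a = 0 then (0, (certify l).2) else visit a (certify l).2) =
        visit a (ofArities l).colours := by
      rw [ih h.2]
      split_ifs with ha
      · subst ha
        rw [visit_colours (Nat.zero_le _)]
        cases ofArities l <;> rfl
      · rfl
    rw [certify, hv, ih h.2, visit_colours h.1, sizes_ofArities, ofArities, colours,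
      List.cons_append]

/-- The positions of the last nodes below each node, where the list has the numbers of nodes below
each node in preorder, and the first node has position `k`. -/
def lastPositions : ℕ → List ℕ → List ℕ
  | _, [] => []
  | k, x :: d => (k + x) :: lastPositions (k + 1) d

theorem lastPositions_append (k : ℕ) (d e : List ℕ) :
    lastPositions k (d ++ e) = lastPositions k d ++ lastPositions (k + d.length) e := by
  induction d generalizing k with
  | nil => rfl
  | cons x d ih =>
    rw [List.cons_append, lastPositions, lastPositions, ih, List.cons_append, List.length_cons,
      Nat.add_assoc, Nat.add_comm 1]

theorem lastPositions_eq_map (k : ℕ) (d : List ℕ) :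
    lastPositions k d = (List.range d.length).map fun i => k + i + d.getD i 0 := by
  induction d generalizing k with
  | nil => rfl
  | cons x d ih =>
    rw [lastPositions, ih, List.length_cons, List.range_succ_eq_map, List.map_cons, List.map_map]
    simp only [List.getD_cons_zero, Nat.add_zero, List.cons.injEq, true_and]
    refine List.map_congr_left fun i _ => ?_
    simp only [Function.comp, List.getD_cons_succ]
    omega

theorem mem_lastPositions {F : BinaryTree Unit} {k x : ℕ} (h : x ∈ lastPositions k F.sizes) :
    k ≤ x ∧ x < k + F.numNodes := by
  induction F generalizing k with
  | nil => simp [sizes, lastPositions] at h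
  | node u c r ihc ihr =>
    rw [sizes, List.cons_append, lastPositions, lastPositions_append, length_sizes,
      List.mem_cons, List.mem_append] at h
    rw [numNodes]
    rcases h with rfl | h | h
    · omega
    · have := ihc h; omega
    · have := ihr h; omega

theorem count_lastPositions_of_notMem {F : BinaryTree Unit} {k x : ℕ}
    (h : x < k ∨ k + F.numNodes ≤ x) : (lastPositions k F.sizes).count x = 0 := by
  rw [List.count_eq_zero]
  intro hx
  have := mem_lastPositions hx
  omega

/-- The path where the up step number `k + j`, for `j < n`, is followed by as many down steps as
`k + j` is counted in `L`. -/
def pathOfCounts (L : List ℕ) (k n : ℕ) : List DyckStep :=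
  (List.range n).flatMap fun j => U :: List.replicate (L.count (k + j)) D

theorem pathOfCounts_add (L : List ℕ) (k m n : ℕ) :
    pathOfCounts L k (m + n) = pathOfCounts L k m ++ pathOfCounts L (k + m) n := by
  rw [pathOfCounts, List.range_add, List.flatMap_append, List.flatMap_map]
  simp only [pathOfCounts, Nat.add_assoc]

theorem pathOfCounts_congr {L L' : List ℕ} {k n : ℕ}
    (h : ∀ x, k ≤ x → x < k + n → L.count x = L'.count x) :
    pathOfCounts L k n = pathOfCounts L' k n := by
  rw [pathOfCounts, pathOfCounts, List.flatMap_def, List.flatMap_def]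
  congr 1
  refine List.map_congr_left fun j hj => ?_
  rw [List.mem_range] at hj
  rw [h _ (by omega) (by omega)]

theorem pathOfCounts_one (L : List ℕ) (k : ℕ) :
    pathOfCounts L k 1 = U :: List.replicate (L.count k) D := by
  simp [pathOfCounts]

/-- One more certificate at the last node of a block adds a down step at its end. This is the step
that closes the tree of the block. -/
theorem pathOfCounts_cons_last (L : List ℕ) (k n : ℕ) :
    pathOfCounts ((k + n) :: L) k (n + 1) = pathOfCounts L k (n + 1) ++ [D] := by
  rw [pathOfCounts_add, pathOfCounts_add, pathOfCounts_one, pathOfCounts_one, List.append_assoc,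
    pathOfCounts_congr (L' := L)]
  · simp [List.count_cons_self, List.replicate_succ']
  · intro x _ hx
    rw [List.count_cons_of_ne (by omega)]

/-- Last descendants of the nodes of a subtree lie in its own interval of positions, so the path
breaks up into the root, the part below it and the remaining forest without interference. -/
theorem pathOfCounts_lastPositions (F : BinaryTree Unit) (k : ℕ) :
    pathOfCounts (lastPositions k F.sizes) k F.numNodes = F.contour := by
  induction F generalizing k with
  | nil => rfl
  | node u c r ihc ihr =>
    have hc : ∀ x, k + 1 + c.numNodes ≤ x → (lastPositions (k + 1) c.sizes).count x = 0 :=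
      fun x hx => count_lastPositions_of_notMem (.inr hx)
    have hr : ∀ x, x < k + 1 + c.numNodes →
        (lastPositions (k + 1 + c.numNodes) r.sizes).count x = 0 :=
      fun x hx => count_lastPositions_of_notMem (.inl hx)
    rw [sizes, List.cons_append, lastPositions, lastPositions_append, length_sizes, numNodes,
      show c.numNodes + r.numNodes + 1 = (c.numNodes + 1) + r.numNodes by omega,
      pathOfCounts_add, contour_node]
    rw [pathOfCounts_congr (L' := (k + c.numNodes) :: lastPositions (k + 1) c.sizes)
      (k := k) (n := c.numNodes + 1)]
    · rw [pathOfCounts_cons_last, Nat.add_comm c.numNodes, pathOfCounts_add, pathOfCounts_one,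
        ihc, count_lastPositions_of_notMem (.inl (Nat.lt_succ_self k))]
      rw [pathOfCounts_congr (L' := lastPositions (k + 1 + c.numNodes) r.sizes),
        ← Nat.add_assoc, ihr]
      · simp
      · intro x hx _
        rw [List.count_cons_of_ne (by omega), List.count_append, hc x (by omega), zero_add]
    · intro x _ hx
      rw [List.count_cons, List.count_cons, List.count_append, hr x (by omega), add_zero]

end BinaryTree

namespace EdgeTree

open BinaryTree

theorem length_lowerLabels (t : EdgeTree) : t.lowerLabels.length = t.size := by
  induction t with
  | point => rfl
  | graft a c r ihc ihr => simp [lowerLabels, size, ihc, ihr]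

theorem length_labels (t : EdgeTree) : t.labels.length = t.size + 1 := by
  rw [labels, List.length_cons, length_lowerLabels]

theorem lowerPath_eq {t : EdgeTree} (h : IsArities t.labels) :
    t.lowerPath = (ofArities t.labels).contour := by
  set F := ofArities t.labels with hF
  have hlen : t.labels.length = F.numNodes := (numNodes_ofArities _).symm
  rw [← pathOfCounts_lastPositions F 0, lowerPath, hlen, pathOfCounts]
  congr 1
  funext j
  congr 2
  rw [zero_add, certCount, lastPositions_eq_map, length_sizes, hlen, List.count, List.countP_map]
  simp only [certificate, certify_eq h, ← hF]
  rw [List.countP_eq_length_filter]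
  change (List.filter _ (List.range _)).length = _
  congr 2
  funext i
  rw [Bool.eq_iff_iff]
  simp

end EdgeTree

open BinaryTree

/-! ### Degree trees and new intervals -/

/-- The inequalities between the bracket vectors `d` and `u` of the lower and the upper path of
a new interval. -/
def BracketLE : List ℕ → List ℕ → Prop
  | _, [] => True
  | d, x :: u => (d.headD 0 ≤ x ∧ (0 < x → d.headD 0 ≤ u.headD 0)) ∧ BracketLE d.tail u

theorem bracketLE_iff {d u : List ℕ} : BracketLE d u ↔ ∀ i < u.length,
    d.getD i 0 ≤ u.getD i 0 ∧ (0 < u.getD i 0 → d.getD i 0 ≤ u.getD (i + 1) 0) := by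
  induction u generalizing d with
  | nil => simp [BracketLE]
  | cons x u ih =>
    have hd : ∀ (d : List ℕ) i, d.tail.getD i 0 = d.getD (i + 1) 0 := by
      intro d i
      cases d <;> simp
    have hh : ∀ d : List ℕ, d.headD 0 = d.getD 0 0 := by
      intro d
      cases d <;> simp
    rw [BracketLE, ih, List.length_cons]
    constructor
    · rintro ⟨h1, h2⟩ i hi
      cases i with
      | zero =>
        rw [hh, hh] at h1
        rwa [List.getD_cons_zero, List.getD_cons_succ]
      | succ i =>
        have := h2 i (by omega)
        rw [hd] at this
        rwa [List.getD_cons_succ, List.getD_cons_succ]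
    · intro h
      refine ⟨?_, fun i hi => ?_⟩
      · have := h 0 (by omega)
        rw [List.getD_cons_zero, List.getD_cons_succ] at this
        rwa [hh, hh]
      · have := h (i + 1) (by omega)
        rw [List.getD_cons_succ, List.getD_cons_succ] at this
        rwa [hd]

theorem bracketLE_drop {d e u v : List ℕ} (h : BracketLE (d ++ e) (u ++ v))
    (hl : d.length = u.length) : BracketLE e v := by
  induction u generalizing d with
  | nil =>
    rw [List.length_nil, List.length_eq_zero_iff] at hl
    rw [hl] at h
    exact h
  | cons x u ih =>
    cases d with
    | nil => simp at hl
    | cons y d => exact ih h.2 (by simpa using hl)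

theorem sizes_ofArities_append (l m : List ℕ) : ∃ d : List ℕ, d.length = l.length ∧
    (ofArities (l ++ m)).sizes = d ++ (ofArities m).sizes := by
  induction l with
  | nil => exact ⟨[], rfl, rfl⟩
  | cons a l ih =>
    obtain ⟨d, h1, h2⟩ := ih
    exact ⟨_ :: d, by simp [h1], by rw [List.cons_append, sizes_ofArities, h2]; rfl⟩

namespace EdgeTree

/-- The tree without its labels. -/
def shape : EdgeTree → BinaryTree Unit
  | point => nil
  | graft _ c r => node () c.shape r.shape

theorem numNodes_shape (t : EdgeTree) : t.shape.numNodes = t.size := by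
  induction t with
  | point => rfl
  | graft a c r ihc ihr => rw [shape, numNodes, ihc, ihr, size]

theorem contour_eq (t : EdgeTree) : t.contour = t.shape.contour := by
  induction t with
  | point => rfl
  | graft a c r ihc ihr => rw [contour, shape, contour_node, ihc, ihr]

theorem lowerLabels_graft (a : ℕ) (c r : EdgeTree) :
    (graft a c r).lowerLabels = c.labels ++ r.lowerLabels := rfl

/-- Concatenation after the labels of a part of a tree is concatenation of forests. -/
structure LabelsJoin (L : List ℕ) (k : ℕ) : Prop where
  ofArities_append (l : List ℕ) : ofArities (L ++ l) = (ofArities L).join (ofArities l)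
  roots : (ofArities L).roots = k
  isArities_append {l : List ℕ} (hl : IsArities l) : IsArities (L ++ l)

/-- Of the `excess + rootLabel` trees decoded after it, the root takes `rootLabel` as children;
`excess` trees and the root's own tree are left. -/
theorem LabelsJoin.labels {t : EdgeTree} (h : LabelsJoin t.lowerLabels (t.excess + t.rootLabel)) :
    LabelsJoin t.labels (t.excess + 1) := by
  have hle : t.rootLabel ≤ (ofArities t.lowerLabels).roots := by rw [h.roots]; omega
  refine ⟨fun l => ?_, ?_, fun hl => ⟨?_, h.isArities_append hl⟩⟩
  · rw [EdgeTree.labels, List.cons_append, ofArities, ofArities, h.ofArities_append,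
      takeTrees_join hle, dropTrees_join hle, join]
  · have h1 := congrArg BinaryTree.roots (take_join_drop t.rootLabel (ofArities t.lowerLabels))
    rw [roots_join, roots_takeTrees hle, h.roots] at h1
    rw [EdgeTree.labels, ofArities, BinaryTree.roots]
    omega
  · change t.rootLabel ≤ (ofArities (t.lowerLabels ++ _)).roots
    rw [h.ofArities_append, roots_join]
    omega

theorem IsDegree.lowerLabels_join {t : EdgeTree} (ht : t.IsDegree) :
    LabelsJoin t.lowerLabels (t.excess + t.rootLabel) := by
  induction t with
  | point => exact ⟨fun l => rfl, rfl, fun hl => hl⟩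
  | graft a c r ihc ihr =>
    have hc := (ihc ht.1).labels
    have hr := ihr ht.2.1
    rw [lowerLabels_graft]
    refine ⟨fun l => ?_, ?_, fun hl => ?_⟩
    · rw [List.append_assoc, hc.ofArities_append, hr.ofArities_append, hc.ofArities_append,
        join_assoc]
    · rw [hc.ofArities_append, roots_join, hc.roots, hr.roots, ht.2.2.1, excess, rootLabel]
      -- The truncated subtraction in `excess` is exact because `a ≤ c.excess`.
      have := ht.2.2.2
      omega
    · rw [List.append_assoc]
      exact hc.isArities_append (hr.isArities_append hl)

theorem IsDegree.labels_join {t : EdgeTree} (ht : t.IsDegree) :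
    LabelsJoin t.labels (t.excess + 1) := ht.lowerLabels_join.labels

theorem IsDegree.isArities_labels {t : EdgeTree} (ht : t.IsDegree) : IsArities t.labels := by
  have := ht.labels_join.isArities_append (l := []) trivial
  rwa [List.append_nil] at this

theorem numNodes_ofArities_labels (t : EdgeTree) : (ofArities t.labels).numNodes = t.size + 1 := by
  rw [numNodes_ofArities, length_labels]

/-- The root takes at most `c.excess` of the `c.excess + 1` trees decoded from `c`, so it misses one
of their `c.size + 1` nodes. The resulting bound `c.size` is the upper bracket of the next node, and
it implies the Tamari inequality because `c` is part of the tree. -/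
theorem IsDegree.bracketLE_labels {t : EdgeTree} (ht : t.IsDegree) {l u : List ℕ}
    (h : BracketLE (ofArities (t.lowerLabels ++ l)).sizes (t.shape.sizes ++ u)) :
    BracketLE (ofArities (t.labels ++ l)).sizes (t.size :: t.shape.sizes ++ u) := by
  rw [labels, List.cons_append, sizes_ofArities]
  refine ⟨?_, h⟩
  cases t with
  | point =>
    rw [rootLabel]
    exact ⟨Nat.zero_le _, fun h => absurd h (Nat.lt_irrefl 0)⟩
  | graft a c r =>
    have hc := ht.1.labels_join
    have h1 : (takeTrees a (ofArities ((graft a c r).lowerLabels ++ l))).numNodes ≤ c.size := by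
      have hac := ht.2.2.2
      rw [lowerLabels_graft, List.append_assoc, hc.ofArities_append,
        takeTrees_join (by rw [hc.roots]; omega), ← Nat.lt_succ_iff, ← Nat.add_one,
        ← numNodes_ofArities_labels]
      exact numNodes_takeTrees_lt (by rw [hc.roots]; omega)
    rw [← numNodes_shape] at h1
    refine ⟨h1.trans ?_, fun _ => h1⟩
    rw [numNodes_shape, size]
    omega

theorem IsDegree.bracketLE {t : EdgeTree} (ht : t.IsDegree) {l u : List ℕ}
    (h : BracketLE (ofArities l).sizes u) :
    BracketLE (ofArities (t.lowerLabels ++ l)).sizes (t.shape.sizes ++ u) := by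
  induction t generalizing l u with
  | point => exact h
  | graft a c r ihc ihr =>
    have := ht.1.bracketLE_labels (ihc ht.1 (ihr ht.2.1 h))
    rw [lowerLabels_graft, shape, sizes, numNodes_shape, List.append_assoc, List.append_assoc]
    exact this

/-- Only leftmost edges have a nonzero label. -/
def IsLeftLabelled : EdgeTree → Prop
  | point => True
  | graft _ c r => c.IsLeftLabelled ∧ r.IsLeftLabelled ∧ r.rootLabel = 0

theorem IsDegree.isLeftLabelled {t : EdgeTree} (ht : t.IsDegree) : t.IsLeftLabelled := by
  induction t with
  | point => trivial
  | graft a c r ihc ihr => exact ⟨ihc ht.1, ihr ht.2.1, ht.2.2.1⟩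

/-- The converse of `bracketLE_labels`, with arbitrary continuations `l` and `u` so that the
induction applies to `c` followed by the rest of the tree. -/
theorem IsLeftLabelled.isDegree {t : EdgeTree} (ht : t.IsLeftLabelled) {l u : List ℕ}
    (h : BracketLE (ofArities (t.labels ++ l)).sizes (t.size :: t.shape.sizes ++ u)) :
    t.IsDegree := by
  induction t generalizing l u with
  | point => trivial
  | graft a c r ihc ihr =>
    obtain ⟨hc, hr, h0⟩ := ht
    rw [labels, List.cons_append, sizes_ofArities, lowerLabels_graft, shape, sizes, numNodes_shape,
      rootLabel, List.append_assoc] at h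
    have h2 : BracketLE (ofArities (c.labels ++ (r.lowerLabels ++ l))).sizes
        (c.size :: c.shape.sizes ++ (r.shape.sizes ++ u)) := by
      have := h.2
      simpa using this
    have hc' := ihc hc h2
    have h3 : BracketLE (ofArities (r.lowerLabels ++ l)).sizes (r.shape.sizes ++ u) := by
      obtain ⟨d, hd, hd'⟩ := sizes_ofArities_append c.labels (r.lowerLabels ++ l)
      rw [hd'] at h2
      refine bracketLE_drop h2 ?_
      rw [hd, length_labels, List.length_cons, length_sizes, numNodes_shape]
    -- The root of `r` has label `0`, so the first entry added for it is `0` and its inequalities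
    -- are trivial.
    have hr' : r.IsDegree := by
      refine ihr hr (l := l) (u := u) ?_
      rw [labels, List.cons_append, sizes_ofArities, h0]
      exact ⟨⟨Nat.zero_le _, fun _ => Nat.zero_le _⟩, h3⟩
    refine ⟨hc', hr', h0, ?_⟩
    have h4 := h.1.2 (by rw [size]; omega)
    rw [List.headD_cons, hc'.labels_join.ofArities_append] at h4
    change _ ≤ c.size at h4
    -- A label above `c.excess` would take all `c.size + 1` nodes decoded from `c`, one more than
    -- the bracket of the next node.
    by_contra! hlt
    have := numNodes_le_takeTrees_join (F := ofArities c.labels)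
      (G := ofArities (r.lowerLabels ++ l)) (a := a) (by rw [hc'.labels_join.roots]; omega)
    rw [numNodes_ofArities_labels] at this
    omega

/-! ### Labels of a given shape -/

theorem shape_labelFrom (f : ℕ → ℕ) (S : BinaryTree Unit) (a i : ℕ) :
    (labelFrom f a i S).shape = S := by
  induction S generalizing a i with
  | nil => rfl
  | node u c r ihc ihr => rw [labelFrom, shape, ihc, ihr]

theorem isLeftLabelled_labelFrom (f : ℕ → ℕ) (S : BinaryTree Unit) (a i : ℕ) :
    (labelFrom f a i S).IsLeftLabelled := by
  induction S generalizing a i with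
  | nil => trivial
  | node u c r ihc ihr =>
    refine ⟨ihc _ _, ihr _ _, ?_⟩
    cases r <;> rfl

/-- A leaf has no edge to carry its label, so `f` has to vanish at leaves. -/
theorem lowerLabels_labelFrom {f : ℕ → ℕ} {S : BinaryTree Unit} {a i : ℕ}
    (h : ∀ j < S.numNodes, S.sizes.getD j 0 = 0 → f (i + j) = 0) :
    (labelFrom f a i S).lowerLabels = (List.range S.numNodes).map fun j => f (i + j) := by
  induction S generalizing a i with
  | nil => rfl
  | node u c r ihc ihr =>
    have h0 : (labelFrom f (f i) (i + 1) c).rootLabel = f i := by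
      cases c with
      | nil => exact (h 0 (by simp [numNodes]) rfl).symm
      | node u c' r' => rfl
    rw [numNodes] at h
    rw [labelFrom, lowerLabels_graft, labels, h0, ihc, ihr, numNodes,
      show c.numNodes + r.numNodes + 1 = 1 + c.numNodes + r.numNodes by omega, List.range_add,
      List.range_add, List.map_append, List.map_append, List.map_map, List.map_map]
    · rw [List.cons_append]
      simp [Function.comp_def, Nat.add_assoc]
    · intro j hj hs
      rw [show i + 1 + c.numNodes + j = i + (c.numNodes + j + 1) by omega]
      refine h _ (by omega) ?_
      rw [sizes, List.cons_append, List.getD_cons_succ, List.getD_append_right _ _ _ _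
        (by rw [length_sizes]; omega), length_sizes, Nat.add_sub_cancel_left, hs]
    · intro j hj hs
      rw [show i + 1 + j = i + (j + 1) by omega]
      refine h _ (by omega) ?_
      rw [sizes, List.cons_append, List.getD_cons_succ, List.getD_append _ _ _ _
        (by rwa [length_sizes]), hs]

theorem labelFrom_shape {t : EdgeTree} (ht : t.IsLeftLabelled) {f : ℕ → ℕ} {i : ℕ}
    (h : ∀ j < t.size, f (i + j) = t.lowerLabels.getD j 0) :
    labelFrom f t.rootLabel i t.shape = t := by
  induction t generalizing i with
  | point => rfl
  | graft a c r ihc ihr =>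
    obtain ⟨hc, hr, h0⟩ := ht
    rw [size] at h
    have hi : f i = c.rootLabel := h 0 (by omega)
    have hc' := ihc hc (i := i + 1) fun j hj => by
      have := h (j + 1) (by omega)
      rw [lowerLabels_graft, labels, List.cons_append, List.getD_cons_succ,
        List.getD_append _ _ _ _ (by rwa [length_lowerLabels])] at this
      rw [← this]
      congr 1
      omega
    have hr' := ihr hr (i := i + 1 + c.size) fun j hj => by
      have := h (j + 1 + c.size) (by omega)
      rw [lowerLabels_graft, List.getD_append_right _ _ _ _ (by rw [length_labels]; omega),
        length_labels] at this
      rw [show j + 1 + c.size - (c.size + 1) = j by omega] at this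
      rw [← this]
      congr 1
      omega
    rw [shape, labelFrom, numNodes_shape, rootLabel, hi, hc']
    rw [h0] at hr'
    rw [hr']

end EdgeTree

/-! ### Bracket vectors and types of Dyck words, read from forests -/

namespace DyckWord

theorem semilength_ofTree (F : BinaryTree Unit) : (ofTree F).semilength = F.numNodes :=
  count_contour F

theorem bracket_ofTree (F : BinaryTree Unit) (i : ℕ) : (ofTree F).bracket i = F.sizes.getD i 0 := by
  by_cases hi : i < F.numNodes
  · rw [bracket, sizes_getD, ← count_contour, ← matchedPart_contour F hi]
    rfl
  · have := afterUp_add_contour F (i - F.numNodes) []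
    rw [Nat.add_sub_cancel' (by omega), List.append_nil] at this
    rw [bracket, matchedPart, show (ofTree F).toList = F.contour from rfl, this,
      List.getD_eq_default _ _ (by rw [length_sizes]; omega), afterUp, untilBelow, List.count_nil]

theorem typeOne_ofTree (F : BinaryTree Unit) {i : ℕ} (hi : i < F.numNodes) :
    (ofTree F).TypeOne i ↔ F.arities.getD i 0 ≠ 0 := head_afterUp_contour F hi

theorem toTree_insidePart_ofTree (S : BinaryTree Unit) :
    (ofTree (node () S nil)).insidePart.toTree = S := by
  simp [ofTree, toTree_ofTree]

end DyckWord

namespace BinaryTree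

theorem numNodes_eq_zero {F : BinaryTree Unit} : F.numNodes = 0 ↔ F = nil := by
  cases F <;> simp

theorem roots_eq_zero {F : BinaryTree Unit} : F.roots = 0 ↔ F = nil := by
  cases F <;> simp [roots]

theorem arities_getD_eq_zero {F : BinaryTree Unit} {i : ℕ} :
    F.arities.getD i 0 = 0 ↔ F.sizes.getD i 0 = 0 := by
  rw [arities_getD, sizes_getD, numNodes_eq_zero, roots_eq_zero]

end BinaryTree

theorem List.map_getD_range (l : List ℕ) : ((List.range l.length).map fun i => l.getD i 0) = l := by
  refine List.ext_getElem (by simp) fun i h1 h2 => ?_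
  rw [List.getElem_map, List.getElem_range, List.getD_eq_getElem _ _ h2]

/-! ### The interval of a degree tree -/

open DyckWord

namespace EdgeTree

theorem sizes_node_shape (t : EdgeTree) :
    (node () t.shape nil).sizes = t.size :: t.shape.sizes := by
  rw [sizes, sizes, List.append_nil, numNodes_shape]

variable {n : ℕ} {t : EdgeTree}

/-- The new interval of a degree tree. -/
def IsDegree.interval (ht : t.IsDegree) (hn : t.size = n) : NewInterval (n + 1) :=
  have h : BracketLE (ofArities t.labels).sizes (node () t.shape nil).sizes := by
    have h1 := ht.bracketLE (l := []) (u := []) trivial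
    have h2 := ht.bracketLE_labels h1
    rwa [List.append_nil, List.append_nil, ← sizes_node_shape] at h2
  have hl : (node () t.shape nil).sizes.length = n + 1 := by
    rw [length_sizes, numNodes, numNodes_shape, hn, numNodes]
  { lower := ofTree (ofArities t.labels)
    upper := ofTree (node () t.shape nil)
    lower_size := by rw [semilength_ofTree, numNodes_ofArities_labels, hn]
    upper_size := by rw [semilength_ofTree, numNodes, numNodes_shape, hn, numNodes]
    tamari := fun i hi => by
      rw [bracket_ofTree, bracket_ofTree]
      exact (bracketLE_iff.mp h i (by omega)).1
    bracket_first := by rw [bracket_ofTree, sizes_node_shape, List.getD_cons_zero, hn]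
    bracket_next := fun i hi => by
      rw [bracket_ofTree, bracket_ofTree, bracket_ofTree]
      exact (bracketLE_iff.mp h i (by omega)).2 }

theorem IsDegree.toList_lower_interval (ht : t.IsDegree) (hn : t.size = n) :
    (ht.interval hn).lower.toList = t.lowerPath := (lowerPath_eq ht.isArities_labels).symm

theorem IsDegree.toList_upper_interval (ht : t.IsDegree) (hn : t.size = n) :
    (ht.interval hn).upper.toList = t.upperPath := by
  change BinaryTree.contour (node () t.shape nil) = _
  rw [contour_node, upperPath, contour_eq, contour_nil]

theorem risingContacts_matchedPart {F : BinaryTree Unit} {i : ℕ} (hi : i < F.numNodes) :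
    risingContacts (matchedPart (ofTree F).toList i) = F.arities.getD i 0 := by
  change risingContacts (matchedPart F.contour i) = _
  rw [matchedPart_contour F hi, risingContacts_contour, arities_getD]

theorem IsDegree.toTree_interval (ht : t.IsDegree) (hn : t.size = n) :
    (ht.interval hn).toTree = t := by
  have hf : ∀ i < n + 1, risingContacts (matchedPart (ht.interval hn).lower.toList i) =
      t.labels.getD i 0 := by
    intro i hi
    rw [← arities_ofArities ht.isArities_labels]
    exact risingContacts_matchedPart (by rwa [numNodes_ofArities_labels, hn])
  have hs : (ht.interval hn).upper.insidePart.toTree = t.shape := toTree_insidePart_ofTree _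
  simp only [NewInterval.toTree]
  rw [hs, hf 0 (by omega)]
  refine labelFrom_shape ht.isLeftLabelled fun j hj => ?_
  rw [hf _ (by omega), Nat.add_comm, labels, List.getD_cons_succ]

/-- The labels of `I.toTree` are the arities of the forest of the lower path, so decoding them
restores this path, and the shape restores the upper one. The interval inequalities are those that
make the tree a degree tree. -/
theorem exists_interval_eq (I : NewInterval (n + 1)) :
    ∃ (ht : I.toTree.IsDegree) (hn : I.toTree.size = n), ht.interval hn = I := by
  obtain ⟨F, hF⟩ : ∃ F, ofTree F = I.lower := ⟨_, ofTree_toTree _⟩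
  obtain ⟨G, hG⟩ : ∃ G, ofTree G = I.upper := ⟨_, ofTree_toTree _⟩
  have hFn : F.numNodes = n + 1 := by rw [← semilength_ofTree, hF, I.lower_size]
  have hGn : G.numNodes = n + 1 := by rw [← semilength_ofTree, hG, I.upper_size]
  obtain ⟨S, rfl⟩ : ∃ S, G = node () S nil := by
    have h0 := I.bracket_first
    rw [← hG, bracket_ofTree] at h0
    rcases G with _ | ⟨_, S, R⟩
    · simp at hGn
    · rw [numNodes] at hGn
      rw [sizes, List.cons_append, List.getD_cons_zero] at h0
      have : R = nil := numNodes_eq_zero.mp (by omega)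
      exact ⟨S, by rw [this]⟩
  have hSn : S.numNodes = n := by
    rw [numNodes, numNodes] at hGn
    omega
  have hle := I.tamari
  have hnext := I.bracket_next
  rw [← hF, ← hG] at hle hnext
  simp only [bracket_ofTree] at hle hnext
  -- A leaf of the upper tree has bracket `0`, hence so has the lower node by the Tamari inequality.
  -- The labels that `labelFrom` drops at leaves are therefore `0`.
  have hleaf : ∀ i < n + 1, (node () S nil).sizes.getD i 0 = 0 → F.arities.getD i 0 = 0 := by
    intro i hi h
    have := hle i hi
    exact arities_getD_eq_zero.mpr (by omega)
  have hsz : (node () S nil).sizes = n :: S.sizes := by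
    rw [sizes, sizes, List.append_nil, hSn]
  have hf : ∀ i < n + 1, risingContacts (matchedPart I.lower.toList i) = F.arities.getD i 0 := by
    intro i hi
    rw [← hF]
    exact risingContacts_matchedPart (by omega)
  set f : ℕ → ℕ := fun i => risingContacts (matchedPart I.lower.toList i) with hfdef
  have ht : I.toTree = labelFrom f (f 0) 1 S := by
    rw [NewInterval.toTree, ← hG, toTree_insidePart_ofTree]
  have hshape : I.toTree.shape = S := by rw [ht, shape_labelFrom]
  have hsize : I.toTree.size = n := by rw [← numNodes_shape, hshape, hSn]
  have hroot : I.toTree.rootLabel = f 0 := by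
    rw [ht]
    cases S with
    | nil =>
      rw [labelFrom, rootLabel, hfdef]
      refine ((hf 0 (by omega)).trans (hleaf 0 (by omega) ?_)).symm
      rfl
    | node u c r => rfl
  have hlab : I.toTree.labels = F.arities := by
    rw [labels, hroot, ht, lowerLabels_labelFrom, hSn, ← List.map_getD_range F.arities,
      length_arities, hFn, Nat.add_comm n, List.range_add, List.map_append, List.map_map]
    · congr 1
      · exact hf 0 (by omega)
      · refine List.map_congr_left fun j hj => ?_
        rw [List.mem_range] at hj
        exact hf (1 + j) (by omega)
    · intro j hj hs
      refine (hf (1 + j) (by omega)).trans (hleaf _ (by omega) ?_)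
      rw [hsz, Nat.add_comm, List.getD_cons_succ, hs]
  have hdeg : I.toTree.IsDegree := by
    refine IsLeftLabelled.isDegree (l := []) (u := []) ?_ ?_
    · rw [ht]
      exact isLeftLabelled_labelFrom _ _ _ _
    · rw [List.append_nil, List.append_nil, hlab, ofArities_arities, hshape, hsize, ← hsz,
        bracketLE_iff]
      intro i hi
      rw [length_sizes, hGn] at hi
      exact ⟨hle i hi, hnext i hi⟩
  refine ⟨hdeg, hsize, NewInterval.ext ?_ ?_⟩
  · change ofTree (ofArities I.toTree.labels) = _
    rw [hlab, ofArities_arities, hF]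
  · change ofTree (node () I.toTree.shape nil) = _
    rw [hshape, hG]

/-! ### Statistics -/

/-- For all nodes but the root, in preorder, the label of the leftmost descending edge and the
number of nodes below. -/
def lowerData : EdgeTree → List (ℕ × ℕ)
  | point => []
  | graft _ c r => (c.rootLabel, c.size) :: c.lowerData ++ r.lowerData

/-- For all nodes, in preorder, the label of the leftmost descending edge and the number of nodes
below. -/
def data (t : EdgeTree) : List (ℕ × ℕ) := (t.rootLabel, t.size) :: t.lowerData

theorem map_fst_data (t : EdgeTree) : t.data.map Prod.fst = t.labels := by
  have : t.lowerData.map Prod.fst = t.lowerLabels := by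
    induction t with
    | point => rfl
    | graft a c r ihc ihr => simp [lowerData, lowerLabels, ihc, ihr]
  rw [data, List.map_cons, this, labels]

theorem map_snd_data (t : EdgeTree) : t.data.map Prod.snd = (node () t.shape nil).sizes := by
  have : t.lowerData.map Prod.snd = t.shape.sizes := by
    induction t with
    | point => rfl
    | graft a c r ihc ihr => simp [lowerData, shape, sizes, numNodes_shape, ihc, ihr]
  rw [data, List.map_cons, this, sizes_node_shape]

theorem length_data (t : EdgeTree) : t.data.length = t.size + 1 := by
  rw [← List.length_map (f := Prod.fst), map_fst_data, length_labels]

theorem countP_lowerData_leaf (t : EdgeTree) :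
    t.lowerData.countP (fun p => p.1 = 0 ∧ p.2 = 0) = t.numLeaves := by
  induction t with
  | point => rfl
  | graft a c r ihc ihr =>
    have h : c.size = 0 → c.rootLabel = 0 := by
      rw [size_eq_zero]
      rintro rfl
      rfl
    rw [lowerData, List.cons_append, List.countP_cons, List.countP_append, ihc, ihr, numLeaves]
    congr 1
    by_cases hc : c.size = 0 <;> simp [hc, h]

theorem countP_lowerData_zero (t : EdgeTree) :
    t.lowerData.countP (fun p => p.1 = 0 ∧ p.2 ≠ 0) = t.numLowerZeros := by
  induction t with
  | point => rfl
  | graft a c r ihc ihr =>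
    rw [lowerData, List.cons_append, List.countP_cons, List.countP_append, ihc, ihr,
      numLowerZeros]
    congr 1
    simp [and_comm]

end EdgeTree

theorem List.card_filter_range_getD {α : Type} (L : List α) (d : α) (p : α → Prop)
    [DecidablePred p] :
    ((Finset.range L.length).filter fun i => p (L.getD i d)).card = L.countP (fun a => p a) := by
  induction L with
  | nil => rfl
  | cons a L ih =>
    rw [Finset.card_filter] at ih ⊢
    rw [List.length_cons, Finset.sum_range_succ']
    simp only [List.getD_cons_zero, List.getD_cons_succ]
    rw [ih, List.countP_cons]
    simp

namespace EdgeTree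

variable {n : ℕ} {t : EdgeTree}

theorem IsDegree.typeOne_lower (ht : t.IsDegree) (hn : t.size = n) {i : ℕ} (hi : i < n + 1) :
    (ht.interval hn).lower.TypeOne i ↔ (t.data.getD i (0, 0)).1 ≠ 0 := by
  have h1 := typeOne_ofTree (ofArities t.labels) (i := i) (by rwa [numNodes_ofArities_labels, hn])
  refine Iff.trans h1 ?_
  rw [arities_ofArities ht.isArities_labels, ← map_fst_data]
  rw [show (0 : ℕ) = Prod.fst ((0 : ℕ), (0 : ℕ)) from rfl, List.getD_map]

theorem IsDegree.typeOne_upper (ht : t.IsDegree) (hn : t.size = n) {i : ℕ} (hi : i < n + 1) :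
    (ht.interval hn).upper.TypeOne i ↔ (t.data.getD i (0, 0)).2 ≠ 0 := by
  have h1 := typeOne_ofTree (node () t.shape nil) (i := i)
    (by rwa [numNodes, numNodes_shape, hn, numNodes])
  refine Iff.trans h1 ?_
  rw [Ne, arities_getD_eq_zero, ← map_snd_data]
  rw [show (0 : ℕ) = Prod.snd ((0 : ℕ), (0 : ℕ)) from rfl, List.getD_map]

theorem IsDegree.c00_eq (ht : t.IsDegree) (hn : t.size = n) :
    (ht.interval hn).c00 = t.data.countP (fun p => p.1 = 0 ∧ p.2 = 0) := by
  rw [← List.card_filter_range_getD _ (0, 0), length_data, hn, NewInterval.c00]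
  congr 1
  refine Finset.filter_congr fun i hi => ?_
  rw [Finset.mem_range] at hi
  rw [ht.typeOne_lower hn hi, ht.typeOne_upper hn hi, not_not, not_not]

theorem IsDegree.c01_eq (ht : t.IsDegree) (hn : t.size = n) :
    (ht.interval hn).c01 = t.data.countP (fun p => p.1 = 0 ∧ p.2 ≠ 0) := by
  rw [← List.card_filter_range_getD _ (0, 0), length_data, hn, NewInterval.c01]
  congr 1
  refine Finset.filter_congr fun i hi => ?_
  rw [Finset.mem_range] at hi
  rw [ht.typeOne_lower hn hi, ht.typeOne_upper hn hi, not_not]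

theorem IsDegree.c00_interval (ht : t.IsDegree) (hn : t.size = n) (h : 0 < n) :
    (ht.interval hn).c00 = t.numLeaves := by
  rw [ht.c00_eq, data, List.countP_cons, countP_lowerData_leaf]
  simp [hn, h.ne']

theorem IsDegree.c01_interval (ht : t.IsDegree) (hn : t.size = n) : (ht.interval hn).c01 =
    t.numLowerZeros + if t.size ≠ 0 ∧ t.rootLabel = 0 then 1 else 0 := by
  rw [ht.c01_eq, data, List.countP_cons, countP_lowerData_zero]
  simp [and_comm]

end EdgeTree

namespace NewInterval

/-- The Tamari inequality excludes the pair of types `1` and `0`. -/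
theorem c00_add_c01_add_c11 {n : ℕ} (I : NewInterval n) : I.c00 + I.c01 + I.c11 = n := by
  obtain ⟨F, hF⟩ : ∃ F, ofTree F = I.lower := ⟨_, ofTree_toTree _⟩
  obtain ⟨G, hG⟩ : ∃ G, ofTree G = I.upper := ⟨_, ofTree_toTree _⟩
  have hFn : F.numNodes = n := by rw [← semilength_ofTree, hF, I.lower_size]
  have hGn : G.numNodes = n := by rw [← semilength_ofTree, hG, I.upper_size]
  have hle : ∀ i < n, I.lower.TypeOne i → I.upper.TypeOne i := by
    intro i hi
    have h := I.tamari i hi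
    rw [← hF, ← hG, bracket_ofTree, bracket_ofTree] at h
    rw [← hF, ← hG, typeOne_ofTree _ (by omega), typeOne_ofTree _ (by omega), Ne, Ne,
      arities_getD_eq_zero, arities_getD_eq_zero]
    omega
  simp only [c00, c01, c11, Finset.card_filter]
  rw [← Finset.sum_add_distrib, ← Finset.sum_add_distrib, Finset.sum_congr rfl (g := fun _ => 1)]
  · simp
  · intro i hi
    have := hle i (Finset.mem_range.mp hi)
    by_cases h1 : I.lower.TypeOne i <;> by_cases h2 : I.upper.TypeOne i <;> simp [h1, h2]
    exact h2 (this h1)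

end NewInterval

theorem EdgeTree.IsDegree.rcont_interval {n : ℕ} {t : EdgeTree} (ht : t.IsDegree)
    (hn : t.size = n) : (ht.interval hn).rcont = t.excess + 1 :=
  (risingContacts_contour _).trans ht.labels_join.roots

/-! ### The interval of a map, isomorphism classes and statistics -/

namespace LabelledMap

variable {n : ℕ}

theorem isDegree_toTree (M : LabelledMap n) : M.1.toTree.IsDegree := by
  obtain ⟨t, ht, h⟩ := EdgeTree.exists_toMap_iso M
  rwa [EdgeTree.toTree_eq_of_iso ht h]

theorem toMap_toTree_iso (M : LabelledMap n) : M.1.toTree.toMap.Iso M.1 := by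
  obtain ⟨t, ht, h⟩ := EdgeTree.exists_toMap_iso M
  rwa [EdgeTree.toTree_eq_of_iso ht h]

theorem size_toTree (M : LabelledMap n) : M.1.toTree.size = n :=
  EdgeTree.size_eq_of_iso M.toMap_toTree_iso

/-- The new interval of a map. -/
noncomputable def interval (M : LabelledMap n) : NewInterval (n + 1) :=
  M.isDegree_toTree.interval M.size_toTree

theorem toTree_interval (M : LabelledMap n) : M.interval.toTree = M.1.toTree :=
  M.isDegree_toTree.toTree_interval M.size_toTree

/-- The tree is a complete invariant, because it rebuilds the map up to isomorphism. -/
theorem toTree_eq_iff {M N : LabelledMap n} : M.1.toTree = N.1.toTree ↔ M.1.Iso N.1 := by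
  refine ⟨fun h => ?_, fun h => ?_⟩
  · have := M.toMap_toTree_iso
    rw [h] at this
    exact this.symm.trans N.toMap_toTree_iso
  · exact (EdgeTree.toTree_eq_of_iso M.isDegree_toTree (M.toMap_toTree_iso.trans h)).symm

theorem interval_eq_iff {M N : LabelledMap n} : M.interval = N.interval ↔ M.1.Iso N.1 := by
  rw [← toTree_eq_iff]
  refine ⟨fun h => ?_, fun h => ?_⟩
  · rw [← M.toTree_interval, h, N.toTree_interval]
  · unfold interval
    congr 1

theorem exists_interval_eq (I : NewInterval (n + 1)) : ∃ M : LabelledMap n, M.interval = I := by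
  obtain ⟨ht, hn, h⟩ := EdgeTree.exists_interval_eq I
  obtain ⟨M, hM⟩ := EdgeTree.exists_labelledMap hn
  have := EdgeTree.toTree_eq_of_iso ht hM
  refine ⟨M, ?_⟩
  rw [← h]
  unfold interval
  congr 1

theorem numWhite_eq_c00 (M : LabelledMap n) (hn : 0 < n) : M.1.numWhite = M.interval.c00 := by
  rw [interval, EdgeTree.IsDegree.c00_interval _ _ hn, RootedBipMap.numWhite_eq,
    ← M.toMap_toTree_iso.numCycles_white, EdgeTree.numCycles_white_toMap]

theorem numBlack_eq_c01 (M : LabelledMap n) (hn : 0 < n) : M.1.numBlack = M.interval.c01 := by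
  have : Nonempty (Fin n) := ⟨⟨0, hn⟩⟩
  rw [interval, EdgeTree.IsDegree.c01_interval, RootedBipMap.numBlack_of_nonempty,
    ← M.toMap_toTree_iso.numCycles_black, EdgeTree.numCycles_black_toMap M.isDegree_toTree]

/-- The three counts of type pairs add up to `n + 1`, while vertices and faces add up to `n + 2`;
the two vertex statistics then leave one possibility. For `n = 0` the only index is counted by
`c00`. -/
theorem numFace_eq_c11 (M : LabelledMap n) : M.1.numFace = 1 + M.interval.c11 := by
  have h1 := M.interval.c00_add_c01_add_c11
  rcases Nat.eq_zero_or_pos n with rfl | hn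
  · have hp : M.1.toTree = .point := EdgeTree.size_eq_zero.mp M.size_toTree
    have h2 : M.interval.c00 = 1 := by
      rw [interval, EdgeTree.IsDegree.c00_eq, hp]
      rfl
    rw [RootedBipMap.numFace, if_pos Fin.isEmpty]
    omega
  · have h2 := M.2.euler
    rw [Nat.card_fin, M.numWhite_eq_c00 hn, M.numBlack_eq_c01 hn] at h2
    omega

theorem outdeg_add_one (M : LabelledMap n) : M.1.outdeg + 1 = M.interval.rcont := by
  rw [interval, EdgeTree.IsDegree.rcont_interval, ← M.toMap_toTree_iso.outdeg_eq,
    EdgeTree.outdeg_toMap M.isDegree_toTree]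

end LabelledMap

/-- The bijection from maps to new intervals. -/
noncomputable def PlanarMap.equivNewInterval (n : ℕ) : PlanarMap n ≃ NewInterval (n + 1) :=
  Equiv.ofBijective
    (Quotient.lift LabelledMap.interval fun _ _ h => LabelledMap.interval_eq_iff.mpr h) <| by
  refine ⟨?_, fun I => ?_⟩
  · rintro ⟨M⟩ ⟨N⟩ h
    exact Quotient.sound (LabelledMap.interval_eq_iff.mp h)
  · obtain ⟨M, hM⟩ := LabelledMap.exists_interval_eq I
    exact ⟨⟦M⟧, hM⟩

theorem PlanarMap.equivNewInterval_mk {n : ℕ} (M : LabelledMap n) :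
    equivNewInterval n ⟦M⟧ = M.interval := rfl

/-- The bijection is the composition of the transformations from maps to trees and from trees to
intervals, and its inverse is the composition of the transformations from intervals to trees and
from trees to maps. For `n = 0`, the only map is a single black vertex and the only interval
has `c00 = 1` and `c01 = 0`, so that the vertex statistics are only compared for `n > 0`. -/
theorem theorem1 (n : ℕ) :
    ∃ I_M : PlanarMap n ≃ NewInterval (n + 1),
      (∀ M : LabelledMap n,
        (I_M ⟦M⟧).lower.toList = M.1.toTree.lowerPath ∧
        (I_M ⟦M⟧).upper.toList = M.1.toTree.upperPath) ∧
      (∀ (I : NewInterval (n + 1)) (M : LabelledMap n),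
        I_M.symm I = ⟦M⟧ ↔ I.toTree.toMap.Iso M.1) ∧
      (∀ M : LabelledMap n,
        (0 < n → M.1.numWhite = (I_M ⟦M⟧).c00) ∧
        (0 < n → M.1.numBlack = (I_M ⟦M⟧).c01) ∧
        M.1.numFace = 1 + (I_M ⟦M⟧).c11 ∧
        (M.1.outdeg : ℤ) = ((I_M ⟦M⟧).rcont : ℤ) - 1) := by
  refine ⟨PlanarMap.equivNewInterval n, fun M => ⟨?_, ?_⟩, fun I M => ?_, fun M => ?_⟩
  · exact M.isDegree_toTree.toList_lower_interval M.size_toTree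
  · exact M.isDegree_toTree.toList_upper_interval M.size_toTree
  · obtain ⟨N, rfl⟩ := LabelledMap.exists_interval_eq I
    refine (Equiv.symm_apply_eq _).trans ?_
    rw [PlanarMap.equivNewInterval_mk, LabelledMap.interval_eq_iff, N.toTree_interval]
    exact ⟨N.toMap_toTree_iso.trans, N.toMap_toTree_iso.symm.trans⟩
  · rw [PlanarMap.equivNewInterval_mk]
    refine ⟨M.numWhite_eq_c00, M.numBlack_eq_c01, M.numFace_eq_c11, ?_⟩
    have := M.outdeg_add_one
    omega
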